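/- Graphs are finite and may have loops and multiple edges. A loop counts twice in a degree. A circle is a connected 2-regular subgraph. In a signed graph $\Sigma=(G,\sigma)$, $\sigma:E(G)\to\{+,-\}$, the sign of a circle is the product of the signs of its edges; $\Sigma$ is balanced if all its circles are positive. An edge $b$ is a balancing edge if $\Sigma$ can be switched (replacing $\sigma(e)$, for $e$ with endpoints $x,y$, by $\zeta(x)\sigma(e)\zeta(y)$ for some $\zeta:V(G)\to\{+,-\}$) so that $b$ is the only negative edge. We write $[v,C,+]$ (positive vertex battery), respectively $[e,C,+]$ (positive edge battery), if $C$ is the unique positive circle containing the vertex $v$, respectively the edge $e$. A cutpoint of $G$ is a vertex $v$ such that $G=H_1\cup H_2$ with $H_1\cap H_2=\{v\}$ for subgraphs $H_1,H_2$ that each have at least one edge; a block is a maximal connected subgraph without a cutpoint. If $\deg_B(v)=2$ and $v$ has edges $v_1v$, $v_2v$ in $B$, then $B{\downarrow}v$ is obtained by replacing these two edges and $v$ with a single edge $e_v{:}v_1v_2$ with $\sigma(e_v)=\sigma(v_1v)\sigma(v_2v)$; if $B$ is a single loop at $v$, then $B{\downarrow}v=B$ and $e_v$ is this loop. For a circle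 $C$ of $B$ through $v$, $C{\downarrow}v$ is the corresponding circle of $B{\downarrow}v$. Let $C$ be a circle of a graph $B$. A chord of $C$ is an edge outside $C$ that joins two different vertices of $C$. A bridge of $C$ is a chord of $C$, or a connected component of $B\setminus V(C)$ together with all edges joining it to $C$; its vertices of attachment are its vertices on $C$. Two chords $c_1,c_2$ cross if $C\cup c_1\cup c_2$ is a subdivision of $K_4$. The endpoints of the chords divide $C$ into paths, called segments; a handle is a segment whose endpoints are joined by a chord; $C$ is 2-handled if no two of its chords cross and it has exactly two handles. $B$ is $C$-layered if every bridge of $C$ has exactly two vertices of attachment and $C$ is 2-handled in the graph $C^*$ obtained by replacing each bridge with a single chord between its vertices of attachment. For a block $B$, a vertex $v$ of $B$ and a circle $C$ of $B$, let $(\ast)$ be the statement that one of the following holds: 1. $B=C$ is a balanced circle; 2. $B$ is unbalanced, $\deg_B(v)=2$, $B{\downarrow}v$ is $(C{\downarrow}v)$-layered, and $[e_v,C{\downarrow}v,+]$ is a positive edge battery in $B{\downarrow}v$; 3. $B$ is unbalanced, $\deg_B(v)=3$, $B$ is $C$-layered, $C$ has exactly one bridge in $B$, $v$ is a vertex of attachment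 of this bridge, and $[e,C,+]$ is a positive edge battery in $B$ for every edge $e$ of $C$. **Theorem.** Let $\Sigma$ be a signed graph and $v$ a vertex of $\Sigma$ such that every block containing $v$ contains a circle. (a) For every block $B$ of $\Sigma$ containing $v$ and every subgraph $C$: $C$ is the unique positive circle of $B$ that contains $v$ if and only if $C$ is a circle of $B$ and $(\ast)$ holds for $B,v,C$. (b) For every subgraph $C$: $[v,C,+]$ is a positive vertex battery in $\Sigma$ if and only if there is a block $B$ of $\Sigma$ containing $v$ such that $C$ is a circle of $B$ and (i) $(\ast)$ holds for $B,v,C$, and $B$ is the only block containing $v$ for which $(\ast)$ holds with some circle; and (ii) in every other block $B'$ of $\Sigma$ containing $v$, $\deg_{B'}(v)=2$ and $e_v$ is a balancing edge in $B'{\downarrow}v$. -/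

import Mathlib

open scoped Graph

namespace Graph

variable {α β : Type*}

/-! ### Graphs (finite multigraphs with loops are terms of Mathlib's `Graph α β`) -/

/-- A graph is connected if it is nonempty and any two vertices are joined by a walk. -/
def IsConn (G : Graph α β) : Prop :=
  V(G).Nonempty ∧ ∀ x ∈ V(G), ∀ y ∈ V(G), Relation.ReflTransGen G.Adj x y

/-- The degree of a vertex: the number of incident edges, where a loop counts twice. -/
noncomputable def deg (G : Graph α β) (v : α) : ℕ :=
  (G.incidenceSet v).ncard + (G.loopSet v).ncard

/-- A circle: a connected 2-regular graph. -/
def IsCircle (C : Graph α β) : Prop :=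
  C.IsConn ∧ ∀ x ∈ V(C), C.deg x = 2

/-- `C` is a circle of `G`: a subgraph of `G` that is a circle. -/
def IsCircleOf (C G : Graph α β) : Prop :=
  C ≤ G ∧ C.IsCircle

/-- `P` is (the graph of) a path with at least one edge and endpoints `x`, `y`: a connected graph
in which `x ≠ y` have degree one and all other vertices, the interior ones, have degree two. -/
def IsPathFromTo (P : Graph α β) (x y : α) : Prop :=
  P.IsConn ∧ x ≠ y ∧ x ∈ V(P) ∧ y ∈ V(P) ∧ P.deg x = 1 ∧ P.deg y = 1 ∧
    ∀ z ∈ V(P), z ≠ x → z ≠ y → P.deg z = 2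

/-- `v` is a cutpoint of `G`: there are subgraphs `H₁`, `H₂`, each with at least one edge, with
`H₁ ∪ H₂ = G` and `H₁ ∩ H₂ = {v}`. -/
def IsCutpoint (G : Graph α β) (v : α) : Prop :=
  ∃ H₁ H₂ : Graph α β, H₁ ≤ G ∧ H₂ ≤ G ∧ E(H₁).Nonempty ∧ E(H₂).Nonempty ∧
    V(H₁) ∪ V(H₂) = V(G) ∧ E(H₁) ∪ E(H₂) = E(G) ∧
    V(H₁) ∩ V(H₂) = {v} ∧ E(H₁) ∩ E(H₂) = ∅

/-- `B` is a block of `G`: a maximal connected subgraph that contains no cutpoint (of itself). -/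
def IsBlockOf (B G : Graph α β) : Prop :=
  Maximal (fun H : Graph α β => H ≤ G ∧ H.IsConn ∧ ∀ x, ¬ H.IsCutpoint x) B

/-- `H` is a subdivision of `K₄`: the union of six paths `P i j` (`i < j`) that join four distinct
vertices pairwise and that meet only in common endpoints. -/
def IsSubdivisionK4 (H : Graph α β) : Prop :=
  ∃ (f : Fin 4 → α) (P : Fin 4 → Fin 4 → Graph α β), Function.Injective f ∧
    (∀ i j, i < j → P i j ≤ H ∧ (P i j).IsPathFromTo (f i) (f j)) ∧
    (∀ i j k l, i < j → k < l → (i, j) ≠ (k, l) →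
      V(P i j) ∩ V(P k l) ⊆ f '' (({i, j} : Set (Fin 4)) ∩ {k, l})) ∧
    (∀ x ∈ V(H), ∃ i j, i < j ∧ x ∈ V(P i j)) ∧
    (∀ e ∈ E(H), ∃ i j, i < j ∧ e ∈ E(P i j))

/-! ### Chords, bridges and layering -/

/-- The edge `c` is a chord of `C` (in `G`) with endpoints `x` and `y`. -/
def IsChordWithEnds (G C : Graph α β) (c : β) (x y : α) : Prop :=
  c ∉ E(C) ∧ x ∈ V(C) ∧ y ∈ V(C) ∧ x ≠ y ∧ G.IsLink c x y

/-- The edge `c` is a chord of `C` in `G`. -/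
def IsChord (G C : Graph α β) (c : β) : Prop :=
  ∃ x y, G.IsChordWithEnds C c x y

/-- Two chords `c₁`, `c₂` of `C` cross: `C ∪ c₁ ∪ c₂` is a subdivision of `K₄`. -/
def ChordsCross (G C : Graph α β) (c₁ c₂ : β) : Prop :=
  ((G.induce V(C)).restrict (E(C) ∪ {c₁, c₂})).IsSubdivisionK4

/-- The set of all vertices of `C` that are endpoints of some chord of `C`. -/
def chordEnds (G C : Graph α β) : Set α :=
  {x | ∃ c y, G.IsChordWithEnds C c x y}

/-- `P` is a handle of `C` in `G`: a segment of `C` (one of the paths into which the endpoints of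
chords divide `C`) whose two endpoints are joined by a chord. -/
def IsHandle (G C P : Graph α β) : Prop :=
  ∃ x y, P ≤ C ∧ P.IsPathFromTo x y ∧ x ∈ G.chordEnds C ∧ y ∈ G.chordEnds C ∧
    (∀ z ∈ V(P), z ∈ G.chordEnds C → z = x ∨ z = y) ∧
    ∃ c, G.IsChordWithEnds C c x y

/-- The circle `C` of `G` is 2-handled: no two chords cross and there are exactly two handles. -/
def IsTwoHandled (G C : Graph α β) : Prop :=
  (∀ c₁ c₂, G.IsChord C c₁ → G.IsChord C c₂ → ¬ G.ChordsCross C c₁ c₂) ∧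
    {P : Graph α β | G.IsHandle C P}.ncard = 2

/-- The subgraph `D` of `B` is a bridge of the circle `C`: either a chord of `C` (with its two
endpoints), or a connected component `K` of `B \ V(C)` together with all edges joining `K` to `C`
(and their endpoints). -/
def IsBridgeOf (B C D : Graph α β) : Prop :=
  D ≤ B ∧
    ((∃ c x y, B.IsChordWithEnds C c x y ∧ V(D) = {x, y} ∧ E(D) = {c}) ∨
      ∃ K : Graph α β, Maximal (fun H : Graph α β => H ≤ B.deleteVerts V(C) ∧ H.IsConn) K ∧
        V(D) = V(K) ∪ {x | ∃ y ∈ V(K), B.Adj y x} ∧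
        E(D) = {e | ∃ y ∈ V(K), B.Inc e y})

/-- The vertices of attachment of a bridge `D` of `C`. -/
def attachments (C D : Graph α β) : Set α := V(D) ∩ V(C)

/-- The graph `C*` obtained from `B` by replacing each bridge `D` of `C` by a single chord (the edge
`Sum.inr D`) between its two vertices of attachment; the edges of `C` are kept as `Sum.inl e`. -/
def star (B C : Graph α β) : Graph α (β ⊕ Graph α β) where
  vertexSet := V(C)
  IsLink e x y := match e with
    | .inl e => C.IsLink e x y
    | .inr D => B.IsBridgeOf C D ∧ x ≠ y ∧ C.attachments D = {x, y}
  isLink_symm := by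
    rintro (e | D) he <;> refine ⟨fun x y h => ?_⟩
    · exact h.symm
    · exact ⟨h.1, h.2.1.symm, by rw [h.2.2, Set.pair_comm]⟩
  eq_or_eq_of_isLink_of_isLink := by
    rintro (e | D) x y z w h h'
    · exact h.left_eq_or_eq h'
    · have hx : x ∈ C.attachments D := by rw [h.2.2]; simp
      rw [h'.2.2] at hx
      simpa using hx
  left_mem_of_isLink := by
    rintro (e | D) x y h
    · exact h.left_mem
    · have hx : x ∈ C.attachments D := by rw [h.2.2]; simp
      exact hx.2

/-- The circle `C`, seen as a subgraph of `C*`. -/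
def inlCopy (C : Graph α β) (γ : Type*) : Graph α (β ⊕ γ) where
  vertexSet := V(C)
  IsLink e x y := match e with
    | .inl e => C.IsLink e x y
    | .inr _ => False
  isLink_symm := by
    rintro (e | D) he <;> refine ⟨fun x y h => ?_⟩
    · exact h.symm
    · exact h
  eq_or_eq_of_isLink_of_isLink := by
    rintro (e | D) x y z w h h'
    · exact h.left_eq_or_eq h'
    · exact h.elim
  left_mem_of_isLink := by
    rintro (e | D) x y h
    · exact h.left_mem
    · exact h.elim

/-- `B` is `C`-layered: `C` is a circle of `B`, every bridge of `C` has exactly two vertices of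
attachment, and `C*` is 2-handled. -/
def IsLayered (B C : Graph α β) : Prop :=
  C.IsCircleOf B ∧ (∀ D, B.IsBridgeOf C D → (C.attachments D).ncard = 2) ∧
    (B.star C).IsTwoHandled (C.inlCopy (Graph α β))

/-! ### Signed graphs: a graph together with a signature `σ : β → ℤˣ` (only the values on the edge
set matter) -/

/-- The sign of a circle: the product of the signs of its edges. -/
noncomputable def circleSign (σ : β → ℤˣ) (C : Graph α β) : ℤˣ :=
  ∏ᶠ e ∈ E(C), σ e

/-- A signed graph is balanced if all of its circles are positive. -/
def IsBalanced (σ : β → ℤˣ) (G : Graph α β) : Prop :=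
  ∀ C, C.IsCircleOf G → circleSign σ C = 1

/-- `b` is a balancing edge: the signature can be switched, by some `ζ`, so that `b` is the only
negative edge. -/
def IsBalancingEdge (σ : β → ℤˣ) (G : Graph α β) (b : β) : Prop :=
  b ∈ E(G) ∧ ∃ ζ : α → ℤˣ, ∀ e x y, G.IsLink e x y → (ζ x * σ e * ζ y = -1 ↔ e = b)

/-- `[e, C, +]` in `G`: `C` is the unique positive circle of `G` containing the edge `e`. -/
def IsPosEdgeBattery (σ : β → ℤˣ) (G : Graph α β) (e : β) (C : Graph α β) : Prop :=
  (C.IsCircleOf G ∧ circleSign σ C = 1 ∧ e ∈ E(C)) ∧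
    ∀ C', C'.IsCircleOf G → circleSign σ C' = 1 → e ∈ E(C') → C' = C

/-- `[v, C, +]` in `G`: `C` is the unique positive circle of `G` containing the vertex `v`. -/
def IsPosVertexBattery (σ : β → ℤˣ) (G : Graph α β) (v : α) (C : Graph α β) : Prop :=
  (C.IsCircleOf G ∧ circleSign σ C = 1 ∧ v ∈ V(C)) ∧
    ∀ C', C'.IsCircleOf G → circleSign σ C' = 1 → v ∈ V(C') → C' = C

/-! ### Suppression of a vertex of degree two -/

/-- The only edge at `v` is a loop. -/
def OnlyLoopAt (B : Graph α β) (v : α) : Prop :=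
  ∃ e, B.incidenceSet v = {e} ∧ B.IsLoopAt e v

/-- The two edges at `v` are links, and their other endpoints are `x` and `y`. -/
def TwoLinksAt (B : Graph α β) (v x y : α) : Prop :=
  ∃ e₁ e₂, e₁ ≠ e₂ ∧ B.incidenceSet v = {e₁, e₂} ∧ B.IsLink e₁ v x ∧ B.IsLink e₂ v y ∧
    x ≠ v ∧ y ≠ v

theorem TwoLinksAt.symm {B : Graph α β} {v x y : α} (h : B.TwoLinksAt v x y) :
    B.TwoLinksAt v y x := by
  obtain ⟨e₁, e₂, hne, hi, h₁, h₂, hx, hy⟩ := h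
  exact ⟨e₂, e₁, hne.symm, by rw [hi, Set.pair_comm], h₂, h₁, hy, hx⟩

theorem TwoLinksAt.eq_or_eq {B : Graph α β} {v x y z w : α} (h : B.TwoLinksAt v x y)
    (h' : B.TwoLinksAt v z w) : x = z ∨ x = w := by
  obtain ⟨e₁, e₂, hne, hi, h₁, h₂, hx, hy⟩ := h
  obtain ⟨f₁, f₂, hne', hi', h₁', h₂', hx', hy'⟩ := h'
  have he : e₁ ∈ B.incidenceSet v := by rw [hi]; simp
  rw [hi'] at he
  rcases he with rfl | he
  · exact Or.inl (h₁.right_unique h₁')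
  · rw [Set.mem_singleton_iff] at he
    subst he
    exact Or.inr (h₁.right_unique h₂')

/-- The graph `B ↓ v` for a vertex `v` of degree two in `B`: the two links `v x`, `v y` at `v` are
replaced with the single edge `none` (which is `e_v`) with endpoints `x`, `y`, and `v` is removed;
every other edge `e` is kept as `some e`. If the only edge at `v` is a loop, then nothing
changes except that this loop is now called `none`. -/
def suppress (B : Graph α β) (v : α) : Graph α (Option β) where
  vertexSet := {x ∈ V(B) | x ≠ v ∨ B.OnlyLoopAt v}
  IsLink e x y := match e with
    | some e => B.IsLink e x y ∧ ¬ B.Inc e v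
    | none => B.TwoLinksAt v x y ∨ (x = v ∧ y = v ∧ B.OnlyLoopAt v)
  isLink_symm := by
    rintro (_ | e) he <;> refine ⟨fun x y h => ?_⟩
    · rcases h with h | ⟨hx, hy, h⟩
      · exact Or.inl h.symm
      · exact Or.inr ⟨hy, hx, h⟩
    · exact ⟨h.1.symm, h.2⟩
  eq_or_eq_of_isLink_of_isLink := by
    rintro (_ | e) x y z w h h'
    · rcases h with h | ⟨rfl, rfl, h⟩ <;> rcases h' with h' | ⟨rfl, rfl, h'⟩
      · exact h.eq_or_eq h'
      · obtain ⟨e₁, e₂, hne, hi, -⟩ := h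
        obtain ⟨e, hi', -⟩ := h'
        have h1 : e₁ ∈ B.incidenceSet w := by rw [hi]; simp
        have h2 : e₂ ∈ B.incidenceSet w := by rw [hi]; simp
        rw [hi', Set.mem_singleton_iff] at h1 h2
        exact absurd (h1.trans h2.symm) hne
      · obtain ⟨e₁, e₂, hne, hi, -⟩ := h'
        obtain ⟨e, hi', -⟩ := h
        have h1 : e₁ ∈ B.incidenceSet y := by rw [hi]; simp
        have h2 : e₂ ∈ B.incidenceSet y := by rw [hi]; simp
        rw [hi', Set.mem_singleton_iff] at h1 h2
        exact absurd (h1.trans h2.symm) hne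
      · exact Or.inl rfl
    · exact h.1.left_eq_or_eq h'.1
  left_mem_of_isLink := by
    rintro (_ | e) x y h
    · rcases h with ⟨e₁, e₂, -, -, h₁, -, hx, -⟩ | ⟨rfl, rfl, h⟩
      · exact ⟨h₁.right_mem, Or.inl hx⟩
      · obtain ⟨e, hi, he⟩ := h
        exact ⟨he.vertex_mem, Or.inr ⟨e, hi, he⟩⟩
    · refine ⟨h.1.left_mem, Or.inl ?_⟩
      rintro rfl
      exact h.2 h.1.inc_left

/-- The signature of `B ↓ v`: the sign of `e_v = none` is the product of the signs of the edges that
it replaces; all other signs are unchanged. -/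
noncomputable def suppressSign (σ : β → ℤˣ) (B : Graph α β) (v : α) : Option β → ℤˣ
  | none => ∏ᶠ e ∈ B.incidenceSet v, σ e
  | some e => σ e

/-! ### The blocks in which a vertex lies in exactly one, or in no, positive circle -/

/-- The three forms of a block `B` in which `v` lies in the unique positive circle `C`. -/
def HasOnePosForm (σ : β → ℤˣ) (B : Graph α β) (v : α) (C : Graph α β) : Prop :=
  C.IsCircleOf B ∧
    ((B = C ∧ IsBalanced σ B) ∨
      (¬ IsBalanced σ B ∧ B.deg v = 2 ∧ (B.suppress v).IsLayered (C.suppress v) ∧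
        IsPosEdgeBattery (suppressSign σ B v) (B.suppress v) none (C.suppress v)) ∨
      (¬ IsBalanced σ B ∧ B.deg v = 3 ∧ B.IsLayered C ∧
        (∃ D, (∀ D', B.IsBridgeOf C D' ↔ D' = D) ∧ v ∈ C.attachments D) ∧
        ∀ e ∈ E(C), IsPosEdgeBattery σ B e C))

/-- `v` has degree two in `B`, and `e_v` is a balancing edge in `B ↓ v`. -/
def HasOnlyNegForm (σ : β → ℤˣ) (B : Graph α β) (v : α) : Prop :=
  B.deg v = 2 ∧ IsBalancingEdge (suppressSign σ B v) (B.suppress v) none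

end Graph

/-!
# Signed graphs with exactly one positive circle through a vertex

Every circle lies in one block, and two blocks with a common edge are equal
(`Graph.IsBlockOf.eq_of_mem`). So `C` is the only positive circle through `v` if and only if this
holds in the block of `C`, and no other block has a positive circle through `v`. It remains to
describe the two kinds of blocks. Of a block only the following is used (`Graph.EdgeNonsep`): if its
edges are divided into two classes, then at least two vertices are incident with edges of both
classes. It follows that any two edges lie on a common circle
(`Graph.EdgeNonsep.exists_isCircleOf`).

*No positive circle through `v`.* A third edge at `v` would give a theta graph whose three circles
all contain `v`, and one of the circles of a theta graph is positive. So `v` has degree two, the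
circles through `v` correspond to the circles of `B ↓ v` through the new edge, and all of these are
negative. If a negative circle `Q` avoided the new edge, a circle through the new edge and an edge
of `Q` could be led along either of two arcs of `Q`, which have different signs; hence the new edge
is a balancing edge (`Graph.EdgeNonsep.isBalancingEdge`, `Graph.EdgeNonsep.hasOnlyNegForm`).

*Exactly one positive circle `C` through an edge `e`.* The vertices of `C` are enumerated as
`c 0, …, c n` such that `e` joins `c n` to `c 0` (`Graph.EnumBattery`). Replacing the part of `C`
that avoids `e` between the ends of an ear by this ear gives a negative circle, so relative to `C`
every ear is negative (`Graph.EnumBattery.sgn_ear`). Therefore a bridge of `C` has no three vertices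
of attachment, because two of the three legs of a tripod have the same sign
(`Graph.EnumBattery.eq_of_tripod`), and the intervals of indices spanned by two bridges are nested,
because otherwise two ears could be used in a second positive circle through `e`
(`Graph.EnumBattery.nested`). A circle with nested chords is 2-handled: chords do not cross, because
the branch vertices of a subdivision of `K₄` cannot be separated by two edges
(`Graph.branch_mem_iff`), and the handles belong to the innermost and to the outermost chord
(`Graph.CycEnum.isTwoHandled`). So the block is `C`-layered (`Graph.IsPosEdgeBattery.isLayered`).

*Exactly one positive circle `C` through `v`.* If the block is balanced, it has no other circle and
equals `C`. If it is unbalanced and `v` has degree two, the statement about `v` is the statement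
about the new edge of `B ↓ v`. Otherwise some bridge of `C` is attached at `v = c 0`, and it is the
only bridge, since two negative ears and parts of `C` would form another positive circle through
`v`; for a similar reason it has only one edge at `v` (`Graph.EnumBattery.bridge_unique`,
`Graph.EnumBattery.bridge_edge_unique`). So `v` has degree three. A circle different from `C` that
shares an edge with `C` passes through both vertices of attachment of the only bridge, so through
`v`; conversely, two circles through a vertex of degree three share an edge. This makes the
uniqueness of `C` at `v` equivalent to its uniqueness at each of its edges
(`Graph.EdgeNonsep.isPosVertexBattery_iff`).
-/

namespace Graph

/-! ### Paths as vertex and edge sets -/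

section Paths

variable {α β : Type*} {G H : Graph α β} {x y z u v w a b : α} {e f g : β}
  {X Y X' : Set α} {F F' : Set β}

/-- `G.PathOn x y X F`: there is a path in `G` from `x` to `y` (without repeated vertices, and
possibly of length zero) whose vertex set is `X` and whose edge set is `F`. Only these two sets
are recorded, so that reversing and concatenating paths changes nothing but sets. -/
inductive PathOn (G : Graph α β) : α → α → Set α → Set β → Prop
  | nil {x : α} (hx : x ∈ V(G)) : PathOn G x x {x} ∅
  | cons {x y z : α} {e : β} {X : Set α} {F : Set β} (he : G.IsLink e x y)
      (h : PathOn G y z X F) (hx : x ∉ X) : PathOn G x z (insert x X) (insert e F)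

namespace PathOn

lemma left_mem (h : G.PathOn x y X F) : x ∈ X := by cases h <;> simp

lemma right_mem (h : G.PathOn x y X F) : y ∈ X := by induction h <;> simp_all

lemma subset_vertexSet (h : G.PathOn x y X F) : X ⊆ V(G) := by
  induction h with
  | nil hx => simpa
  | cons he _ _ ih => exact Set.insert_subset he.left_mem ih

lemma subset_edgeSet (h : G.PathOn x y X F) : F ⊆ E(G) := by
  induction h with
  | nil hx => simp
  | cons he _ _ ih => exact Set.insert_subset he.edge_mem ih

lemma finite_vertices (h : G.PathOn x y X F) : X.Finite := by
  induction h with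
  | nil hx => simp
  | cons he _ _ ih => exact ih.insert _

lemma finite_edges (h : G.PathOn x y X F) : F.Finite := by
  induction h with
  | nil hx => simp
  | cons he _ _ ih => exact ih.insert _

lemma exists_isLink (h : G.PathOn x y X F) (he : e ∈ F) :
    ∃ a ∈ X, ∃ b ∈ X, a ≠ b ∧ G.IsLink e a b := by
  induction h with
  | nil hx => simp at he
  | @cons x y z e' X F he' h hx ih =>
    rcases he with rfl | he
    · exact ⟨x, by simp, y, by simp [h.left_mem], fun hxy => hx (hxy ▸ h.left_mem), he'⟩
    · obtain ⟨a, ha, b, hb, h'⟩ := ih he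
      exact ⟨a, Or.inr ha, b, Or.inr hb, h'⟩

lemma mem_of_inc (h : G.PathOn x y X F) (he : e ∈ F) (hz : G.Inc e z) : z ∈ X := by
  obtain ⟨a, ha, b, hb, -, hl⟩ := h.exists_isLink he
  rcases hz.eq_or_eq_of_isLink hl with rfl | rfl <;> assumption

lemma not_isLoopAt (h : G.PathOn x y X F) (he : e ∈ F) : ¬ G.IsLoopAt e z := by
  obtain ⟨a, ha, b, hb, hab, hl⟩ := h.exists_isLink he
  intro hz
  exact hab ((hz.eq_of_inc hl.inc_left).symm.trans (hz.eq_of_inc hl.inc_right))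

lemma eq_of_refl (h : G.PathOn x x X F) : X = {x} ∧ F = ∅ := by
  cases h with
  | nil => simp
  | cons he h hx => exact absurd h.right_mem hx

lemma congr (h : G.PathOn x y X F) (hX : X = X') (hF : F = F') : G.PathOn x y X' F' :=
  hX ▸ hF ▸ h

lemma single (he : G.IsLink e x y) (hxy : x ≠ y) : G.PathOn x y {x, y} {e} :=
  (PathOn.cons he (.nil he.right_mem) (by simpa)).congr rfl (by simp)

lemma append (h : G.PathOn x y X F) (h' : G.PathOn y z X' F') (hd : X ∩ X' ⊆ {y}) :
    G.PathOn x z (X ∪ X') (F ∪ F') := by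
  induction h with
  | nil hx => exact h'.congr (by simp [h'.left_mem]) (by simp)
  | @cons x y w e X F he h hx ih =>
    refine (PathOn.cons he (ih h' ?_) ?_).congr (Set.insert_union ..).symm
      (Set.insert_union ..).symm
    · exact fun t ht => hd ⟨Or.inr ht.1, ht.2⟩
    · rintro (h1 | h1)
      · exact hx h1
      · have : x = w := hd ⟨Or.inl rfl, h1⟩
        exact hx (this ▸ h.right_mem)

lemma reverse (h : G.PathOn x y X F) : G.PathOn y x X F := by
  induction h with
  | nil hx => exact .nil hx
  | @cons x y z e X F he h hx ih =>
    have hxy : y ≠ x := fun hxy => hx (hxy ▸ h.left_mem)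
    refine (ih.append (single he.symm hxy) ?_).congr ?_ ?_
    · rintro t ⟨h1, rfl | rfl⟩
      · rfl
      · exact absurd h1 hx
    · ext t; simp only [Set.mem_union, Set.mem_insert_iff, Set.mem_singleton_iff]
      have := h.left_mem
      constructor
      · rintro (h | rfl | rfl) <;> tauto
      · tauto
    · rw [Set.union_comm, Set.singleton_union]

/-- Adding an edge at the end of a path. -/
lemma concat (h : G.PathOn x y X F) (he : G.IsLink e y z) (hz : z ∉ X) :
    G.PathOn x z (insert z X) (insert e F) :=
  (PathOn.cons he.symm h.reverse hz).reverse

lemma disjoint_edges (h : G.PathOn x y X F) (h' : G.PathOn z w X' F') (hd : X ∩ X' ⊆ {u}) :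
    Disjoint F F' := by
  rw [Set.disjoint_left]
  intro e he he'
  obtain ⟨a, ha, b, hb, hab, hl⟩ := h.exists_isLink he
  exact hab ((hd ⟨ha, h'.mem_of_inc he' hl.inc_left⟩ : a = u).trans
    (hd ⟨hb, h'.mem_of_inc he' hl.inc_right⟩ : b = u).symm)

lemma split (h : G.PathOn x y X F) (hu : u ∈ X) :
    ∃ X₁ F₁ X₂ F₂, G.PathOn x u X₁ F₁ ∧ G.PathOn u y X₂ F₂ ∧ X₁ ∪ X₂ = X ∧ X₁ ∩ X₂ = {u} ∧
      F₁ ∪ F₂ = F ∧ Disjoint F₁ F₂ := by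
  induction h with
  | nil hx =>
    obtain rfl : u = _ := hu
    exact ⟨_, _, _, _, .nil hx, .nil hx, by simp, by simp, by simp, by simp⟩
  | @cons x y z e X F he h hx ih =>
    have hc := PathOn.cons he h hx
    by_cases hux : u = x
    · subst hux
      exact ⟨_, _, _, _, .nil he.left_mem, hc, by simp, by simp, by simp, by simp⟩
    · have huX : u ∈ X := hu.resolve_left hux
      obtain ⟨X₁, F₁, X₂, F₂, h₁, h₂, hX, hi, hF, -⟩ := ih huX
      have hx1 : x ∉ X₁ := fun h' => hx (hX ▸ Or.inl h')
      have hx2 : x ∉ X₂ := fun h' => hx (hX ▸ Or.inr h')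
      have hi' : insert x X₁ ∩ X₂ = {u} := by rw [Set.insert_inter_of_notMem hx2, hi]
      have h₁' := PathOn.cons he h₁ hx1
      exact ⟨_, _, _, _, h₁', h₂, by rw [Set.insert_union, hX], hi',
        by rw [Set.insert_union, hF], h₁'.disjoint_edges h₂ hi'.subset⟩

/-- Cutting a path at the first vertex that lies in `T`. -/
lemma firstHit (h : G.PathOn x y X F) {T : Set α} (hT : (X ∩ T).Nonempty) :
    ∃ t X₁ F₁ X₂ F₂, G.PathOn x t X₁ F₁ ∧ G.PathOn t y X₂ F₂ ∧ X₁ ∪ X₂ = X ∧ X₁ ∩ X₂ = {t} ∧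
      F₁ ∪ F₂ = F ∧ Disjoint F₁ F₂ ∧ X₁ ∩ T = {t} := by
  induction h with
  | @nil x hx =>
    obtain ⟨t, rfl, ht⟩ := hT
    exact ⟨_, _, _, _, _, .nil hx, .nil hx, by simp, by simp, by simp, by simp, by simpa⟩
  | @cons x y z e X F he h hx ih =>
    have hc := PathOn.cons he h hx
    by_cases hxT : x ∈ T
    · exact ⟨_, _, _, _, _, .nil he.left_mem, hc, by simp, by simp, by simp, by simp, by simpa⟩
    · obtain ⟨t, X₁, F₁, X₂, F₂, h₁, h₂, hX, hi, hF, -, ht⟩ :=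
        ih (by rwa [Set.insert_inter_of_notMem hxT] at hT)
      have hx1 : x ∉ X₁ := fun h' => hx (hX ▸ Or.inl h')
      have hx2 : x ∉ X₂ := fun h' => hx (hX ▸ Or.inr h')
      have hi' : insert x X₁ ∩ X₂ = {t} := by rw [Set.insert_inter_of_notMem hx2, hi]
      have h₁' := PathOn.cons he h₁ hx1
      exact ⟨_, _, _, _, _, h₁', h₂, by rw [Set.insert_union, hX], hi',
        by rw [Set.insert_union, hF], h₁'.disjoint_edges h₂ hi'.subset,
        by rw [Set.insert_inter_of_notMem hxT, ht]⟩

/-- Cutting out an edge of a path. -/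
lemma splitEdge (h : G.PathOn x y X F) (hg : g ∈ F) :
    ∃ a b X₁ F₁ X₂ F₂, G.PathOn x a X₁ F₁ ∧ G.IsLink g a b ∧ G.PathOn b y X₂ F₂ ∧
      X₁ ∪ X₂ = X ∧ Disjoint X₁ X₂ ∧ insert g (F₁ ∪ F₂) = F := by
  induction h with
  | nil hx => simp at hg
  | @cons x y z e X F he h hx ih =>
    by_cases hge : g = e
    · subst hge
      exact ⟨_, _, _, _, _, _, .nil he.left_mem, he, h, by simp, by simpa, by simp⟩
    · obtain ⟨a, b, X₁, F₁, X₂, F₂, h₁, hl, h₂, hX, hd, hF⟩ := ih (hg.resolve_left hge)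
      have hx1 : x ∉ X₁ := fun h' => hx (hX ▸ Or.inl h')
      have hx2 : x ∉ X₂ := fun h' => hx (hX ▸ Or.inr h')
      refine ⟨a, b, _, _, _, _, .cons he h₁ hx1, hl, h₂, by rw [Set.insert_union, hX], ?_, ?_⟩
      · rw [Set.disjoint_insert_left]; exact ⟨hx2, hd⟩
      · rw [Set.insert_union, Set.insert_comm, hF]

lemma mono (h : G.PathOn x y X F) (hle : G ≤ H) : H.PathOn x y X F := by
  induction h with
  | nil hx => exact .nil (IsSubgraph.vertexSet_mono hle hx)
  | cons he _ hx ih => exact .cons (he.mono hle) ih hx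

lemma of_le (h : G.PathOn x y X F) (hle : H ≤ G) (hX : X ⊆ V(H)) (hF : F ⊆ E(H)) :
    H.PathOn x y X F := by
  induction h with
  | nil hx => exact .nil (hX rfl)
  | cons he _ hx ih =>
    rw [Set.insert_subset_iff] at hX hF
    exact .cons ((IsSubgraph.isLink_iff hle hF.1).2 he) (ih hX.2 hF.2) hx

lemma reflTransGen (h : G.PathOn x y X F) (hu : u ∈ X) : Relation.ReflTransGen G.Adj x u := by
  induction h with
  | nil hx => rw [hu]
  | cons he _ hx ih =>
    rcases hu with rfl | hu
    · rfl
    · exact .head he.adj (ih hu)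

/-- The first vertex of a path of positive length is incident with exactly one edge of it. -/
lemma inc_left (h : G.PathOn x y X F) (hxy : x ≠ y) : ∃ f ∈ F, ∀ g ∈ F, G.Inc g x ↔ g = f := by
  cases h with
  | nil => exact absurd rfl hxy
  | @cons x z y e X F he h hx =>
    refine ⟨e, by simp, ?_⟩
    rintro g (rfl | hg)
    · simp [he.inc_left]
    · refine ⟨fun hi => absurd (h.mem_of_inc hg hi) hx, ?_⟩
      rintro rfl
      exact absurd (h.mem_of_inc hg he.inc_left) hx

lemma inc_right (h : G.PathOn x y X F) (hxy : x ≠ y) : ∃ f ∈ F, ∀ g ∈ F, G.Inc g y ↔ g = f :=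
  h.reverse.inc_left hxy.symm

/-- An interior vertex of a path is incident with exactly two edges of it. -/
lemma inc_mid (h : G.PathOn x y X F) (hz : z ∈ X) (hzx : z ≠ x) (hzy : z ≠ y) :
    ∃ f₁ ∈ F, ∃ f₂ ∈ F, f₁ ≠ f₂ ∧ ∀ g ∈ F, G.Inc g z ↔ g = f₁ ∨ g = f₂ := by
  obtain ⟨X₁, F₁, X₂, F₂, h₁, h₂, -, -, rfl, hd⟩ := h.split hz
  obtain ⟨f₁, hf₁, h1⟩ := h₁.inc_right hzx.symm
  obtain ⟨f₂, hf₂, h2⟩ := h₂.inc_left hzy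
  refine ⟨f₁, Or.inl hf₁, f₂, Or.inr hf₂, hd.ne_of_mem hf₁ hf₂, ?_⟩
  rintro g (hg | hg)
  · rw [h1 g hg]
    exact ⟨Or.inl, fun h => h.resolve_right (hd.ne_of_mem hg hf₂)⟩
  · rw [h2 g hg]
    exact ⟨Or.inr, fun h => h.resolve_left (hd.ne_of_mem hf₁ hg).symm⟩

end PathOn

lemma exists_pathOn (hx : x ∈ V(G)) (h : Relation.ReflTransGen G.Adj x y) :
    ∃ X F, G.PathOn x y X F := by
  induction h using Relation.ReflTransGen.head_induction_on with
  | refl => exact ⟨_, _, .nil hx⟩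
  | @head a c hac _ ih =>
    obtain ⟨e, he⟩ := hac
    obtain ⟨X, F, h⟩ := ih he.right_mem
    by_cases ha : a ∈ X
    · obtain ⟨X₁, F₁, X₂, F₂, -, h₂, -⟩ := h.split ha
      exact ⟨X₂, F₂, h₂⟩
    · exact ⟨_, _, .cons he h ha⟩

end Paths

/-! ### Circles and paths -/

section Circles

variable {α β : Type*} {G H C C₁ C₂ : Graph α β} {x y z u v w a b : α} {e f g : β}
  {X Y X' X₁ X₂ : Set α} {F F' F₁ F₂ : Set β}

/-- The subgraph of `G` with vertex set `X` that consists of the edges in `F` with both ends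
in `X`. -/
def sub (G : Graph α β) (X : Set α) (F : Set β) : Graph α β := (G.induce X).restrict F

@[simp] lemma sub_isLink : (G.sub X F).IsLink e x y ↔ (G.IsLink e x y ∧ x ∈ X ∧ y ∈ X) ∧ e ∈ F := by
  simp [sub, and_comm]

lemma sub_le (hX : X ⊆ V(G)) : G.sub X F ≤ G :=
  ⟨hX, fun _ _ _ h => (sub_isLink.1 h).1.1⟩

/-- If all edges of `F` have both ends in `X`, then no edge of `F` is lost in `G.sub X F`. -/
lemma edgeSet_sub (hF : F ⊆ E(G)) (h : ∀ e ∈ F, ∀ x, G.Inc e x → x ∈ X) : E(G.sub X F) = F := by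
  ext e
  constructor
  · intro he
    obtain ⟨x, y, h⟩ := exists_isLink_of_mem_edgeSet he
    exact (sub_isLink.1 h).2
  · intro he
    obtain ⟨x, y, hl⟩ := exists_isLink_of_mem_edgeSet (hF he)
    exact (sub_isLink.2 ⟨⟨hl, h e he x hl.inc_left, h e he y hl.inc_right⟩, he⟩).edge_mem

lemma eq_of_le_of_le (h₁ : C₁ ≤ G) (h₂ : C₂ ≤ G) (hV : V(C₁) = V(C₂)) (hE : E(C₁) = E(C₂)) :
    C₁ = C₂ :=
  Compatible.ext hV hE (.of_le_le h₁ h₂)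

lemma deg_eq_two_of_pair (hne : e ≠ f) (h : ∀ g, G.Inc g x ↔ g = e ∨ g = f)
    (he : ¬ G.IsLoopAt e x) (hf : ¬ G.IsLoopAt f x) : G.deg x = 2 := by
  have h1 : G.incidenceSet x = {e, f} := by ext g; simp [h]
  have h2 : G.loopSet x = ∅ := by
    ext g
    simp only [mem_loopSet, Set.mem_empty_iff_false, iff_false]
    intro hg
    rcases (h g).1 hg.inc with rfl | rfl <;> contradiction
  rw [deg, h1, h2, Set.ncard_pair hne, Set.ncard_empty]

lemma deg_eq_one (h : ∀ g, G.Inc g x ↔ g = e) (he : ¬ G.IsLoopAt e x) : G.deg x = 1 := by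
  have h1 : G.incidenceSet x = {e} := by ext g; simp [h]
  have h2 : G.loopSet x = ∅ := by
    ext g
    simp only [mem_loopSet, Set.mem_empty_iff_false, iff_false]
    intro hg
    obtain rfl := (h g).1 hg.inc
    contradiction
  rw [deg, h1, h2, Set.ncard_singleton, Set.ncard_empty]

lemma deg_eq_two_of_onlyLoopAt (h : G.OnlyLoopAt x) : G.deg x = 2 := by
  obtain ⟨e, h1, he⟩ := h
  have h2 : G.loopSet x = {e} := by
    refine Set.Subset.antisymm (h1 ▸ G.loopSet_subset_incidenceSet x) ?_
    rintro _ rfl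
    exact he
  rw [deg, h1, h2, Set.ncard_singleton]

/-- A vertex of degree two has two links, or one loop and no other edge. -/
lemma deg_eq_two_iff (hfin : E(G).Finite) : G.deg x = 2 ↔ G.OnlyLoopAt x ∨
    ∃ e f, e ≠ f ∧ (∀ g, G.Inc g x ↔ g = e ∨ g = f) ∧ ¬ G.IsLoopAt e x ∧ ¬ G.IsLoopAt f x := by
  constructor
  · intro h
    have hi : (G.incidenceSet x).Finite := hfin.subset (G.incidenceSet_subset_edgeSet x)
    have hle := Set.ncard_le_ncard (G.loopSet_subset_incidenceSet x) hi
    rw [deg] at h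
    by_cases h1 : (G.incidenceSet x).ncard = 1
    · left
      obtain ⟨e, he⟩ := Set.ncard_eq_one.1 h1
      obtain ⟨f, hf⟩ := Set.ncard_eq_one.1 (show (G.loopSet x).ncard = 1 by omega)
      have : f ∈ G.loopSet x := by rw [hf]; rfl
      have h2 : f ∈ G.incidenceSet x := G.loopSet_subset_incidenceSet x this
      rw [he] at h2
      obtain rfl : f = e := h2
      exact ⟨f, he, this⟩
    · right
      obtain ⟨e, f, hne, hef⟩ := Set.ncard_eq_two.1 (show (G.incidenceSet x).ncard = 2 by omega)
      have h0 : G.loopSet x = ∅ :=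
        (Set.ncard_eq_zero (hi.subset (G.loopSet_subset_incidenceSet x))).1 (by omega)
      refine ⟨e, f, hne, fun g => ?_, fun h => ?_, fun h => ?_⟩
      · rw [← mem_incidenceSet, hef]; simp
      · exact (Set.ext_iff.1 h0 _).1 h
      · exact (Set.ext_iff.1 h0 _).1 h
  · rintro (h | ⟨e, f, hne, h, he, hf⟩)
    · exact deg_eq_two_of_onlyLoopAt h
    · exact deg_eq_two_of_pair hne h he hf

lemma IsCircleOf.mono (h : C.IsCircleOf G) (hle : G ≤ H) : C.IsCircleOf H :=
  ⟨h.1.trans hle, h.2⟩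

lemma IsConn.subset_of_adj_closed (h : G.IsConn) (hx : x ∈ X) (hxG : x ∈ V(G))
    (hX : ∀ a ∈ X, ∀ b, G.Adj a b → b ∈ X) : V(G) ⊆ X := by
  intro y hy
  have := h.2 x hxG y hy
  induction this with
  | refl => exact hx
  | tail _ hbc ih => exact hX _ (ih hbc.left_mem) _ hbc

/-- In a connected graph with an edge there are no isolated vertices. -/
lemma IsConn.exists_inc (h : G.IsConn) (he : e ∈ E(G)) (hx : x ∈ V(G)) : ∃ f, G.Inc f x := by
  obtain ⟨a, b, hab⟩ := exists_isLink_of_mem_edgeSet he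
  rcases (h.2 x hx a hab.left_mem).cases_head with rfl | ⟨c, ⟨f, hf⟩, -⟩
  · exact ⟨e, hab.inc_left⟩
  · exact ⟨f, hf.inc_left⟩

lemma isConn_of_reach (hx : x ∈ V(G)) (h : ∀ y ∈ V(G), Relation.ReflTransGen G.Adj x y) :
    G.IsConn :=
  ⟨⟨x, hx⟩, fun a ha b hb =>
    (Std.Symm.symm (r := Relation.ReflTransGen G.Adj) _ _ (h a ha)).trans (h b hb)⟩

/-- A path together with a further edge between its ends is a circle. (If the path has length zero,
then the edge is a loop.) -/
lemma PathOn.exists_isCircleOf (h : G.PathOn x y X F) (he : G.IsLink e x y) (heF : e ∉ F) :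
    ∃ C, C.IsCircleOf G ∧ V(C) = X ∧ E(C) = insert e F := by
  have hins : ∀ f ∈ insert e F, ∀ z, G.Inc f z → z ∈ X := by
    rintro f (rfl | hf) z hz
    · rcases hz.eq_or_eq_of_isLink he with rfl | rfl
      exacts [h.left_mem, h.right_mem]
    · exact h.mem_of_inc hf hz
  have hE : E(G.sub X (insert e F)) = insert e F :=
    edgeSet_sub (Set.insert_subset he.edge_mem h.subset_edgeSet) hins
  have hle : G.sub X (insert e F) ≤ G := sub_le h.subset_vertexSet
  refine ⟨G.sub X (insert e F), ⟨hle, ?_, ?_⟩, rfl, hE⟩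
  · have h' : (G.sub X (insert e F)).PathOn x y X F :=
      h.of_le hle subset_rfl ((Set.subset_insert e F).trans hE.symm.subset)
    exact isConn_of_reach h.left_mem fun z hz => h'.reflTransGen hz
  · have hinc : ∀ f z, (G.sub X (insert e F)).Inc f z ↔ G.Inc f z ∧ (f = e ∨ f ∈ F) := by
      intro f z
      constructor
      · exact fun hf => ⟨hf.mono hle, by simpa [hE] using hf.edge_mem⟩
      · exact fun hf => (IsSubgraph.inc_congr hle (by simpa [hE] using hf.2)).2 hf.1
    intro z hz
    by_cases hxy : x = y
    · subst hxy
      obtain ⟨rfl, rfl⟩ := h.eq_of_refl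
      obtain rfl : z = x := hz
      refine deg_eq_two_of_onlyLoopAt ⟨e, ?_, ?_⟩
      · ext f
        simp only [mem_incidenceSet, hinc]
        constructor
        · rintro ⟨-, rfl | hf⟩
          · rfl
          · simp at hf
        · rintro rfl
          exact ⟨he.inc_left, Or.inl rfl⟩
      · exact sub_isLink.2 ⟨⟨he, rfl, rfl⟩, by simp⟩
    · have hnl : ∀ f ∈ insert e F, ¬ (G.sub X (insert e F)).IsLoopAt f z := by
        rintro f (rfl | hf) hz
        · have hz' := hz.mono hle
          exact hxy ((hz'.eq_of_inc he.inc_left).symm.trans (hz'.eq_of_inc he.inc_right))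
        · exact h.not_isLoopAt hf (hz.mono hle)
      by_cases hzx : z = x
      · subst hzx
        obtain ⟨f, hf, hf'⟩ := h.inc_left hxy
        refine deg_eq_two_of_pair (e := e) (f := f) (fun h => heF (h ▸ hf)) (fun g => ?_)
          (hnl _ (by simp)) (hnl _ (Or.inr hf))
        rw [hinc]
        constructor
        · rintro ⟨h1, rfl | h2⟩
          · exact Or.inl rfl
          · exact Or.inr ((hf' g h2).1 h1)
        · rintro (rfl | rfl)
          · exact ⟨he.inc_left, Or.inl rfl⟩
          · exact ⟨(hf' _ hf).2 rfl, Or.inr hf⟩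
      by_cases hzy : z = y
      · subst hzy
        obtain ⟨f, hf, hf'⟩ := h.inc_right hxy
        refine deg_eq_two_of_pair (e := e) (f := f) (fun h => heF (h ▸ hf)) (fun g => ?_)
          (hnl _ (by simp)) (hnl _ (Or.inr hf))
        rw [hinc]
        constructor
        · rintro ⟨h1, rfl | h2⟩
          · exact Or.inl rfl
          · exact Or.inr ((hf' g h2).1 h1)
        · rintro (rfl | rfl)
          · exact ⟨he.inc_right, Or.inl rfl⟩
          · exact ⟨(hf' _ hf).2 rfl, Or.inr hf⟩
      · obtain ⟨f₁, hf₁, f₂, hf₂, hne, hf⟩ := h.inc_mid hz hzx hzy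
        refine deg_eq_two_of_pair hne (fun g => ?_) (hnl _ (Or.inr hf₁)) (hnl _ (Or.inr hf₂))
        rw [hinc]
        constructor
        · rintro ⟨h1, rfl | h2⟩
          · rcases h1.eq_or_eq_of_isLink he with rfl | rfl <;> contradiction
          · exact (hf g h2).1 h1
        · rintro (rfl | rfl)
          · exact ⟨(hf _ hf₁).2 (Or.inl rfl), Or.inr hf₁⟩
          · exact ⟨(hf _ hf₂).2 (Or.inr rfl), Or.inr hf₂⟩

/-- Two internally disjoint paths with the same ends form a circle. -/
lemma PathOn.exists_isCircleOf_union (h₁ : G.PathOn a b X₁ F₁) (h₂ : G.PathOn a b X₂ F₂)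
    (hab : a ≠ b) (hX : X₁ ∩ X₂ ⊆ {a, b}) (hF : Disjoint F₁ F₂) :
    ∃ C, C.IsCircleOf G ∧ V(C) = X₁ ∪ X₂ ∧ E(C) = F₁ ∪ F₂ := by
  cases h₂ with
  | nil => exact absurd rfl hab
  | @cons _ w _ g X₂ F₂ hg h₂ haX =>
    have hd : X₂ ∩ X₁ ⊆ {b} := by
      rintro t ⟨ht2, ht1⟩
      rcases hX ⟨ht1, Or.inr ht2⟩ with rfl | ht
      · exact absurd ht2 haX
      · exact ht
    have hg1 : g ∉ F₁ := fun h => Set.disjoint_left.1 hF h (by simp)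
    have hg2 : g ∉ F₂ := fun h => haX (h₂.mem_of_inc h hg.inc_left)
    obtain ⟨C, hC, hV, hE⟩ := (h₂.append h₁.reverse hd).exists_isCircleOf hg.symm
      (by simp [hg1, hg2])
    refine ⟨C, hC, ?_, ?_⟩
    · rw [hV, Set.union_comm, Set.union_insert,
        Set.insert_eq_of_mem (show a ∈ X₁ ∪ X₂ from Or.inl h₁.left_mem)]
    · rw [hE, Set.union_comm, Set.union_insert]

/-- A vertex on a circle that has a link has exactly two edges, both of them links. -/
lemma IsCircle.exists_other (hC : C.IsCircle) (hfin : E(C).Finite) (he : C.IsLink e x y)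
    (hxy : x ≠ y) :
    ∃ f, f ≠ e ∧ (∀ g, C.Inc g x ↔ g = e ∨ g = f) ∧ ∃ z, z ≠ x ∧ C.IsLink f x z := by
  rcases (deg_eq_two_iff hfin).1 (hC.2 x he.left_mem) with ⟨l, hl, hloop⟩ | ⟨f₁, f₂, hne, h, h1, h2⟩
  · have : e ∈ C.incidenceSet x := he.inc_left
    rw [hl] at this
    obtain rfl : e = l := this
    exact absurd (hloop.eq_of_inc he.inc_right) hxy
  · have key : ∀ f, ¬ C.IsLoopAt f x → C.Inc f x → ∃ z, z ≠ x ∧ C.IsLink f x z := by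
      rintro f hf ⟨z, hz⟩
      exact ⟨z, fun h => hf (h ▸ hz), hz⟩
    rcases (h e).1 he.inc_left with rfl | rfl
    · exact ⟨f₂, hne.symm, h, key _ h2 ((h _).2 (Or.inr rfl))⟩
    · exact ⟨f₁, hne, fun g => by rw [h g, or_comm], key _ h1 ((h _).2 (Or.inl rfl))⟩

/-- Extending a path in a circle as long as possible; induction on the number of vertices outside
the path. -/
lemma IsCircle.extend (hC : C.IsCircle) (hV : V(C).Finite) (hE : E(C).Finite)
    (he : C.IsLink e x y) (hxy : x ≠ y) (n : ℕ) :
    ∀ z X F, C.PathOn x z X F → e ∉ F → V(C).ncard - X.ncard ≤ n →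
      ∃ X F, C.PathOn x y X F ∧ e ∉ F := by
  induction n with
  | zero =>
    intro z X F h heF hn
    have hXV : X = V(C) := Set.eq_of_subset_of_ncard_le h.subset_vertexSet (by omega) hV
    obtain ⟨X₁, F₁, X₂, F₂, h₁, -, -, -, hF, -⟩ := h.split (hXV ▸ he.right_mem : y ∈ X)
    exact ⟨_, _, h₁, fun h => heF (hF ▸ Or.inl h)⟩
  | succ n ih =>
    intro z X F h heF hn
    by_cases hzy : z = y
    · subst hzy
      exact ⟨_, _, h, heF⟩
    by_cases hyX : y ∈ X
    · obtain ⟨X₁, F₁, X₂, F₂, h₁, -, -, -, hF, -⟩ := h.split hyX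
      exact ⟨_, _, h₁, fun h => heF (hF ▸ Or.inl h)⟩
    have hext : ∀ g w, C.IsLink g z w → g ≠ e → w ∉ X → ∃ X F, C.PathOn x y X F ∧ e ∉ F := by
      intro g w hg hge hw
      refine ih w _ _ (h.concat hg hw) ?_ ?_
      · simp only [Set.mem_insert_iff, not_or]
        exact ⟨hge.symm, heF⟩
      · rw [Set.ncard_insert_of_notMem hw h.finite_vertices]
        have := Set.ncard_lt_ncard (Set.ssubset_iff_of_subset h.subset_vertexSet |>.2
          ⟨w, hg.right_mem, hw⟩) hV
        omega
    by_cases hzx : z = x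
    · subst hzx
      obtain ⟨rfl, rfl⟩ := h.eq_of_refl
      obtain ⟨f, hfe, -, w, hw, hl⟩ := hC.exists_other hE he hxy
      exact hext f w hl hfe (by simpa)
    · obtain ⟨f, hf, hf'⟩ := h.inc_right (Ne.symm hzx)
      have hfz : C.Inc f z := (hf' f hf).2 rfl
      obtain ⟨t, ht⟩ := hfz
      have hzt : z ≠ t := fun hh => h.not_isLoopAt hf (hh ▸ ht : C.IsLink f z z)
      obtain ⟨g, hgf, hg, w, hw, hl⟩ := hC.exists_other hE ht hzt
      have hgF : g ∉ F := fun hgF => hgf ((hf' g hgF).1 hl.inc_left)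
      have hge : g ≠ e := by
        rintro rfl
        rcases hl.inc_left.eq_or_eq_of_isLink he with rfl | rfl <;> contradiction
      refine hext g w hl hge fun hwX => ?_
      by_cases hwx : w = x
      · subst hwx
        obtain ⟨p, hp, hp'⟩ := h.inc_left (Ne.symm hzx)
        obtain ⟨q, hqe, hq, -⟩ := hC.exists_other hE he hxy
        have hpe : p ≠ e := fun h => heF (h ▸ hp)
        have hpq : p = q := ((hq p).1 ((hp' p hp).2 rfl)).resolve_left hpe
        have hgq : g = q := ((hq g).1 hl.inc_right).resolve_left hge
        exact hgF (hgq ▸ hpq ▸ hp)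
      · obtain ⟨p, hp, q, hq, hpq, hpq'⟩ := h.inc_mid hwX hwx hw
        have hpw := (hpq' p hp).2 (Or.inl rfl)
        have hqw := (hpq' q hq).2 (Or.inr rfl)
        obtain ⟨r, hrg, hr, -⟩ := hC.exists_other hE hl.symm hw
        have hpr : p = r := ((hr p).1 hpw).resolve_left fun h => hgF (h ▸ hp)
        have hqr : q = r := ((hr q).1 hqw).resolve_left fun h => hgF (h ▸ hq)
        exact hpq (hpr.trans hqr.symm)

/-- A circle without one of its edges is a path between the ends of that edge. -/
lemma IsCircle.exists_pathOn (hC : C.IsCircle) (hV : V(C).Finite) (hE : E(C).Finite)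
    (he : C.IsLink e x y) : ∃ F, C.PathOn x y V(C) F ∧ e ∉ F ∧ E(C) = insert e F := by
  by_cases hxy : x = y
  · subst hxy
    have hinc : ∀ g, C.Inc g x → g = e := by
      rcases (deg_eq_two_iff hE).1 (hC.2 x he.left_mem) with ⟨l, hl, -⟩ | ⟨f₁, f₂, -, h, h1, h2⟩
      · have h1 : e ∈ C.incidenceSet x := he.inc_left
        rw [hl] at h1
        intro g hg
        have h2 : g ∈ C.incidenceSet x := hg
        rw [hl] at h2
        exact (h2 : g = l).trans (h1 : e = l).symm
      · rcases (h e).1 he.inc_left with rfl | rfl <;> contradiction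
    have hVx : V(C) = {x} := by
      refine Set.Subset.antisymm (hC.1.subset_of_adj_closed rfl he.left_mem ?_) (by
        simpa using he.left_mem)
      rintro _ rfl b ⟨g, hg⟩
      obtain rfl := hinc g hg.inc_left
      exact (hg.right_unique he)
    refine ⟨∅, hVx ▸ .nil he.left_mem, by simp, ?_⟩
    ext g
    simp only [insert_empty_eq, Set.mem_singleton_iff]
    constructor
    · intro hg
      obtain ⟨a, b, hab⟩ := exists_isLink_of_mem_edgeSet hg
      have : a = x := by simpa [hVx] using hab.left_mem
      exact hinc g (this ▸ hab.inc_left)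
    · rintro rfl
      exact he.edge_mem
  · obtain ⟨X, F, h, heF⟩ := hC.extend hV hE he hxy _ x {x} ∅ (.nil he.left_mem) (by simp) le_rfl
    have hstep : ∀ a ∈ X, ∀ g, C.Inc g a → g ∈ insert e F := by
      intro a ha g hg
      by_cases hax : a = x
      · subst hax
        obtain ⟨p, hp, hp'⟩ := h.inc_left hxy
        obtain ⟨q, hqe, hq, -⟩ := hC.exists_other hE he hxy
        have hpe : p ≠ e := fun h => heF (h ▸ hp)
        have hpq : p = q := ((hq p).1 ((hp' p hp).2 rfl)).resolve_left hpe
        rcases (hq g).1 hg with rfl | rfl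
        exacts [Or.inl rfl, Or.inr (hpq ▸ hp)]
      by_cases hay : a = y
      · subst hay
        obtain ⟨p, hp, hp'⟩ := h.inc_right hxy
        obtain ⟨q, hqe, hq, -⟩ := hC.exists_other hE he.symm (Ne.symm hxy)
        have hpe : p ≠ e := fun h => heF (h ▸ hp)
        have hpq : p = q := ((hq p).1 ((hp' p hp).2 rfl)).resolve_left hpe
        rcases (hq g).1 hg with rfl | rfl
        exacts [Or.inl rfl, Or.inr (hpq ▸ hp)]
      · obtain ⟨p, hp, q, hq, hpq, hpq'⟩ := h.inc_mid ha hax hay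
        have hpw := (hpq' p hp).2 (Or.inl rfl)
        have hqw := (hpq' q hq).2 (Or.inr rfl)
        obtain ⟨t, ht⟩ := id hpw
        have hat : a ≠ t := fun hh => h.not_isLoopAt hp (hh ▸ ht : C.IsLink p a a)
        obtain ⟨r, hrp, hr, -⟩ := hC.exists_other hE ht hat
        have hqr : q = r := ((hr q).1 hqw).resolve_left hpq.symm
        rcases (hr g).1 hg with rfl | rfl
        exacts [Or.inr hp, Or.inr (hqr ▸ hq)]
    have hXV : X = V(C) := by
      refine Set.Subset.antisymm h.subset_vertexSet
        (hC.1.subset_of_adj_closed h.left_mem he.left_mem ?_)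
      rintro a ha b ⟨g, hg⟩
      rcases hstep a ha g hg.inc_left with rfl | hgF
      · rcases hg.right_eq_or_eq he with rfl | rfl
        exacts [h.left_mem, h.right_mem]
      · exact h.mem_of_inc hgF hg.inc_right
    refine ⟨F, hXV ▸ h, heF, Set.Subset.antisymm ?_
      (Set.insert_subset he.edge_mem h.subset_edgeSet)⟩
    intro g hg
    obtain ⟨a, b, hab⟩ := exists_isLink_of_mem_edgeSet hg
    exact hstep a (hXV ▸ hab.left_mem) g hab.inc_left

lemma IsCircle.exists_inc (hC : C.IsCircle) (hx : x ∈ V(C)) : ∃ f, C.Inc f x := by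
  by_contra! h
  have h1 : C.incidenceSet x = ∅ := by ext g; simp [h]
  have h2 : C.loopSet x = ∅ :=
    Set.subset_eq_empty (C.loopSet_subset_incidenceSet x) h1
  have := hC.2 x hx
  simp [deg, h1, h2] at this

/-- Two vertices of a circle divide it into two arcs. -/
lemma IsCircle.exists_arcs (hC : C.IsCircle) (hV : V(C).Finite) (hE : E(C).Finite)
    (ha : a ∈ V(C)) (hb : b ∈ V(C)) (hab : a ≠ b) :
    ∃ X₁ F₁ X₂ F₂, C.PathOn a b X₁ F₁ ∧ C.PathOn a b X₂ F₂ ∧ X₁ ∪ X₂ = V(C) ∧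
      X₁ ∩ X₂ = {a, b} ∧ F₁ ∪ F₂ = E(C) ∧ Disjoint F₁ F₂ := by
  obtain ⟨g, w, hg⟩ := hC.exists_inc ha
  obtain ⟨F, h, hgF, hEC⟩ := hC.exists_pathOn hV hE hg
  obtain ⟨X₁, F₁, X₂, F₂, h₁, h₂, hX, hi, hF, hd⟩ := h.split hb
  have haX : a ∉ X₂ := fun h2 => by
    have : a ∈ X₁ ∩ X₂ := ⟨h₁.left_mem, h2⟩
    rw [hi] at this
    exact hab this
  refine ⟨X₁, F₁, _, _, h₁, .cons hg h₂.reverse haX, ?_, ?_, ?_, ?_⟩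
  · rw [Set.union_insert, hX, Set.insert_eq_of_mem ha]
  · rw [Set.inter_insert_of_mem h₁.left_mem, hi]
  · rw [Set.union_insert, hF, hEC]
  · rw [Set.disjoint_insert_right]
    exact ⟨fun h => hgF (hF ▸ Or.inl h), hd⟩

/-- A circle contains no other circle. -/
lemma IsCircle.eq_of_le (hC : C.IsCircle) (hE : E(C).Finite) (h : C₁ ≤ C) (h₁ : C₁.IsCircle) :
    C₁ = C := by
  have hinc : ∀ a ∈ V(C₁), ∀ g, C.Inc g a → g ∈ E(C₁) := by
    intro a ha g hg
    have hs1 : C₁.incidenceSet a ⊆ C.incidenceSet a := fun f hf => hf.mono h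
    have hs2 : C₁.loopSet a ⊆ C.loopSet a := fun f hf => hf.mono h
    have hf1 : (C.incidenceSet a).Finite := hE.subset (C.incidenceSet_subset_edgeSet a)
    have hf2 : (C.loopSet a).Finite := hf1.subset (C.loopSet_subset_incidenceSet a)
    have h1 := Set.ncard_le_ncard hs1 hf1
    have h2 := Set.ncard_le_ncard hs2 hf2
    have h3 := h₁.2 a ha
    have h4 := hC.2 a (IsSubgraph.vertexSet_mono h ha)
    rw [deg] at h3 h4
    have := Set.eq_of_subset_of_ncard_le hs1 (by omega) hf1
    have hg' : g ∈ C.incidenceSet a := hg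
    rw [← this] at hg'
    exact Inc.edge_mem hg'
  obtain ⟨x, hx⟩ := h₁.1.1
  have hVV : V(C₁) = V(C) := by
    refine Set.Subset.antisymm (IsSubgraph.vertexSet_mono h)
      (hC.1.subset_of_adj_closed hx (IsSubgraph.vertexSet_mono h hx) ?_)
    rintro a ha b ⟨g, hg⟩
    exact ((IsSubgraph.isLink_iff h (hinc a ha g hg.inc_left)).2 hg).right_mem
  refine eq_of_le_of_le h le_rfl hVV (Set.Subset.antisymm (IsSubgraph.edgeSet_mono h) ?_)
  intro g hg
  obtain ⟨a, b, hab⟩ := exists_isLink_of_mem_edgeSet hg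
  exact hinc a (hVV ▸ hab.left_mem) g hab.inc_left

end Circles

/-! ### Signs of edge sets -/

section Signs

variable {α β : Type*} {σ : β → ℤˣ} {F F' : Set β} {e : β}

/-- The product of the signs of the edges in `F`. -/
noncomputable def sgn (σ : β → ℤˣ) (F : Set β) : ℤˣ := ∏ᶠ e ∈ F, σ e

lemma sgn_empty : sgn σ ∅ = 1 := by simp [sgn]

lemma sgn_union (hF : F.Finite) (hF' : F'.Finite) (h : Disjoint F F') :
    sgn σ (F ∪ F') = sgn σ F * sgn σ F' := finprod_mem_union h hF hF'

lemma sgn_insert (hF : F.Finite) (he : e ∉ F) : sgn σ (insert e F) = σ e * sgn σ F :=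
  finprod_mem_insert _ he hF

lemma sgn_singleton : sgn σ {e} = σ e := by simp [sgn]

lemma circleSign_eq_sgn (C : Graph α β) : circleSign σ C = sgn σ E(C) := rfl

end Signs

/-! ### Nonseparable graphs and blocks -/

section Nonsep

variable {α β : Type*} {G H B B' C C₁ C₂ Q : Graph α β} {x y z u v w a b p q : α} {e f g : β}
  {X Y X' X₁ X₂ T : Set α} {F F' F₁ F₂ S : Set β}

/-- The vertex `x` is incident with an edge in `S` and with an edge outside `S`. -/
def IsShared (G : Graph α β) (S : Set β) (x : α) : Prop :=
  (∃ e ∈ S, G.Inc e x) ∧ ∃ e ∉ S, G.Inc e x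

/-- However the edges of `G` are divided into two nonempty classes, there are two distinct vertices
that are incident with edges of both classes. For a connected graph this says that there is
no cutpoint; in this form the property is easily transferred to other graphs. -/
def EdgeNonsep (G : Graph α β) : Prop :=
  ∀ S ⊆ E(G), S.Nonempty → S ≠ E(G) → ∃ x y, x ≠ y ∧ G.IsShared S x ∧ G.IsShared S y

lemma exists_notMem_of_ne (hS : S ⊆ F) (hne : S ≠ F) : ∃ g ∈ F, g ∉ S := by
  by_contra! h
  exact hne (Set.Subset.antisymm hS h)

lemma IsConn.edgeNonsep (h : G.IsConn) (hc : ∀ x, ¬ G.IsCutpoint x) : G.EdgeNonsep := by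
  intro S hS hSne hne
  by_contra! hcon
  obtain ⟨e, he⟩ := hSne
  obtain ⟨g, hg, hgS⟩ := exists_notMem_of_ne hS hne
  let V₁ : Set α := {x | ∃ e ∈ S, G.Inc e x}
  let V₂ : Set α := {x | ∃ e ∉ S, G.Inc e x}
  have hV₁ : V₁ ⊆ V(G) := fun x ⟨e, _, h⟩ => h.vertex_mem
  have hV₂ : V₂ ⊆ V(G) := fun x ⟨e, _, h⟩ => h.vertex_mem
  have hE₁ : E(G.sub V₁ S) = S := edgeSet_sub hS fun e he x hx => ⟨e, he, hx⟩
  have hE₂ : E(G.sub V₂ (E(G) \ S)) = E(G) \ S :=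
    edgeSet_sub Set.sdiff_subset fun e he x hx => ⟨e, he.2, hx⟩
  by_cases hsh : ∃ w, G.IsShared S w
  · obtain ⟨w, hw⟩ := hsh
    refine hc w ⟨G.sub V₁ S, G.sub V₂ (E(G) \ S), sub_le hV₁, sub_le hV₂, ?_, ?_, ?_, ?_, ?_, ?_⟩
    · rw [hE₁]; exact ⟨e, he⟩
    · rw [hE₂]; exact ⟨g, hg, hgS⟩
    · refine Set.Subset.antisymm (Set.union_subset hV₁ hV₂) fun x hx => ?_
      obtain ⟨f, hf⟩ := h.exists_inc hg hx
      by_cases hfS : f ∈ S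
      · exact Or.inl ⟨f, hfS, hf⟩
      · exact Or.inr ⟨f, hfS, hf⟩
    · rw [hE₁, hE₂, Set.union_sdiff_cancel hS]
    · ext x
      constructor
      · intro hx
        by_contra hxw
        exact hcon x w hxw hx hw
      · rintro rfl
        exact hw
    · rw [hE₁, hE₂, Set.inter_sdiff_self]
  · push Not at hsh
    obtain ⟨a, b, hab⟩ := exists_isLink_of_mem_edgeSet (hS he)
    obtain ⟨c, d, hcd⟩ := exists_isLink_of_mem_edgeSet hg
    have := h.subset_of_adj_closed (X := V₁) ⟨e, he, hab.inc_left⟩ hab.left_mem (by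
      rintro s ⟨e', he', hs⟩ t ⟨f, hf⟩
      by_cases hfS : f ∈ S
      · exact ⟨f, hfS, hf.inc_right⟩
      · exact absurd ⟨⟨e', he', hs⟩, f, hfS, hf.inc_left⟩ (hsh s))
    exact hsh c ⟨this hcd.left_mem, g, hgS, hcd.inc_left⟩

lemma EdgeNonsep.not_isCutpoint (h : G.EdgeNonsep) : ¬ G.IsCutpoint x := by
  rintro ⟨H₁, H₂, h₁, h₂, hne₁, ⟨g, hg⟩, hV, hE, hVi, hEi⟩
  have hS : E(H₁) ⊆ E(G) := IsSubgraph.edgeSet_mono h₁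
  have hgS : g ∉ E(H₁) := fun h => by
    have : g ∈ E(H₁) ∩ E(H₂) := ⟨h, hg⟩
    simp [hEi] at this
  have key : ∀ s, G.IsShared E(H₁) s → s = x := by
    rintro s ⟨⟨e, he, hes⟩, f, hf, hfs⟩
    have hf2 : f ∈ E(H₂) := by
      have := hfs.edge_mem
      rw [← hE] at this
      exact this.resolve_left hf
    have : s ∈ V(H₁) ∩ V(H₂) := ⟨((IsSubgraph.inc_congr h₁ he).2 hes).vertex_mem,
      ((IsSubgraph.inc_congr h₂ hf2).2 hfs).vertex_mem⟩
    rw [hVi] at this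
    exact this
  obtain ⟨s, t, hst, hs, ht⟩ := h _ hS hne₁ fun h => hgS (h ▸ IsSubgraph.edgeSet_mono h₂ hg)
  exact hst ((key s hs).trans (key t ht).symm)

/-- On a path that starts at an edge in `S` and ends at an edge outside `S` there is a vertex at
which the two classes meet. -/
lemma PathOn.exists_isShared (h : G.PathOn x a X F) (he : G.Inc e x) (hg : G.Inc g a)
    (heS : e ∈ S) (hgS : g ∉ S) : ∃ z ∈ X, G.IsShared S z := by
  induction h generalizing e with
  | nil hx => exact ⟨_, rfl, ⟨e, heS, he⟩, g, hgS, hg⟩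
  | @cons x y z f X F hf h hx ih =>
    by_cases hfS : f ∈ S
    · obtain ⟨z, hz, hz'⟩ := ih hf.inc_right hg hfS
      exact ⟨z, Or.inr hz, hz'⟩
    · exact ⟨x, by simp, ⟨e, heS, he⟩, f, hfS, hf.inc_left⟩

lemma IsCircle.edgeNonsep (hC : C.IsCircle) (hV : V(C).Finite) (hE : E(C).Finite) :
    C.EdgeNonsep := by
  rintro S hS ⟨e, he⟩ hne
  obtain ⟨g, hg, hgS⟩ := exists_notMem_of_ne hS hne
  obtain ⟨x, y, hxy⟩ := exists_isLink_of_mem_edgeSet (hS he)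
  obtain ⟨F, h, -, hEC⟩ := hC.exists_pathOn hV hE hxy
  have hgF : g ∈ F := (hEC ▸ hg : g ∈ insert e F).resolve_left fun h => hgS (h ▸ he)
  obtain ⟨a, b, X₁, F₁, X₂, F₂, h₁, hl, h₂, -, hd, -⟩ := h.splitEdge hgF
  obtain ⟨s, hs, hs'⟩ := h₁.exists_isShared hxy.inc_left hl.inc_left he hgS
  obtain ⟨t, ht, ht'⟩ := h₂.reverse.exists_isShared hxy.inc_right hl.inc_right he hgS
  exact ⟨s, t, hd.ne_of_mem hs ht, hs', ht'⟩

lemma IsBlockOf.le (h : B.IsBlockOf G) : B ≤ G := h.prop.1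

lemma IsBlockOf.isConn (h : B.IsBlockOf G) : B.IsConn := h.prop.2.1

lemma IsBlockOf.edgeNonsep (h : B.IsBlockOf G) : B.EdgeNonsep :=
  h.isConn.edgeNonsep h.prop.2.2

lemma IsConn.reach_of_le (hB : B.IsConn) (hle : B ≤ G) (hx : x ∈ V(B)) (hy : y ∈ V(B)) :
    Relation.ReflTransGen G.Adj x y :=
  Relation.ReflTransGen.mono (fun _ _ h => h.mono hle) _ _ (hB.2 x hx y hy)

/-- Two blocks with a common edge are equal, since their union is nonseparable. -/
lemma IsBlockOf.eq_of_mem (h : B.IsBlockOf G) (h' : B'.IsBlockOf G) (he : e ∈ E(B))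
    (he' : e ∈ E(B')) : B = B' := by
  set U := G.sub (V(B) ∪ V(B')) (E(B) ∪ E(B')) with hU
  have hUG : U ≤ G := sub_le (Set.union_subset (IsSubgraph.vertexSet_mono h.le)
    (IsSubgraph.vertexSet_mono h'.le))
  have hBU : B ≤ U := ⟨Set.subset_union_left, fun f s t hf =>
    sub_isLink.2 ⟨⟨hf.mono h.le, Or.inl hf.left_mem, Or.inl hf.right_mem⟩, Or.inl hf.edge_mem⟩⟩
  have hBU' : B' ≤ U := ⟨Set.subset_union_right, fun f s t hf =>
    sub_isLink.2 ⟨⟨hf.mono h'.le, Or.inr hf.left_mem, Or.inr hf.right_mem⟩, Or.inr hf.edge_mem⟩⟩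
  have hUE : E(U) = E(B) ∪ E(B') := by
    refine edgeSet_sub (Set.union_subset (IsSubgraph.edgeSet_mono h.le)
      (IsSubgraph.edgeSet_mono h'.le)) ?_
    rintro f (hf | hf) s hs
    · exact Or.inl ((IsSubgraph.inc_congr h.le hf).2 hs).vertex_mem
    · exact Or.inr ((IsSubgraph.inc_congr h'.le hf).2 hs).vertex_mem
  obtain ⟨s, t, hst⟩ := exists_isLink_of_mem_edgeSet he
  have hs' : s ∈ V(B') := ((IsSubgraph.isLink_iff h'.le he').2 (hst.mono h.le)).left_mem
  have hconn : U.IsConn := by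
    refine isConn_of_reach (x := s) (Or.inl hst.left_mem) ?_
    rintro y (hy | hy)
    · exact h.isConn.reach_of_le hBU hst.left_mem hy
    · exact h'.isConn.reach_of_le hBU' hs' hy
  have hns : U.EdgeNonsep := by
    intro S hS hne hSU
    have aux : ∀ D : Graph α β, D ≤ U → D.EdgeNonsep → (∃ f ∈ E(D), f ∈ S) →
        (∃ f ∈ E(D), f ∉ S) → ∃ x y, x ≠ y ∧ U.IsShared S x ∧ U.IsShared S y := by
      rintro D hD hDn ⟨f, hf, hfS⟩ ⟨k, hk, hkS⟩
      have hsh : ∀ z, D.IsShared (S ∩ E(D)) z → U.IsShared S z := by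
        rintro z ⟨⟨p, hp, hpz⟩, q, hq, hqz⟩
        exact ⟨⟨p, hp.1, hpz.mono hD⟩, q, fun h => hq ⟨h, hqz.edge_mem⟩, hqz.mono hD⟩
      obtain ⟨x, y, hxy, hx, hy⟩ := hDn (S ∩ E(D)) Set.inter_subset_right ⟨f, hfS, hf⟩
        fun h => hkS (h.symm.subset hk).1
      exact ⟨x, y, hxy, hsh x hx, hsh y hy⟩
    by_contra hcon
    obtain ⟨k, hk⟩ := hne
    obtain ⟨l, hl, hlS⟩ := exists_notMem_of_ne hS hSU
    have hB : ∀ f ∈ E(B), (f ∈ S ↔ e ∈ S) := by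
      intro f hf
      by_contra hne
      exact hcon (aux B hBU h.edgeNonsep (by by_cases e ∈ S <;> grind) (by grind))
    have hB' : ∀ f ∈ E(B'), (f ∈ S ↔ e ∈ S) := by
      intro f hf
      by_contra hne
      exact hcon (aux B' hBU' h'.edgeNonsep (by grind) (by grind))
    have hall : ∀ f ∈ E(U), (f ∈ S ↔ e ∈ S) := by
      intro f hf
      rw [hUE] at hf
      exact hf.elim (hB f) (hB' f)
    exact hlS ((hall l hl).2 ((hall k (hS hk)).1 hk))
  have hUP : U ≤ G ∧ U.IsConn ∧ ∀ x, ¬ U.IsCutpoint x := ⟨hUG, hconn, fun x => hns.not_isCutpoint⟩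
  exact (le_antisymm hBU (h.le_of_ge hUP hBU)).trans (le_antisymm hBU' (h'.le_of_ge hUP hBU')).symm

lemma finite_setOf_le (hV : V(G).Finite) (hE : E(G).Finite) : {H | H ≤ G}.Finite := by
  refine Set.Finite.of_finite_image (f := fun H : Graph α β => (V(H), E(H)))
    ((hV.finite_subsets.prod hE.finite_subsets).subset ?_) ?_
  · rintro _ ⟨H, hH, rfl⟩
    exact ⟨IsSubgraph.vertexSet_mono hH, IsSubgraph.edgeSet_mono hH⟩
  · intro H hH K hK h
    simp only [Prod.mk.injEq] at h
    exact eq_of_le_of_le hH hK h.1 h.2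

lemma IsCircleOf.exists_isBlockOf (hV : V(G).Finite) (hE : E(G).Finite) (hC : C.IsCircleOf G) :
    ∃ B, B.IsBlockOf G ∧ C ≤ B := by
  have hfin : {H : Graph α β | H ≤ G ∧ H.IsConn ∧ ∀ x, ¬ H.IsCutpoint x}.Finite :=
    (finite_setOf_le hV hE).subset fun H h => h.1
  have hCE := hC.2.edgeNonsep (hV.subset (IsSubgraph.vertexSet_mono hC.1))
    (hE.subset (IsSubgraph.edgeSet_mono hC.1))
  obtain ⟨B, hCB, hB⟩ := hfin.exists_le_maximal (a := C) ⟨hC.1, hC.2.1, fun x => hCE.not_isCutpoint⟩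
  exact ⟨B, hB, hCB⟩

namespace EdgeNonsep

/-- A loop of a nonseparable graph is its only edge. -/
lemma edgeSet_eq_of_isLoopAt (h : G.EdgeNonsep) (he : G.IsLoopAt e x) : E(G) = {e} := by
  by_contra hne
  obtain ⟨s, t, hst, ⟨⟨e₁, rfl, h1⟩, -⟩, ⟨⟨e₂, rfl, h2⟩, -⟩⟩ :=
    h {e} (by simpa using he.edge_mem) (by simp) (Ne.symm hne)
  exact hst ((he.eq_of_inc h1).symm.trans (he.eq_of_inc h2))

lemma not_isLoopAt (h : G.EdgeNonsep) (he : e ∈ E(G)) (hf : f ∈ E(G)) (hef : e ≠ f) :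
    ¬ G.IsLoopAt g x := by
  intro hg
  have := h.edgeSet_eq_of_isLoopAt hg
  rw [this] at he hf
  exact hef (he.trans hf.symm)

/-- In a nonseparable graph with at least two edges no vertex has exactly one edge. -/
lemma exists_inc_ne (h : G.EdgeNonsep) (he : G.Inc e x) (hf : f ∈ E(G)) (hef : e ≠ f) :
    ∃ g, g ≠ e ∧ G.Inc g x := by
  obtain ⟨s, t, hst, ⟨⟨_, rfl, h1⟩, h1'⟩, ⟨⟨_, rfl, h2⟩, h2'⟩⟩ :=
    h {e} (by simpa using he.edge_mem) (by simp) fun h => hef (by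
      have : f ∈ ({e} : Set β) := h ▸ hf
      exact this.symm)
  rcases he.eq_or_eq_or_eq h1 h2 with rfl | rfl | h
  · exact h1'
  · exact h2'
  · exact absurd h hst

/-- Two edges with a common vertex lie on a common circle. -/
lemma exists_isCircleOf_of_adjacent (h : G.EdgeNonsep) (hef : e ≠ f) (he : G.IsLink e u a)
    (hf : G.IsLink f u b) : ∃ C, C.IsCircleOf G ∧ e ∈ E(C) ∧ f ∈ E(C) := by
  have hua : u ≠ a := fun hh => h.not_isLoopAt he.edge_mem hf.edge_mem hef (g := e) (x := u)
    (by rw [← hh] at he; exact he)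
  have hub : u ≠ b := fun hh => h.not_isLoopAt he.edge_mem hf.edge_mem hef (g := f) (x := u)
    (by rw [← hh] at hf; exact hf)
  -- the edges with an end that can be reached from `a` without passing through `u`
  set W : Set α := {w | Relation.ReflTransGen (G.deleteVerts {u}).Adj a w} with hW
  set S : Set β := {g ∈ E(G) | ∃ w ∈ W, G.Inc g w} with hS
  have haV : a ∈ V(G.deleteVerts {u}) := by simp [he.right_mem, hua.symm]
  have huW : u ∉ W := by
    intro hu
    rcases Relation.ReflTransGen.cases_tail hu with rfl | ⟨c, -, hc⟩
    · exact hua rfl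
    · have := hc.right_mem
      simp at this
  have hbW : b ∈ W := by
    by_contra hbW
    have hfS : f ∉ S := by
      rintro ⟨-, w, hw, hfw⟩
      rcases hfw.eq_or_eq_of_isLink hf with rfl | rfl
      exacts [huW hw, hbW hw]
    have key : ∀ s, G.IsShared S s → s = u := by
      rintro s ⟨⟨g, ⟨hg, w, hw, hgw⟩, hgs⟩, k, hk, hks⟩
      by_contra hsu
      have hsW : s ∉ W := fun hs => hk ⟨hks.edge_mem, s, hs, hks⟩
      obtain ⟨t, ht⟩ := hgs
      obtain rfl : w = t := (hgw.eq_or_eq_of_isLink ht).resolve_left (by rintro rfl; exact hsW hw)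
      have hwu : w ≠ u := by rintro rfl; exact huW hw
      refine hsW (Relation.ReflTransGen.tail hw ⟨g, ?_⟩)
      rw [deleteVerts_isLink]
      exact ⟨ht.symm, by simpa, by simpa⟩
    obtain ⟨s, t, hst, hs, ht⟩ := h S (fun g hg => hg.1)
      ⟨e, he.edge_mem, a, Relation.ReflTransGen.refl, he.inc_right⟩
      fun h => hfS (h ▸ hf.edge_mem)
    exact hst ((key s hs).trans (key t ht).symm)
  obtain ⟨X, F, hP⟩ := exists_pathOn haV hbW
  have huX : u ∉ X := fun hu => by simpa using hP.subset_vertexSet hu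
  have hP' := hP.mono (G.deleteVerts_le (X := {u}))
  have hfF : f ∉ F := fun hh => huX (hP'.mem_of_inc hh hf.inc_left)
  obtain ⟨C, hC, -, hE⟩ := (PathOn.cons he hP' huX).exists_isCircleOf hf (by simp [hef.symm, hfF])
  exact ⟨C, hC, by simp [hE], by simp [hE]⟩

end EdgeNonsep

/-- A path that meets `T` in at least two vertices: its part before the first vertex in `T` and its
part after the last vertex in `T`. -/
lemma PathOn.exists_first_last (h : G.PathOn x y X F) (hp : p ∈ X ∩ T) (hq : q ∈ X ∩ T)
    (hpq : p ≠ q) :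
    ∃ a ∈ T, ∃ b ∈ T, a ≠ b ∧ ∃ X₁ F₁ X₂ F₂, G.PathOn x a X₁ F₁ ∧ G.PathOn b y X₂ F₂ ∧
      X₁ ∩ T = {a} ∧ X₂ ∩ T = {b} ∧ Disjoint X₁ X₂ ∧ F₁ ⊆ F ∧ F₂ ⊆ F := by
  obtain ⟨a, X₁, F₁, Y, F', h₁, h', hX, hi, hF, -, haT⟩ := h.firstHit ⟨p, hp⟩
  have haT' : a ∈ X₁ ∩ T := by rw [haT]; rfl
  obtain ⟨b, X₂, F₂, Z, F'', h₂, hZ, hY, -, hF', -, hbT⟩ :=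
    h'.reverse.firstHit ⟨a, h'.left_mem, haT'.2⟩
  have hbT' : b ∈ X₂ ∩ T := by rw [hbT]; rfl
  have hab : a ≠ b := by
    rintro rfl
    -- otherwise the path would meet `T` only in `a`
    have key : ∀ t ∈ X ∩ T, t = a := by
      rintro t ⟨htX, htT⟩
      rw [← hX] at htX
      rcases htX with ht | ht
      · have : t ∈ X₁ ∩ T := ⟨ht, htT⟩
        rw [haT] at this
        exact this
      · have hX₂ : X₂ = Y := by
          rw [← hY, (hZ.eq_of_refl).1, Set.union_eq_left.2 (by simpa using hbT'.1)]
        have : t ∈ X₂ ∩ T := ⟨hX₂ ▸ ht, htT⟩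
        rw [hbT] at this
        exact this
    exact hpq ((key p hp).trans (key q hq).symm)
  refine ⟨a, haT'.2, b, hbT'.2, hab, X₁, F₁, X₂, F₂, h₁, h₂.reverse, haT, hbT, ?_,
    hF ▸ Set.subset_union_left, ?_⟩
  · rw [Set.disjoint_left]
    intro t ht1 ht2
    have : t ∈ X₁ ∩ Y := ⟨ht1, hY ▸ Or.inl ht2⟩
    rw [hi] at this
    obtain rfl : t = a := this
    have : t ∈ X₂ ∩ T := ⟨ht2, haT'.2⟩
    rw [hbT] at this
    exact hab this
  · exact (hF' ▸ Set.subset_union_left : F₂ ⊆ F').trans (hF ▸ Set.subset_union_right)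

/-- Replacing the part of a path between `a` and `b`, where the path meets `T` first and last,
by a path inside `T`. -/
lemma PathOn.append_append (h₁ : G.PathOn x a X₁ F₁) (h : G.PathOn a b X F)
    (h₂ : G.PathOn b y X₂ F₂) (hT₁ : X₁ ∩ T = {a}) (hT₂ : X₂ ∩ T = {b}) (hd : Disjoint X₁ X₂)
    (hX : X ⊆ T) :
    G.PathOn x y (X₁ ∪ X ∪ X₂) (F₁ ∪ F ∪ F₂) := by
  refine (h₁.append h fun t ht => hT₁ ▸ ⟨ht.1, hX ht.2⟩).append h₂ ?_
  rintro t ⟨ht | ht, ht2⟩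
  · exact absurd ht2 (Set.disjoint_left.1 hd ht)
  · exact hT₂ ▸ ⟨ht2, hX ht⟩

/-- Any two edges of a nonseparable graph lie on a common circle. -/
lemma EdgeNonsep.exists_isCircleOf (h : G.EdgeNonsep) (hV : V(G).Finite) (hE : E(G).Finite)
    (he : e ∈ E(G)) (hf : f ∈ E(G)) (hef : e ≠ f) :
    ∃ C, C.IsCircleOf G ∧ e ∈ E(C) ∧ f ∈ E(C) := by
  -- The edges that lie on a common circle with `e` meet the other edges at some vertex `u`; a
  -- circle `C` through `e` and an edge `g` at `u` can be led through an edge `k` at `u` by means of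
  -- a circle `Q` through `g` and `k`.
  set S : Set β := {g ∈ E(G) | g = e ∨ ∃ C, C.IsCircleOf G ∧ e ∈ E(C) ∧ g ∈ E(C)} with hS
  suffices hSE : S = E(G) by
    have : f ∈ S := hSE ▸ hf
    exact this.2.resolve_left hef.symm
  by_contra hne
  obtain ⟨u, -, -, ⟨⟨g, ⟨hg, hgS⟩, ⟨p, hgu⟩⟩, k, hk, ⟨q, hku⟩⟩, -⟩ :=
    h S (fun g hg => hg.1) ⟨e, he, Or.inl rfl⟩ hne
  apply hk
  refine ⟨hku.edge_mem, Or.inr ?_⟩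
  have hgk : g ≠ k := by
    rintro rfl
    exact hk ⟨hg, hgS⟩
  obtain ⟨Q, hQ, hgQ, hkQ⟩ := h.exists_isCircleOf_of_adjacent hgk hgu hku
  rcases hgS with rfl | ⟨C, hC, heC, hgC⟩
  · exact ⟨Q, hQ, hgQ, hkQ⟩
  by_cases heQ : e ∈ E(Q)
  · exact ⟨Q, hQ, heQ, hkQ⟩
  have fV : ∀ {D : Graph α β}, D ≤ G → V(D).Finite := fun h =>
    hV.subset (IsSubgraph.vertexSet_mono h)
  have fE : ∀ {D : Graph α β}, D ≤ G → E(D).Finite := fun h =>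
    hE.subset (IsSubgraph.edgeSet_mono h)
  obtain ⟨x, y, hxy⟩ := exists_isLink_of_mem_edgeSet heC
  obtain ⟨F, hP, heF, -⟩ := hC.2.exists_pathOn (fV hC.1) (fE hC.1) hxy
  have hlC := (IsSubgraph.isLink_iff hC.1 hgC).2 hgu
  have hlQ := (IsSubgraph.isLink_iff hQ.1 hgQ).2 hgu
  have hup : u ≠ p := fun hh => h.not_isLoopAt hg hku.edge_mem hgk (g := g) (x := u)
    (by rw [← hh] at hgu; exact hgu)
  obtain ⟨a, haT, b, hbT, hab, X₁, F₁, X₂, F₂, h₁, h₂, hT₁, hT₂, hd, hF₁, hF₂⟩ :=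
    hP.exists_first_last (T := V(Q)) ⟨hlC.left_mem, hlQ.left_mem⟩ ⟨hlC.right_mem, hlQ.right_mem⟩
      hup
  have close : ∀ Y K, Q.PathOn a b Y K → k ∈ K → ∃ C, C.IsCircleOf G ∧ e ∈ E(C) ∧ k ∈ E(C) := by
    intro Y K hYK hkK
    have := (h₁.mono hC.1).append_append (hYK.mono hQ.1) (h₂.mono hC.1) hT₁ hT₂ hd
      hYK.subset_vertexSet
    obtain ⟨D, hD, -, hDE⟩ := this.exists_isCircleOf (hxy.mono hC.1) (by
      rintro ((h | h) | h)
      exacts [heF (hF₁ h), heQ (hYK.subset_edgeSet h), heF (hF₂ h)])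
    exact ⟨D, hD, by simp [hDE], by simp [hDE, hkK]⟩
  obtain ⟨Y₁, K₁, Y₂, K₂, hK₁, hK₂, -, -, hKE, -⟩ :=
    hQ.2.exists_arcs (fV hQ.1) (fE hQ.1) haT hbT hab
  rcases (hKE ▸ hkQ : k ∈ K₁ ∪ K₂) with hk | hk
  exacts [close _ _ hK₁ hk, close _ _ hK₂ hk]

end Nonsep

/-! ### Bridges of a circle -/

section Bridges

variable {α β : Type*} {G H B C D D' K K' L : Graph α β} {x y z u v w a b p q : α} {e f g c : β}
  {X Y X' X₁ X₂ T : Set α} {F F' F₁ F₂ S : Set β}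

/-- `K` is a connected component of `H`. -/
def IsComponent (K H : Graph α β) : Prop :=
  Maximal (fun L : Graph α β => L ≤ H ∧ L.IsConn) K

lemma exists_isComponent (hy : y ∈ V(H)) : ∃ K : Graph α β, K.IsComponent H ∧ y ∈ V(K) := by
  set W : Set α := {w | Relation.ReflTransGen H.Adj y w} with hW
  have hWV : W ⊆ V(H) := by
    intro w hw
    rcases Relation.ReflTransGen.cases_tail hw with rfl | ⟨s, -, hs⟩
    exacts [hy, hs.right_mem]
  have hle : H.induce W ≤ H := H.induce_le hWV
  have hyW : y ∈ W := Relation.ReflTransGen.refl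
  refine ⟨H.induce W, ⟨⟨hle, ?_⟩, ?_⟩, hyW⟩
  · refine isConn_of_reach (x := y) hyW fun w hw => ?_
    have hw' : Relation.ReflTransGen H.Adj y w := hw
    clear hw
    induction hw' with
    | refl => exact .refl
    | @tail s t hs hst ih =>
      obtain ⟨e, he⟩ := hst
      exact ih.tail ⟨e, he, hs, Relation.ReflTransGen.tail hs ⟨e, he⟩⟩
  · rintro L ⟨hL, hLc⟩ hKL
    have hLW : V(L) ⊆ W := fun w hw =>
      hLc.reach_of_le hL (IsSubgraph.vertexSet_mono hKL hyW) hw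
    exact ⟨hLW, fun f s t hf => ⟨hf.mono hL, hLW hf.left_mem, hLW hf.right_mem⟩⟩

namespace IsComponent

lemma le (h : K.IsComponent H) : K ≤ H := h.prop.1

lemma isConn (h : K.IsComponent H) : K.IsConn := h.prop.2

lemma mem_of_adj (h : K.IsComponent H) (hx : x ∈ V(K)) (hxy : H.Adj x y) : y ∈ V(K) := by
  have hKV := IsSubgraph.vertexSet_mono h.le
  have hKL : K ≤ H.induce (insert y V(K)) :=
    ⟨Set.subset_insert _ _, fun f s t hf => ⟨hf.mono h.le, Or.inr hf.left_mem, Or.inr hf.right_mem⟩⟩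
  have hL : (H.induce (insert y V(K))).IsConn := by
    refine isConn_of_reach (x := x) (Or.inr hx) ?_
    rintro t (rfl | ht)
    · obtain ⟨f, hf⟩ := hxy
      exact .single ⟨f, hf, Or.inr hx, Or.inl rfl⟩
    · exact h.isConn.reach_of_le hKL hx ht
  have := h.le_of_ge ⟨H.induce_le (Set.insert_subset hxy.right_mem hKV), hL⟩ hKL
  exact IsSubgraph.vertexSet_mono this (Or.inl rfl)

lemma vertexSet_subset (h : K.IsComponent H) (h' : K'.IsComponent H) (hx : x ∈ V(K))
    (hx' : x ∈ V(K')) : V(K) ⊆ V(K') :=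
  h.isConn.subset_of_adj_closed hx' hx fun _ ha _ hb => h'.mem_of_adj ha (hb.mono h.le)

lemma notMem (h : K.IsComponent (B.deleteVerts X)) (hx : x ∈ V(K)) : x ∉ X := by
  have := IsSubgraph.vertexSet_mono h.le hx
  rw [vertexSet_deleteVerts] at this
  exact this.2

lemma mem_or_mem (h : K.IsComponent (B.deleteVerts X)) (hx : x ∈ V(K)) (he : B.IsLink e x y) :
    y ∈ V(K) ∨ y ∈ X := by
  by_cases hy : y ∈ X
  · exact Or.inr hy
  · refine Or.inl (h.mem_of_adj hx ⟨e, ?_⟩)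
    rw [deleteVerts_isLink]
    exact ⟨he, h.notMem hx, hy⟩

lemma le_of_deleteVerts (h : K.IsComponent (B.deleteVerts X)) : K ≤ B := h.le.trans deleteVerts_le

/-- Three vertices of a component are joined by a subdivided star (whose paths may be trivial). -/
lemma exists_tripod (h : K.IsComponent (B.deleteVerts X)) (hx : x ∈ V(K)) (hy : y ∈ V(K))
    (hz : z ∈ V(K)) :
    ∃ q X₁ F₁ X₂ F₂ X₃ F₃, B.PathOn q x X₁ F₁ ∧ B.PathOn q y X₂ F₂ ∧ B.PathOn q z X₃ F₃ ∧
      X₁ ⊆ V(K) ∧ X₂ ⊆ V(K) ∧ X₃ ⊆ V(K) ∧ X₁ ∩ X₂ ⊆ {q} ∧ X₁ ∩ X₃ ⊆ {q} ∧ X₂ ∩ X₃ ⊆ {q} := by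
  obtain ⟨Y, F, hP⟩ := exists_pathOn hx (h.isConn.2 x hx y hy)
  obtain ⟨Z, F', hQ⟩ := exists_pathOn hz (h.isConn.2 z hz x hx)
  obtain ⟨q, X₃, F₃, -, -, h₃, -, -, -, -, -, hq⟩ := hQ.firstHit ⟨x, hQ.right_mem, hP.left_mem⟩
  have hq' : q ∈ X₃ ∩ Y := by rw [hq]; rfl
  obtain ⟨X₁, F₁, X₂, F₂, h₁, h₂, hX, hi, -, -⟩ := hP.split hq'.2
  have hKB := h.le_of_deleteVerts
  refine ⟨q, X₁, F₁, X₂, F₂, X₃, F₃, h₁.reverse.mono hKB, h₂.mono hKB, h₃.reverse.mono hKB,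
    h₁.subset_vertexSet, h₂.subset_vertexSet, h₃.subset_vertexSet, hi.subset, ?_, ?_⟩
  · exact fun t ht => hq ▸ ⟨ht.2, hX ▸ Or.inl ht.1⟩
  · exact fun t ht => hq ▸ ⟨ht.2, hX ▸ Or.inr ht.1⟩

end IsComponent

/-- Every edge outside `C` that has an end on `C` and is not a loop belongs to a bridge of `C`. -/
lemma exists_isBridgeOf (hf : B.IsLink f x y) (hx : x ∈ V(C)) (hfC : f ∉ E(C))
    (hxy : x ≠ y) : ∃ D, B.IsBridgeOf C D ∧ f ∈ E(D) ∧ x ∈ C.attachments D := by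
  by_cases hy : y ∈ V(C)
  · have hE : E(B.sub {x, y} {f}) = {f} := by
      refine edgeSet_sub (by simpa using hf.edge_mem) ?_
      rintro _ rfl s hs
      exact hs.eq_or_eq_of_isLink hf
    refine ⟨B.sub {x, y} {f}, ⟨sub_le ?_, Or.inl ⟨f, x, y, ⟨hfC, hx, hy, hxy, hf⟩, rfl, hE⟩⟩,
      by simp [hE], Or.inl rfl, hx⟩
    rintro s (rfl | rfl)
    exacts [hf.left_mem, hf.right_mem]
  · obtain ⟨K, hK, hyK⟩ := exists_isComponent (H := B.deleteVerts V(C)) (y := y)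
      (by simp [hf.right_mem, hy])
    have hKB := hK.le_of_deleteVerts
    have hE : E(B.sub (V(K) ∪ {x | ∃ y ∈ V(K), B.Adj y x}) {e | ∃ y ∈ V(K), B.Inc e y}) =
        {e | ∃ y ∈ V(K), B.Inc e y} := by
      refine edgeSet_sub (fun e ⟨s, _, he⟩ => he.edge_mem) ?_
      rintro e ⟨s, hs, t, ht⟩ r hr
      rcases hr.eq_or_eq_of_isLink ht with rfl | rfl
      · exact Or.inl hs
      · exact Or.inr ⟨s, hs, e, ht⟩
    refine ⟨B.sub (V(K) ∪ {x | ∃ y ∈ V(K), B.Adj y x}) {e | ∃ y ∈ V(K), B.Inc e y},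
      ⟨sub_le (Set.union_subset (IsSubgraph.vertexSet_mono hKB) ?_), Or.inr ⟨K, hK, rfl, hE⟩⟩,
      ?_, ?_, hx⟩
    · rintro s ⟨t, -, ht⟩
      exact ht.right_mem
    · rw [hE]
      exact ⟨y, hyK, hf.inc_right⟩
    · exact Or.inr ⟨y, hyK, f, hf.symm⟩

namespace IsBridgeOf

lemma notMem_edgeSet (h : B.IsBridgeOf C D) (hle : C ≤ B) (he : e ∈ E(D)) : e ∉ E(C) := by
  rcases h.2 with ⟨c, x, y, hc, -, hE⟩ | ⟨K, hK, -, hE⟩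
  · rw [hE] at he
    obtain rfl : e = c := he
    exact hc.1
  · rw [hE] at he
    obtain ⟨s, hs, hes⟩ := he
    intro heC
    exact IsComponent.notMem hK hs ((IsSubgraph.inc_congr hle heC).2 hes).vertex_mem

/-- Different bridges meet only in vertices of `C`. -/
lemma eq_of_mem (h : B.IsBridgeOf C D) (h' : B.IsBridgeOf C D') (hx : x ∈ V(D))
    (hx' : x ∈ V(D')) (hxC : x ∉ V(C)) : D = D' := by
  rcases h.2 with ⟨c, y, z, hc, hV, hE⟩ | ⟨K, hK, hV, hE⟩
  · rw [hV] at hx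
    rcases hx with rfl | rfl
    exacts [absurd hc.2.1 hxC, absurd hc.2.2.1 hxC]
  rcases h'.2 with ⟨c, y, z, hc, hV', hE'⟩ | ⟨K', hK', hV', hE'⟩
  · rw [hV'] at hx'
    rcases hx' with rfl | rfl
    exacts [absurd hc.2.1 hxC, absurd hc.2.2.1 hxC]
  have aux : ∀ L : Graph α β, L.IsComponent (B.deleteVerts V(C)) →
      x ∈ V(L) ∪ {x | ∃ y ∈ V(L), B.Adj y x} → x ∈ V(L) := by
    rintro L hL (hxL | ⟨s, hs, f, hf⟩)
    · exact hxL
    · exact (hL.mem_or_mem hs hf).resolve_right hxC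
  have hxK := aux K hK (hV ▸ hx)
  have hxK' := aux K' hK' (hV' ▸ hx')
  have hKK : V(K) = V(K') := Set.Subset.antisymm (IsComponent.vertexSet_subset hK hK' hxK hxK')
    (IsComponent.vertexSet_subset hK' hK hxK' hxK)
  exact eq_of_le_of_le h.1 h'.1 (by rw [hV, hV', hKK]) (by rw [hE, hE', hKK])

/-- Different bridges have no common edge. -/
lemma eq_of_mem_edgeSet (h : B.IsBridgeOf C D) (h' : B.IsBridgeOf C D') (he : e ∈ E(D))
    (he' : e ∈ E(D')) : D = D' := by
  obtain ⟨x, y, hxy⟩ := exists_isLink_of_mem_edgeSet he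
  have hxy' := (IsSubgraph.isLink_iff h'.1 he').2 (hxy.mono h.1)
  by_cases hx : x ∈ V(C)
  swap
  · exact h.eq_of_mem h' hxy.left_mem hxy'.left_mem hx
  by_cases hy : y ∈ V(C)
  swap
  · exact h.eq_of_mem h' hxy.right_mem hxy'.right_mem hy
  have aux : ∀ L, B.IsBridgeOf C L → e ∈ E(L) → V(L) = {x, y} ∧ E(L) = {e} := by
    intro L hL heL
    rcases hL.2 with ⟨c, s, t, hc, hV, hE⟩ | ⟨K, hK, hV, hE⟩
    · rw [hE] at heL
      obtain rfl : e = c := heL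
      refine ⟨?_, hE⟩
      rcases hc.2.2.2.2.eq_and_eq_or_eq_and_eq (hxy.mono h.1) with ⟨rfl, rfl⟩ | ⟨rfl, rfl⟩
      exacts [hV, by rw [hV, Set.pair_comm]]
    · rw [hE] at heL
      obtain ⟨s, hs, hes⟩ := heL
      rcases hes.eq_or_eq_of_isLink (hxy.mono h.1) with rfl | rfl
      exacts [absurd hx (IsComponent.notMem hK hs), absurd hy (IsComponent.notMem hK hs)]
  obtain ⟨h1, h2⟩ := aux D h he
  obtain ⟨h3, h4⟩ := aux D' h' he'
  exact eq_of_le_of_le h.1 h'.1 (h1.trans h3.symm) (h2.trans h4.symm)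

lemma mem_attachments_of_isShared (h : B.IsBridgeOf C D) (hx : B.IsShared E(D) x) :
    x ∈ C.attachments D := by
  obtain ⟨⟨e, he, hex⟩, g, hg, hgx⟩ := hx
  have hxD := ((IsSubgraph.inc_congr h.1 he).2 hex).vertex_mem
  refine ⟨hxD, ?_⟩
  rcases h.2 with ⟨c, y, z, hc, hV, hE⟩ | ⟨K, hK, hV, hE⟩
  · rw [hV] at hxD
    rcases hxD with rfl | rfl
    exacts [hc.2.1, hc.2.2.1]
  · rw [hV] at hxD
    have hxK : x ∉ V(K) := fun hxK => hg (hE ▸ ⟨x, hxK, hgx⟩)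
    rcases hxD with hxK' | ⟨s, hs, f, hf⟩
    · exact absurd hxK' hxK
    · exact (IsComponent.mem_or_mem hK hs hf).resolve_left hxK

/-- In a nonseparable graph every bridge has at least two vertices of attachment. -/
lemma exists_ne_attachments (h : B.IsBridgeOf C D) (hB : B.EdgeNonsep)
    (hiso : ∀ x ∈ V(B), ∃ e, B.Inc e x) (hle : C ≤ B) (hC : E(C).Nonempty) :
    ∃ x ∈ C.attachments D, ∃ y ∈ C.attachments D, x ≠ y := by
  obtain ⟨e, he⟩ := hC
  have hne : E(D).Nonempty := by
    rcases h.2 with ⟨c, y, z, hc, hV, hE⟩ | ⟨K, hK, hV, hE⟩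
    · rw [hE]; exact Set.singleton_nonempty c
    · obtain ⟨k, hk⟩ := (IsComponent.isConn hK).1
      obtain ⟨f, hf⟩ := hiso k (IsSubgraph.vertexSet_mono (IsComponent.le_of_deleteVerts hK) hk)
      rw [hE]
      exact ⟨f, k, hk, hf⟩
  obtain ⟨x, y, hxy, hx, hy⟩ := hB E(D) (IsSubgraph.edgeSet_mono h.1) hne fun hh =>
    h.notMem_edgeSet hle (hh ▸ IsSubgraph.edgeSet_mono hle he) he
  exact ⟨x, h.mem_attachments_of_isShared hx, y, h.mem_attachments_of_isShared hy, hxy⟩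

end IsBridgeOf

/-- `G.IsEar C x y X F`: there is a path from `x` to `y`, with vertex set `X` and edge set `F`, that
connects two distinct vertices of `C` and is otherwise disjoint from `C`. -/
structure IsEar (G C : Graph α β) (x y : α) (X : Set α) (F : Set β) : Prop where
  pathOn : G.PathOn x y X F
  ne : x ≠ y
  inter : X ∩ V(C) ⊆ {x, y}
  disj : Disjoint F E(C)

lemma IsEar.reverse (h : G.IsEar C x y X F) : G.IsEar C y x X F :=
  ⟨h.pathOn.reverse, h.ne.symm, Set.pair_comm x y ▸ h.inter, h.disj⟩

lemma PathOn.nonempty (h : G.PathOn x y X F) (hxy : x ≠ y) : F.Nonempty :=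
  let ⟨f, hf, _⟩ := h.inc_left hxy
  ⟨f, hf⟩

/-- Two paths that start at `q` in a component of `G \ V(C)` and are continued to `C` form an
ear. -/
lemma IsComponent.isEar (hK : K.IsComponent (B.deleteVerts V(C))) (hle : C ≤ B)
    (h₁ : B.PathOn q x X₁ F₁) (h₂ : B.PathOn q y X₂ F₂) (hX₁ : X₁ ⊆ V(K)) (hX₂ : X₂ ⊆ V(K))
    (hi : X₁ ∩ X₂ ⊆ {q}) (he : B.IsLink e x a) (hf : B.IsLink f y b) (hab : a ≠ b)
    (ha : a ∈ V(C)) (hb : b ∈ V(C)) :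
    B.IsEar C a b (insert a X₁ ∪ insert b X₂) (insert e F₁ ∪ insert f F₂) ∧
      Disjoint (insert e F₁) (insert f F₂) := by
  have hn : ∀ {t}, t ∈ V(K) → t ∉ V(C) := fun ht => hK.notMem ht
  have haK : a ∉ V(K) := fun h => hn h ha
  have hbK : b ∉ V(K) := fun h => hn h hb
  have p₁ := h₁.concat he fun h => haK (hX₁ h)
  have p₂ := h₂.concat hf fun h => hbK (hX₂ h)
  have hno : ∀ g s, s ∈ V(K) → B.Inc g s → g ∉ E(C) := fun g s hs hg hgC =>
    hn hs ((IsSubgraph.inc_congr hle hgC).2 hg).vertex_mem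
  have hd : insert a X₁ ∩ insert b X₂ ⊆ {q} := by
    rintro t ⟨rfl | h1, rfl | h2⟩
    · exact absurd rfl hab
    · exact absurd (hX₂ h2) haK
    · exact absurd (hX₁ h1) hbK
    · exact hi ⟨h1, h2⟩
  refine ⟨⟨p₁.reverse.append p₂ hd, hab, ?_, ?_⟩, p₁.disjoint_edges p₂ hd⟩
  · rintro t ⟨(rfl | h1) | (rfl | h2), ht⟩
    · exact Or.inl rfl
    · exact absurd ht (hn (hX₁ h1))
    · exact Or.inr rfl
    · exact absurd ht (hn (hX₂ h2))
  · have aux : ∀ {s X F}, B.PathOn q s X F → X ⊆ V(K) → ∀ g ∈ F, g ∉ E(C) := by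
      intro s X F h hX g hg
      obtain ⟨t, ht, _, _, _, hl⟩ := h.exists_isLink hg
      exact hno g t (hX ht) hl.inc_left
    rw [Set.disjoint_left]
    rintro g ((rfl | h1) | (rfl | h2))
    · exact hno _ x (hX₁ h₁.right_mem) he.inc_left
    · exact aux h₁ hX₁ g h1
    · exact hno _ y (hX₂ h₂.right_mem) hf.inc_left
    · exact aux h₂ hX₂ g h2

/-- Any two vertices of attachment of a bridge are joined by an ear through this bridge. -/
lemma IsBridgeOf.exists_isEar (h : B.IsBridgeOf C D) (hle : C ≤ B) (hx : x ∈ C.attachments D)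
    (hy : y ∈ C.attachments D) (hxy : x ≠ y) :
    ∃ X F, B.IsEar C x y X F ∧ X ⊆ V(D) ∧ F ⊆ E(D) := by
  rcases h.2 with ⟨c, s, t, hc, hV, hE⟩ | ⟨K, hK, hV, hE⟩
  · have hxD := hx.1
    have hyD := hy.1
    rw [hV] at hxD hyD
    have hl : B.IsLink c x y := by
      rcases hxD with rfl | rfl <;> rcases hyD with rfl | rfl
      exacts [absurd rfl hxy, hc.2.2.2.2, hc.2.2.2.2.symm, absurd rfl hxy]
    refine ⟨_, _, ⟨.single hl hxy, hxy, Set.inter_subset_left, by simpa using hc.1⟩, ?_,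
      hE.ge⟩
    rintro r (rfl | rfl)
    exacts [hx.1, hy.1]
  · have hK' : K.IsComponent (B.deleteVerts V(C)) := hK
    have aux : ∀ r ∈ C.attachments D, ∃ s ∈ V(K), ∃ f, B.IsLink f s r := by
      rintro r ⟨hr, hrC⟩
      rw [hV] at hr
      rcases hr with hr | ⟨s, hs, f, hf⟩
      · exact absurd hrC (hK'.notMem hr)
      · exact ⟨s, hs, f, hf⟩
    obtain ⟨s, hs, f, hf⟩ := aux x hx
    obtain ⟨t, ht, g, hg⟩ := aux y hy
    obtain ⟨X, F, hP⟩ := exists_pathOn hs (hK'.isConn.2 s hs t ht)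
    have hP' := hP.mono hK'.le_of_deleteVerts
    refine ⟨_, _, (hK'.isEar hle (.nil hf.left_mem) hP' (by simpa)
      hP.subset_vertexSet Set.inter_subset_left hf hg hxy hx.2 hy.2).1, ?_, ?_⟩
    · rintro r ((rfl | rfl) | (rfl | hr))
      · exact hx.1
      · rw [hV]; exact Or.inl hs
      · exact hy.1
      · rw [hV]; exact Or.inl (hP.subset_vertexSet hr)
    · rw [hE]
      rintro r ((rfl | hr) | (rfl | hr))
      · exact ⟨s, hs, hf.inc_left⟩
      · exact absurd hr (Set.notMem_empty r)
      · exact ⟨t, ht, hg.inc_left⟩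
      · obtain ⟨a, ha, b, _, _, hl⟩ := hP'.exists_isLink hr
        exact ⟨a, hP.subset_vertexSet ha, hl.inc_left⟩

end Bridges

/-! ### A circle whose vertices are enumerated along the circle -/

section Enumeration

variable {α β : Type*} {G H B C D D' K : Graph α β} {x y z u v w a b p q : α} {e f g : β}
  {X Y X' X₁ X₂ T : Set α} {F F' F₁ F₂ S : Set β} {σ : β → ℤˣ} {n i j k : ℕ} {c : ℕ → α} {ε : ℕ → β}

lemma sgn_append (h : G.PathOn x y X F) (h' : G.PathOn z w X' F') (hd : X ∩ X' ⊆ {u}) :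
    sgn σ (F ∪ F') = sgn σ F * sgn σ F' :=
  sgn_union h.finite_edges h'.finite_edges (h.disjoint_edges h' hd)

/-- The vertices of the circle `C` are `c 0, …, c n`, in this cyclic order and without repetition;
`ε i` joins `c i` to `c (i + 1)`, and `ε n` joins `c n` to `c 0`. -/
structure CycEnum (C : Graph α β) (n : ℕ) (c : ℕ → α) (ε : ℕ → β) : Prop where
  inj : ∀ i ≤ n, ∀ j ≤ n, c i = c j → i = j
  link : ∀ i < n, C.IsLink (ε i) (c i) (c (i + 1))
  close : C.IsLink (ε n) (c n) (c 0)
  surj : ∀ x ∈ V(C), ∃ i ≤ n, c i = x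
  edge_inj : ∀ i ≤ n, ∀ j ≤ n, ε i = ε j → i = j
  edge_surj : ∀ e ∈ E(C), ∃ i ≤ n, ε i = e

/-- The sign of the part of an enumerated circle from `c 0` to `c i`. -/
noncomputable def pot (σ : β → ℤˣ) (ε : ℕ → β) (i : ℕ) : ℤˣ := sgn σ (ε '' Set.Iio i)

lemma pot_zero : pot σ ε 0 = 1 := by
  rw [pot, show Set.Iio 0 = (∅ : Set ℕ) by ext; simp, Set.image_empty, sgn_empty]

lemma eq_neg_of_ne {s t : ℤˣ} (h : s ≠ t) : s = -t := by
  revert s t; decide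

lemma PathOn.exists_enum [Nonempty β] (h : G.PathOn x y X F) :
    ∃ (n : ℕ) (c : ℕ → α) (ε : ℕ → β), c 0 = x ∧ c n = y ∧
      (∀ i ≤ n, ∀ j ≤ n, c i = c j → i = j) ∧ (∀ i < n, G.IsLink (ε i) (c i) (c (i + 1))) ∧
      X = c '' Set.Iic n ∧ F = ε '' Set.Iio n := by
  induction h with
  | @nil x hx =>
    exact ⟨0, fun _ => x, fun _ => Classical.arbitrary β, rfl, rfl, by simp, by simp,
      by ext; simp [eq_comm], by simp⟩
  | @cons x y z e X F he h hx ih =>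
    obtain ⟨n, c, ε, h0, hn, hinj, hlink, hX, hF⟩ := ih
    have hxc : ∀ i ≤ n, c i ≠ x := fun i hi h => hx (hX ▸ ⟨i, hi, h⟩)
    refine ⟨n + 1, fun i => Nat.casesOn i x c, fun i => Nat.casesOn i e ε, rfl, hn, ?_, ?_, ?_, ?_⟩
    · rintro (_ | i) hi (_ | j) hj hij
      · rfl
      · exact absurd hij.symm (hxc j (by omega))
      · exact absurd hij (hxc i (by omega))
      · rw [hinj i (by omega) j (by omega) hij]
    · rintro (_ | i) hi
      · simpa [h0] using he
      · exact hlink i (by omega)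
    · ext t
      rw [hX]
      constructor
      · rintro (rfl | ⟨i, hi, rfl⟩)
        · exact ⟨0, by simp, rfl⟩
        · exact ⟨i + 1, by simpa using hi, rfl⟩
      · rintro ⟨_ | i, hi, rfl⟩
        · exact Or.inl rfl
        · exact Or.inr ⟨i, by simpa using hi, rfl⟩
    · ext t
      rw [hF]
      constructor
      · rintro (rfl | ⟨i, hi, rfl⟩)
        · exact ⟨0, by simp, rfl⟩
        · exact ⟨i + 1, by simpa using hi, rfl⟩
      · rintro ⟨_ | i, hi, rfl⟩
        · exact Or.inl rfl
        · exact Or.inr ⟨i, by simpa using hi, rfl⟩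

lemma IsCircle.exists_cycEnum (hC : C.IsCircle) (hV : V(C).Finite) (hE : E(C).Finite)
    (he : C.IsLink e x y) (hxy : x ≠ y) :
    ∃ n c ε, C.CycEnum n c ε ∧ c 0 = x ∧ ε n = e ∧ 1 ≤ n := by
  obtain ⟨F, h, heF, hEC⟩ := hC.exists_pathOn hV hE he
  have : Nonempty β := ⟨e⟩
  obtain ⟨n, c, ε, h0, hn, hinj, hlink, hX, hF⟩ := h.exists_enum
  have hupd : ∀ i < n, Function.update ε n e i = ε i := fun i hi =>
    Function.update_of_ne (by omega) _ _
  have hlink' : ∀ i < n, C.IsLink (Function.update ε n e i) (c i) (c (i + 1)) := fun i hi => by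
    rw [hupd i hi]
    exact hlink i hi
  have hlt : ∀ i < n, ∀ j < n, Function.update ε n e i = Function.update ε n e j → i = j := by
    intro i hi j hj hij
    have h1 := hlink' i hi
    rw [hij] at h1
    rcases h1.eq_and_eq_or_eq_and_eq (hlink' j hj) with ⟨h2, -⟩ | ⟨h2, h3⟩
    · exact hinj i (by omega) j (by omega) h2
    · have := hinj _ (by omega) _ (by omega) h2
      have := hinj _ (by omega) _ (by omega) h3
      omega
  have hen : ∀ i < n, Function.update ε n e i ≠ e := fun i hi h' =>
    heF (hF ▸ ⟨i, hi, by rw [← hupd i hi, h']⟩)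
  refine ⟨n, c, Function.update ε n e, ⟨hinj, hlink', ?_, ?_, ?_, ?_⟩, h0, by simp, ?_⟩
  · simpa [h0, hn] using he.symm
  · intro t ht
    rw [hX] at ht
    exact ht
  · intro i hi j hj hij
    rcases hi.lt_or_eq with hi' | rfl <;> rcases hj.lt_or_eq with hj' | rfl
    · exact hlt i hi' j hj' hij
    · exact absurd (by simpa using hij) (hen i hi')
    · exact absurd (by simpa using hij.symm) (hen j hj')
    · rfl
  · intro f hf
    rw [hEC, hF] at hf
    rcases hf with rfl | ⟨i, hi, rfl⟩
    · exact ⟨n, le_rfl, by simp⟩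
    · exact ⟨i, le_of_lt hi, hupd i hi⟩
  · by_contra hn0
    obtain rfl : n = 0 := by omega
    exact hxy (h0.symm.trans hn)

namespace CycEnum

lemma mem (h : C.CycEnum n c ε) (hi : i ≤ n) : c i ∈ V(C) := by
  rcases hi.lt_or_eq with hi | rfl
  · exact (h.link i hi).left_mem
  · exact h.close.left_mem

lemma edge_mem (h : C.CycEnum n c ε) (hi : i ≤ n) : ε i ∈ E(C) := by
  rcases hi.lt_or_eq with hi | rfl
  · exact (h.link i hi).edge_mem
  · exact h.close.edge_mem

lemma edgeSet_eq (h : C.CycEnum n c ε) : E(C) = insert (ε n) (ε '' Set.Iio n) := by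
  ext e
  constructor
  · intro he
    obtain ⟨i, hi, rfl⟩ := h.edge_surj e he
    rcases hi.lt_or_eq with hi | rfl
    · exact Or.inr ⟨i, hi, rfl⟩
    · exact Or.inl rfl
  · rintro (rfl | ⟨i, hi, rfl⟩)
    · exact h.edge_mem le_rfl
    · exact h.edge_mem (le_of_lt hi)

lemma last_notMem (h : C.CycEnum n c ε) {A : Set ℕ} (hA : A ⊆ Set.Iio n) : ε n ∉ ε '' A := by
  rintro ⟨i, hi, hin⟩
  have hi' : i < n := hA hi
  have := h.edge_inj i hi'.le n le_rfl hin
  omega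

lemma circleSign_eq (h : C.CycEnum n c ε) : circleSign σ C = σ (ε n) * pot σ ε n := by
  rw [circleSign_eq_sgn, h.edgeSet_eq, sgn_insert ((Set.finite_Iio n).image ε)
    (h.last_notMem subset_rfl), pot]

lemma mem_image_iff (h : C.CycEnum n c ε) {A : Set ℕ} (hA : A ⊆ Set.Iic n) (hi : i ≤ n) :
    c i ∈ c '' A ↔ i ∈ A :=
  ⟨fun ⟨_, hj, hji⟩ => h.inj _ (hA hj) _ hi hji ▸ hj, fun hi => ⟨i, hi, rfl⟩⟩

lemma pathOn_Icc (h : C.CycEnum n c ε) (hij : i ≤ j) (hj : j ≤ n) :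
    C.PathOn (c i) (c j) (c '' Set.Icc i j) (ε '' Set.Ico i j) := by
  induction j, hij using Nat.le_induction with
  | base => simpa using PathOn.nil (h.mem hj)
  | succ j hij ih =>
    refine ((ih (by omega)).concat (h.link j (by omega)) ?_).congr ?_ ?_
    · rw [h.mem_image_iff (fun k hk => hk.2.trans (by omega)) hj]
      simp
    · rw [← Set.image_insert_eq]
      congr 1
      ext k
      simp only [Set.mem_insert_iff, Set.mem_Icc]
      omega
    · rw [← Set.image_insert_eq]
      congr 1
      ext k
      simp only [Set.mem_insert_iff, Set.mem_Ico]
      omega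

lemma sgn_Ico (h : C.CycEnum n c ε) (hij : i ≤ j) (hj : j ≤ n) :
    sgn σ (ε '' Set.Ico i j) = pot σ ε i * pot σ ε j := by
  have h1 : pot σ ε j = pot σ ε i * sgn σ (ε '' Set.Ico i j) := by
    rw [pot, pot, ← sgn_union ((Set.finite_Iio i).image ε) ((Set.finite_Ico i j).image ε),
      ← Set.image_union]
    · congr 2
      ext k
      simp only [Set.mem_union, Set.mem_Iio, Set.mem_Ico]
      omega
    · rw [Set.disjoint_left]
      rintro _ ⟨k, hk, rfl⟩ ⟨l, hl, hlk⟩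
      simp only [Set.mem_Iio, Set.mem_Ico] at hk hl
      have := h.edge_inj l (by omega) k (by omega) hlk
      omega
  rw [h1, ← mul_assoc, Int.units_mul_self, one_mul]

/-- The part of an enumerated circle between `c i` and `c j` that does not contain `ε n`. -/
lemma exists_pathOn (h : C.CycEnum n c ε) (σ : β → ℤˣ) (hi : i ≤ n) (hj : j ≤ n) :
    ∃ F, C.PathOn (c i) (c j) (c '' Set.uIcc i j) F ∧ ε n ∉ F ∧
      sgn σ F = pot σ ε i * pot σ ε j := by
  rcases le_total i j with hij | hij
  · refine ⟨_, by rw [Set.uIcc_of_le hij]; exact h.pathOn_Icc hij hj,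
      h.last_notMem fun k hk => ?_, h.sgn_Ico hij hj⟩
    exact lt_of_lt_of_le hk.2 hj
  · refine ⟨_, by rw [Set.uIcc_of_ge hij]; exact (h.pathOn_Icc hij hi).reverse,
      h.last_notMem fun k hk => ?_, by rw [h.sgn_Ico hij hi, mul_comm]⟩
    exact lt_of_lt_of_le hk.2 hi

end CycEnum

/-! ### Ears of a unique positive circle -/

/-- `C` is a positive circle of `B`, enumerated by `c` and `ε`, and no other positive circle of `B`
contains the edge `ε n`. -/
structure EnumBattery (σ : β → ℤˣ) (B C : Graph α β) (n : ℕ) (c : ℕ → α) (ε : ℕ → β) :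
    Prop extends CycEnum C n c ε where
  le : C ≤ B
  pos : circleSign σ C = 1
  uniq : ∀ C', C'.IsCircleOf B → circleSign σ C' = 1 → ε n ∈ E(C') → C' = C

namespace EnumBattery

/-- If a path from `c 0` to `c n` forms a positive circle with `ε n`, it is part of `C`. -/
lemma subset_of_pathOn (h : EnumBattery σ B C n c ε) (hP : B.PathOn (c 0) (c n) X F)
    (hF : ε n ∉ F) (hs : sgn σ F = pot σ ε n) : F ⊆ E(C) := by
  obtain ⟨D, hD, -, hE⟩ := hP.exists_isCircleOf (h.close.mono h.le).symm hF
  have := h.uniq D hD (by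
    rw [circleSign_eq_sgn, hE, sgn_insert hP.finite_edges hF, hs, ← h.circleSign_eq, h.pos])
    (by simp [hE])
  rw [← this, hE]
  exact Set.subset_insert _ _

lemma last_notMem_of_isEar (h : EnumBattery σ B C n c ε) (hP : B.IsEar C x y X F) : ε n ∉ F :=
  fun hF => Set.disjoint_left.1 hP.disj hF (h.edge_mem le_rfl)

/-- In an ear only the ends lie on the circle. -/
lemma mem_ear (h : EnumBattery σ B C n c ε) (hP : B.IsEar C (c i) (c j) X F) (hi : i ≤ n)
    (hj : j ≤ n) (hk : k ≤ n) (hkX : c k ∈ X) : k = i ∨ k = j := by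
  rcases hP.inter ⟨hkX, h.mem hk⟩ with hk' | hk'
  · exact Or.inl (h.inj k hk i hi hk')
  · exact Or.inr (h.inj k hk j hj hk')

/-- Every ear is negative with respect to the circle: it forms negative circles with both arcs
between its ends. -/
lemma sgn_ear (h : EnumBattery σ B C n c ε) (hP : B.IsEar C (c i) (c j) X F) (hi : i ≤ n)
    (hj : j ≤ n) : sgn σ F = -(pot σ ε i * pot σ ε j) := by
  wlog hij : i < j generalizing i j
  · have hne : i ≠ j := fun hh => hP.ne (by rw [hh])
    rw [this hP.reverse hj hi (by omega), mul_comm]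
  obtain ⟨A, hA, hnA, hsA⟩ := h.exists_pathOn σ (Nat.zero_le n) hi
  obtain ⟨Z, hZ, hnZ, hsZ⟩ := h.exists_pathOn σ hj le_rfl
  rw [Set.uIcc_of_le (Nat.zero_le i)] at hA
  rw [Set.uIcc_of_le hj] at hZ
  have d1 : c '' Set.Icc 0 i ∩ X ⊆ {c i} := by
    rintro _ ⟨⟨k, hk, rfl⟩, hkX⟩
    rcases h.mem_ear hP hi hj (hk.2.trans hi) hkX with rfl | rfl
    · rfl
    · have := hk.2; omega
  have p1 := (hA.mono h.le).append hP.pathOn d1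
  have d2 : (c '' Set.Icc 0 i ∪ X) ∩ c '' Set.Icc j n ⊆ {c j} := by
    rintro _ ⟨h1, ⟨k, hk, rfl⟩⟩
    rcases h1 with h1 | h1
    · rw [h.mem_image_iff (fun l hl => hl.2.trans hi) hk.2] at h1
      have := hk.1; have := h1.2; omega
    · rcases h.mem_ear hP hi hj hk.2 h1 with rfl | rfl
      · have := hk.1; omega
      · rfl
  have p2 := p1.append (hZ.mono h.le) d2
  refine eq_neg_of_ne fun hs => ?_
  have key : ∀ p q r : ℤˣ, 1 * p * (p * q) * (q * r) = r := by decide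
  have := h.subset_of_pathOn p2 (by
    rintro ((h1 | h1) | h1)
    exacts [hnA h1, h.last_notMem_of_isEar hP h1, hnZ h1]) (by
    rw [sgn_append p1 (hZ.mono h.le) d2, sgn_append (hA.mono h.le) hP.pathOn d1, hsA, hs, hsZ,
      pot_zero, key])
  obtain ⟨f, hf⟩ := hP.pathOn.nonempty hP.ne
  exact absurd (this (Or.inl (Or.inr hf))) (Set.disjoint_left.1 hP.disj hf)

/-- The intervals spanned by two ears that meet at most on the circle are nested: otherwise a circle
through `ε n` that uses both ears is positive. -/
lemma nested (h : EnumBattery σ B C n c ε) {i₁ j₁ i₂ j₂ : ℕ}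
    (hP₁ : B.IsEar C (c i₁) (c j₁) X₁ F₁) (hP₂ : B.IsEar C (c i₂) (c j₂) X₂ F₂)
    (hX : X₁ ∩ X₂ ⊆ V(C)) (h₁ : i₁ < j₁) (h₂ : i₂ < j₂) (hi : i₁ < i₂) (hj : j₁ < j₂)
    (hn : j₂ ≤ n) : False := by
  obtain ⟨A, hA, hnA, hsA⟩ := h.exists_pathOn σ (Nat.zero_le n) (show i₁ ≤ n by omega)
  obtain ⟨M, hM, hnM, hsM⟩ := h.exists_pathOn σ (show j₁ ≤ n by omega) (show i₂ ≤ n by omega)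
  obtain ⟨Z, hZ, hnZ, hsZ⟩ := h.exists_pathOn σ hn le_rfl
  rw [Set.uIcc_of_le (Nat.zero_le i₁)] at hA
  rw [Set.uIcc_of_le hn] at hZ
  have hMsub : Set.uIcc j₁ i₂ ⊆ Set.Ioo i₁ j₂ := fun k hk =>
    ⟨lt_of_lt_of_le (lt_min h₁ hi) hk.1, lt_of_le_of_lt hk.2 (max_lt hj h₂)⟩
  have hA' := hA.mono h.le
  have hM' := hM.mono h.le
  have hZ' := hZ.mono h.le
  have e1 : ∀ k ≤ n, c k ∈ X₁ → k = i₁ ∨ k = j₁ := fun k hk =>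
    h.mem_ear hP₁ (by omega) (by omega) hk
  have e2 : ∀ k ≤ n, c k ∈ X₂ → k = i₂ ∨ k = j₂ := fun k hk =>
    h.mem_ear hP₂ (by omega) (by omega) hk
  have mA : ∀ k ≤ n, c k ∈ c '' Set.Icc 0 i₁ → k ≤ i₁ := fun k hk hk' =>
    ((h.mem_image_iff (fun l hl => hl.2.trans (by omega)) hk).1 hk').2
  have mM : ∀ k ≤ n, c k ∈ c '' Set.uIcc j₁ i₂ → i₁ < k ∧ k < j₂ := fun k hk hk' =>
    hMsub ((h.mem_image_iff (fun l hl => (hMsub hl).2.le.trans hn) hk).1 hk')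
  have d1 : c '' Set.Icc 0 i₁ ∩ X₁ ⊆ {c i₁} := by
    rintro _ ⟨⟨k, hk, rfl⟩, hkX⟩
    have := hk.2
    rcases e1 k (by omega) hkX with rfl | rfl
    · rfl
    · omega
  have p1 := hA'.append hP₁.pathOn d1
  have d2 : (c '' Set.Icc 0 i₁ ∪ X₁) ∩ c '' Set.uIcc j₁ i₂ ⊆ {c j₁} := by
    rintro _ ⟨h1, ⟨k, hk, rfl⟩⟩
    have hk' := hMsub hk
    have hkn : k ≤ n := hk'.2.le.trans hn
    rcases h1 with h1 | h1
    · have := mA k hkn h1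
      have := hk'.1
      omega
    · rcases e1 k hkn h1 with rfl | rfl
      · exact absurd hk'.1 (lt_irrefl _)
      · rfl
  have p2 := p1.append hM' d2
  have d3 : (c '' Set.Icc 0 i₁ ∪ X₁ ∪ c '' Set.uIcc j₁ i₂) ∩ X₂ ⊆ {c i₂} := by
    rintro t ⟨h1, ht⟩
    have htC : t ∈ V(C) := by
      rcases h1 with (⟨k, hk, rfl⟩ | h1) | ⟨k, hk, rfl⟩
      · exact h.mem (hk.2.trans (by omega))
      · exact hX ⟨h1, ht⟩
      · exact h.mem ((hMsub hk).2.le.trans hn)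
    obtain ⟨k, hk, rfl⟩ := h.surj t htC
    rcases e2 k hk ht with rfl | rfl
    · rfl
    · rcases h1 with (h1 | h1) | h1
      · have := mA _ hk h1; omega
      · rcases e1 _ hk h1 with rfl | rfl <;> omega
      · have := mM _ hk h1; omega
  have p3 := p2.append hP₂.pathOn d3
  have d4 : (c '' Set.Icc 0 i₁ ∪ X₁ ∪ c '' Set.uIcc j₁ i₂ ∪ X₂) ∩ c '' Set.Icc j₂ n ⊆ {c j₂} := by
    rintro _ ⟨h1, ⟨k, hk, rfl⟩⟩
    have hk1 := hk.1
    rcases h1 with ((h1 | h1) | h1) | h1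
    · have := mA k hk.2 h1; omega
    · rcases e1 k hk.2 h1 with rfl | rfl <;> omega
    · have := mM k hk.2 h1; omega
    · rcases e2 k hk.2 h1 with rfl | rfl
      · omega
      · rfl
  have p4 := p3.append hZ' d4
  have key : ∀ p q r s t : ℤˣ, 1 * p * -(p * q) * (q * r) * -(r * s) * (s * t) = t := by decide
  have := h.subset_of_pathOn p4 (by
    rintro ((((h1 | h1) | h1) | h1) | h1)
    exacts [hnA h1, h.last_notMem_of_isEar hP₁ h1, hnM h1, h.last_notMem_of_isEar hP₂ h1, hnZ h1])
    (by
      rw [sgn_append p3 hZ' d4, sgn_append p2 hP₂.pathOn d3, sgn_append p1 hM' d2,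
        sgn_append hA' hP₁.pathOn d1, hsA, hsM, hsZ, h.sgn_ear hP₁ (by omega) (by omega),
        h.sgn_ear hP₂ (by omega) (by omega), pot_zero, key])
  obtain ⟨f, hf⟩ := hP₁.pathOn.nonempty hP₁.ne
  exact absurd (this (Or.inl (Or.inl (Or.inl (Or.inr hf))))) (Set.disjoint_left.1 hP₁.disj hf)

/-- After switching such that the circle is all positive, any two of the legs of a tripod with ends
on the circle have different signs, which is impossible for three legs. So no bridge has three
vertices of attachment. -/
lemma eq_of_tripod (h : EnumBattery σ B C n c ε) {x₁ x₂ x₃ a₁ a₂ a₃ : α} {e₁ e₂ e₃ : β}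
    {X₃ : Set α} {F₃ : Set β}
    (hK : K.IsComponent (B.deleteVerts V(C)))
    (h₁ : B.PathOn q x₁ X₁ F₁) (h₂ : B.PathOn q x₂ X₂ F₂) (h₃ : B.PathOn q x₃ X₃ F₃)
    (hX₁ : X₁ ⊆ V(K)) (hX₂ : X₂ ⊆ V(K)) (hX₃ : X₃ ⊆ V(K))
    (h₁₂ : X₁ ∩ X₂ ⊆ {q}) (h₁₃ : X₁ ∩ X₃ ⊆ {q}) (h₂₃ : X₂ ∩ X₃ ⊆ {q})
    (he₁ : B.IsLink e₁ x₁ a₁) (he₂ : B.IsLink e₂ x₂ a₂) (he₃ : B.IsLink e₃ x₃ a₃)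
    (ha₁ : a₁ ∈ V(C)) (ha₂ : a₂ ∈ V(C)) (ha₃ : a₃ ∈ V(C)) (hne₁₂ : a₁ ≠ a₂) (hne₁₃ : a₁ ≠ a₃) :
    a₂ = a₃ := by
  by_contra hne₂₃
  obtain ⟨E₁₂, D₁₂⟩ := hK.isEar h.le h₁ h₂ hX₁ hX₂ h₁₂ he₁ he₂ hne₁₂ ha₁ ha₂
  obtain ⟨E₁₃, D₁₃⟩ := hK.isEar h.le h₁ h₃ hX₁ hX₃ h₁₃ he₁ he₃ hne₁₃ ha₁ ha₃
  obtain ⟨E₂₃, D₂₃⟩ := hK.isEar h.le h₂ h₃ hX₂ hX₃ h₂₃ he₂ he₃ hne₂₃ ha₂ ha₃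
  obtain ⟨i, hi, rfl⟩ := h.surj a₁ ha₁
  obtain ⟨j, hj, rfl⟩ := h.surj a₂ ha₂
  obtain ⟨k, hk, rfl⟩ := h.surj a₃ ha₃
  have f₁ := h₁.finite_edges.insert e₁
  have f₂ := h₂.finite_edges.insert e₂
  have f₃ := h₃.finite_edges.insert e₃
  have s₁₂ := h.sgn_ear E₁₂ hi hj
  have s₁₃ := h.sgn_ear E₁₃ hi hk
  have s₂₃ := h.sgn_ear E₂₃ hj hk
  rw [sgn_union f₁ f₂ D₁₂] at s₁₂
  rw [sgn_union f₁ f₃ D₁₃] at s₁₃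
  rw [sgn_union f₂ f₃ D₂₃] at s₂₃
  have key : ∀ p q r s t u : ℤˣ, p * q = -(s * t) → p * r = -(s * u) → q * r = -(t * u) →
      False := by decide
  exact key _ _ _ _ _ _ s₁₂ s₁₃ s₂₃

/-- Every bridge of the circle has exactly two vertices of attachment. -/
lemma exists_attachments (h : EnumBattery σ B C n c ε) (hB : B.EdgeNonsep)
    (hiso : ∀ x ∈ V(B), ∃ e, B.Inc e x) (hD : B.IsBridgeOf C D) :
    ∃ i j, i < j ∧ j ≤ n ∧ C.attachments D = {c i, c j} := by
  obtain ⟨x, hx, y, hy, hxy⟩ := hD.exists_ne_attachments hB hiso h.le ⟨ε n, h.edge_mem le_rfl⟩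
  have hatt : C.attachments D = {x, y} := by
    refine Set.Subset.antisymm ?_ (Set.insert_subset hx (by simpa using hy))
    intro z hz
    rcases hD.2 with ⟨c, s, t, hc, hV, -⟩ | ⟨K, hK, hV, -⟩
    · have hx' := hx.1
      have hy' := hy.1
      have hz' := hz.1
      rw [hV] at hx' hy' hz'
      simp only [Set.mem_insert_iff, Set.mem_singleton_iff] at hx' hy' hz' ⊢
      grind
    · have hK' : K.IsComponent (B.deleteVerts V(C)) := hK
      have aux : ∀ r ∈ C.attachments D, ∃ s ∈ V(K), ∃ f, B.IsLink f s r := by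
        rintro r ⟨hr, hrC⟩
        rw [hV] at hr
        rcases hr with hr | ⟨s, hs, f, hf⟩
        · exact absurd hrC (hK'.notMem hr)
        · exact ⟨s, hs, f, hf⟩
      obtain ⟨x', hx', e₁, he₁⟩ := aux x hx
      obtain ⟨y', hy', e₂, he₂⟩ := aux y hy
      obtain ⟨z', hz', e₃, he₃⟩ := aux z hz
      obtain ⟨q, X₁, F₁, X₂, F₂, X₃, F₃, h₁, h₂, h₃, hX₁, hX₂, hX₃, h₁₂, h₁₃, h₂₃⟩ :=
        hK'.exists_tripod hx' hy' hz'
      by_cases hzx : x = z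
      · exact Or.inl hzx.symm
      · exact Or.inr (h.eq_of_tripod hK' h₁ h₂ h₃ hX₁ hX₂ hX₃ h₁₂ h₁₃ h₂₃ he₁ he₂ he₃ hx.2 hy.2
          hz.2 hxy hzx).symm
  obtain ⟨i, hi, rfl⟩ := h.surj x hx.2
  obtain ⟨j, hj, rfl⟩ := h.surj y hy.2
  rcases lt_trichotomy i j with hij | rfl | hij
  · exact ⟨i, j, hij, hj, hatt⟩
  · exact absurd rfl hxy
  · exact ⟨j, i, hij, hi, by rw [hatt, Set.pair_comm]⟩

/-- Any two bridges span nested intervals. -/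
lemma bridges_nested (h : EnumBattery σ B C n c ε) {i₁ j₁ i₂ j₂ : ℕ}
    (hD : B.IsBridgeOf C D) (hD' : B.IsBridgeOf C D') (h₁ : i₁ < j₁) (hn₁ : j₁ ≤ n)
    (hA : C.attachments D = {c i₁, c j₁}) (h₂ : i₂ < j₂) (hn₂ : j₂ ≤ n)
    (hA' : C.attachments D' = {c i₂, c j₂}) :
    (i₁ ≤ i₂ ∧ j₂ ≤ j₁) ∨ (i₂ ≤ i₁ ∧ j₁ ≤ j₂) := by
  by_cases hDD : D = D'
  · subst hDD
    have key : ∀ {i j k l : ℕ}, i < j → j ≤ n → k < l → l ≤ n → C.attachments D = {c i, c j} →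
        C.attachments D = {c k, c l} → k ≤ i ∧ j ≤ l := by
      intro i j k l hij hj hkl hl h1 h2
      have hi' : c i ∈ ({c k, c l} : Set α) := h2 ▸ h1 ▸ Or.inl rfl
      have hj' : c j ∈ ({c k, c l} : Set α) := h2 ▸ h1 ▸ Or.inr rfl
      rcases hi' with hi' | hi' <;> rcases hj' with hj' | hj' <;>
      · have := h.inj _ (by omega) _ (by omega) hi'
        have := h.inj _ (by omega) _ (by omega) hj'
        omega
    exact Or.inr (key h₁ hn₁ h₂ hn₂ hA hA')
  have hne : ∀ {i j : ℕ}, i < j → j ≤ n → c i ≠ c j := fun hij hj hh => by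
    have := h.inj _ (by omega) _ hj hh
    omega
  obtain ⟨X₁, F₁, E₁, hX₁, -⟩ :=
    hD.exists_isEar h.le (hA ▸ Or.inl rfl) (hA ▸ Or.inr rfl) (hne h₁ hn₁)
  obtain ⟨X₂, F₂, E₂, hX₂, -⟩ :=
    hD'.exists_isEar h.le (hA' ▸ Or.inl rfl) (hA' ▸ Or.inr rfl) (hne h₂ hn₂)
  have hX : ∀ t ∈ X₁, t ∈ X₂ → t ∈ V(C) := fun t h1 h2 => by
    by_contra ht
    exact hDD (hD.eq_of_mem hD' (hX₁ h1) (hX₂ h2) ht)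
  by_contra hcon
  rcases lt_or_ge i₁ i₂ with hi | hi
  · rcases lt_or_ge j₁ j₂ with hj | hj
    · exact h.nested E₁ E₂ (fun t ht => hX t ht.1 ht.2) h₁ h₂ hi hj hn₂
    · omega
  · rcases lt_or_ge j₂ j₁ with hj | hj
    · exact h.nested E₂ E₁ (fun t ht => hX t ht.2 ht.1) h₂ h₁ (by omega) hj hn₁
    · omega

end EnumBattery

end Enumeration

/-! ### Subdivisions of `K₄` and small edge cuts -/

section SubdivisionK4

variable {α β : Type*} {H P : Graph α β} {x y : α} {p q : β} {S : Set α}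

lemma exists_isLink_of_reflTransGen (h : Relation.ReflTransGen P.Adj x y)
    (hxy : ¬ (x ∈ S ↔ y ∈ S)) : ∃ e a b, P.IsLink e a b ∧ a ∈ S ∧ b ∉ S := by
  induction h with
  | refl => exact absurd Iff.rfl hxy
  | @tail b c _ hbc ih =>
    by_cases hxb : x ∈ S ↔ b ∈ S
    · obtain ⟨e, he⟩ := hbc
      by_cases hb : b ∈ S
      · exact ⟨e, b, c, he, hb, fun hc => hxy (by tauto)⟩
      · exact ⟨e, c, b, he.symm, by tauto, hb⟩
    · exact ih hxb

/-- Every edge cut of `K₄` has at least three edges. -/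
lemma three_le_card_separated (s : Fin 4 → Bool) (h : ∃ i j, s i ≠ s j) :
    3 ≤ (Finset.univ.filter fun p : Fin 4 × Fin 4 => p.1 < p.2 ∧ s p.1 ≠ s p.2).card := by
  revert s; decide

/-- If at most two edges lead from `S` to its complement, then `S` contains all four branch vertices
of a subdivision of `K₄` or none of them. -/
lemma branch_mem_iff {f : Fin 4 → α} {P : Fin 4 → Fin 4 → Graph α β}
    (hP : ∀ i j, i < j → P i j ≤ H ∧ (P i j).IsPathFromTo (f i) (f j))
    (hdisj : ∀ i j k l, i < j → k < l → (i, j) ≠ (k, l) →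
      V(P i j) ∩ V(P k l) ⊆ f '' (({i, j} : Set (Fin 4)) ∩ {k, l}))
    (hcut : ∀ e a b, H.IsLink e a b → a ∈ S → b ∉ S → e = p ∨ e = q) (i j : Fin 4) :
    f i ∈ S ↔ f j ∈ S := by
  classical
  by_contra hij
  -- At least three of the six paths lead from `S` to its complement, so two of them would have to
  -- share one of the edges `p` and `q`.
  have h3 := three_le_card_separated (fun i => decide (f i ∈ S)) ⟨i, j, by simpa using hij⟩
  set A := Finset.univ.filter fun p : Fin 4 × Fin 4 =>
    p.1 < p.2 ∧ decide (f p.1 ∈ S) ≠ decide (f p.2 ∈ S) with hA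
  have hex : ∀ r ∈ A, ∃ e, (e = p ∨ e = q) ∧
      ∃ a b, (P r.1 r.2).IsLink e a b ∧ a ∈ S ∧ b ∉ S := by
    rintro ⟨k, l⟩ hr
    simp only [hA, Finset.mem_filter, Finset.mem_univ, true_and, ne_eq, decide_eq_decide] at hr
    obtain ⟨hle, hconn, -, hk, hl, -⟩ := hP k l hr.1
    obtain ⟨e, a, b, he, ha, hb⟩ := exists_isLink_of_reflTransGen (hconn.2 _ hk _ hl) hr.2
    exact ⟨e, hcut e a b (he.mono hle) ha hb, a, b, he, ha, hb⟩
  have : Nonempty β := ⟨p⟩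
  choose! g hg hg' using hex
  obtain ⟨⟨k, l⟩, hr, ⟨k', l'⟩, hr', hne, heq⟩ :=
    Finset.exists_ne_map_eq_of_card_lt_of_maps_to (s := A) (t := {p, q}) (f := g)
      (lt_of_le_of_lt Finset.card_le_two h3) (fun r hr => by simpa using hg r hr)
  obtain ⟨a, b, hab, ha, hb⟩ := hg' _ hr
  obtain ⟨a', b', hab', -, -⟩ := hg' _ hr'
  simp only [hA, Finset.mem_filter, Finset.mem_univ, true_and] at hr hr'
  rw [heq] at hab
  have hl' := (IsSubgraph.isLink_iff (hP k' l' hr'.1).1 hab'.edge_mem).2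
    (hab.mono (hP k l hr.1).1)
  obtain ⟨s, hs, rfl⟩ := hdisj k l k' l' hr.1 hr'.1 hne ⟨hab.left_mem, hl'.left_mem⟩
  obtain ⟨t, ht, rfl⟩ := hdisj k l k' l' hr.1 hr'.1 hne ⟨hab.right_mem, hl'.right_mem⟩
  have hst : s ≠ t := by
    rintro rfl
    exact hb ha
  have h1 := hr.1
  have h2 := hr'.1
  simp only [Set.mem_inter_iff, Set.mem_insert_iff, Set.mem_singleton_iff] at hs ht
  apply hne
  rw [Prod.mk.injEq]
  omega

end SubdivisionK4

/-! ### Circles with nested chords -/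

section Nested

variable {α β : Type*} {G C P : Graph α β} {x y a b : α} {e f d : β}
  {X : Set α} {F : Set β} {n i j k m : ℕ} {c : ℕ → α} {ε : ℕ → β}

/-- The graph formed by a path is a path in the sense of the degree condition. -/
lemma PathOn.isPathFromTo (h : G.PathOn x y X F) (hxy : x ≠ y) :
    G.sub X F ≤ G ∧ E(G.sub X F) = F ∧ (G.sub X F).IsPathFromTo x y := by
  have hE : E(G.sub X F) = F := edgeSet_sub h.subset_edgeSet fun e he z hz => h.mem_of_inc he hz
  have hle : G.sub X F ≤ G := sub_le h.subset_vertexSet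
  have hinc : ∀ f z, (G.sub X F).Inc f z ↔ G.Inc f z ∧ f ∈ F := by
    intro f z
    constructor
    · exact fun hf => ⟨hf.mono hle, hE ▸ hf.edge_mem⟩
    · exact fun hf => (IsSubgraph.inc_congr hle (hE.symm ▸ hf.2)).2 hf.1
  have hnl : ∀ f ∈ F, ∀ z, ¬ (G.sub X F).IsLoopAt f z := fun f hf z hz =>
    h.not_isLoopAt hf (hz.mono hle)
  refine ⟨hle, hE, ?_, hxy, h.left_mem, h.right_mem, ?_, ?_, ?_⟩
  · have h' : (G.sub X F).PathOn x y X F := h.of_le hle subset_rfl hE.symm.subset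
    exact isConn_of_reach h.left_mem fun z hz => h'.reflTransGen hz
  · obtain ⟨f, hf, hf'⟩ := h.inc_left hxy
    refine deg_eq_one (e := f) (fun g => ?_) (hnl f hf x)
    rw [hinc]
    exact ⟨fun hg => (hf' g hg.2).1 hg.1, by rintro rfl; exact ⟨(hf' _ hf).2 rfl, hf⟩⟩
  · obtain ⟨f, hf, hf'⟩ := h.inc_right hxy
    refine deg_eq_one (e := f) (fun g => ?_) (hnl f hf y)
    rw [hinc]
    exact ⟨fun hg => (hf' g hg.2).1 hg.1, by rintro rfl; exact ⟨(hf' _ hf).2 rfl, hf⟩⟩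
  · intro z hz hzx hzy
    obtain ⟨f₁, hf₁, f₂, hf₂, hne, hf⟩ := h.inc_mid hz hzx hzy
    refine deg_eq_two_of_pair hne (fun g => ?_) (hnl f₁ hf₁ z) (hnl f₂ hf₂ z)
    rw [hinc]
    constructor
    · exact fun hg => (hf g hg.2).1 hg.1
    · rintro (rfl | rfl)
      exacts [⟨(hf _ hf₁).2 (Or.inl rfl), hf₁⟩, ⟨(hf _ hf₂).2 (Or.inr rfl), hf₂⟩]

/-- The index before `k` in the cyclic order of `0, …, n`. -/
def cycPred (n k : ℕ) : ℕ := if k = 0 then n else k - 1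

namespace CycEnum

lemma inc_iff (h : C.CycEnum n c ε) (hm : m ≤ n) (hk : k ≤ n) :
    C.Inc (ε m) (c k) ↔ m = k ∨ m = cycPred n k := by
  rw [cycPred]
  rcases hm.lt_or_eq with hm' | rfl
  · constructor
    · intro hi
      rcases hi.eq_or_eq_of_isLink (h.link m hm') with hh | hh
      · exact Or.inl (h.inj _ hk _ hm hh).symm
      · have := h.inj _ hk _ (by omega) hh
        split_ifs <;> omega
    · intro hi
      rcases hi with rfl | hi
      · exact (h.link _ hm').inc_left
      · split_ifs at hi with h0
        · omega
        · have hk' : k = m + 1 := by omega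
          rw [hk']
          exact (h.link m hm').inc_right
  · constructor
    · intro hi
      rcases hi.eq_or_eq_of_isLink h.close with hh | hh
      · exact Or.inl (h.inj _ hk _ le_rfl hh).symm
      · have := h.inj _ hk _ (by omega) hh
        exact Or.inr (by simp [this])
    · intro hi
      rcases hi with rfl | hi
      · exact h.close.inc_left
      · split_ifs at hi with h0
        · rw [h0]; exact h.close.inc_right
        · omega

lemma not_isLoopAt (h : C.CycEnum n c ε) (hn : 1 ≤ n) (hm : m ≤ n) : ¬ C.IsLoopAt (ε m) x := by
  intro hl
  rcases hm.lt_or_eq with hm' | rfl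
  · have := (hl.eq_of_inc (h.link m hm').inc_left).symm.trans
      (hl.eq_of_inc (h.link m hm').inc_right)
    have := h.inj _ hm _ (by omega) this
    omega
  · have := (hl.eq_of_inc h.close.inc_left).symm.trans (hl.eq_of_inc h.close.inc_right)
    have := h.inj _ le_rfl _ (by omega) this
    omega

lemma cycPred_le (hk : k ≤ n) : cycPred n k ≤ n := by
  rw [cycPred]; split_ifs <;> omega

lemma cycPred_ne (hn : 1 ≤ n) : k ≠ cycPred n k := by
  rw [cycPred]; split_ifs <;> omega

lemma edge_mem_image_iff (h : C.CycEnum n c ε) {A : Set ℕ} (hA : A ⊆ Set.Iic n) (hi : i ≤ n) :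
    ε i ∈ ε '' A ↔ i ∈ A :=
  ⟨fun ⟨_, hj, hji⟩ => h.edge_inj _ (hA hj) _ hi hji ▸ hj, fun hi => ⟨i, hi, rfl⟩⟩

/-- The degree of a vertex in a subgraph of an enumerated circle. -/
lemma deg_sub (h : C.CycEnum n c ε) (hn : 1 ≤ n) (hP : P ≤ C) (hk : k ≤ n) :
    (P.deg (c k) = 1 → ¬ (ε k ∈ E(P) ↔ ε (cycPred n k) ∈ E(P))) ∧
      (P.deg (c k) = 2 → (ε k ∈ E(P) ↔ ε (cycPred n k) ∈ E(P))) := by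
  have hinc : ∀ g, P.Inc g (c k) ↔ (g = ε k ∨ g = ε (cycPred n k)) ∧ g ∈ E(P) := by
    intro g
    constructor
    · intro hg
      obtain ⟨m, hm, rfl⟩ := h.edge_surj g (hg.mono hP).edge_mem
      refine ⟨?_, hg.edge_mem⟩
      rcases (h.inc_iff hm hk).1 (hg.mono hP) with rfl | rfl
      exacts [Or.inl rfl, Or.inr rfl]
    · rintro ⟨rfl | rfl, hg⟩
      · exact (IsSubgraph.inc_congr hP hg).2 ((h.inc_iff hk hk).2 (Or.inl rfl))
      · exact (IsSubgraph.inc_congr hP hg).2 ((h.inc_iff (cycPred_le hk) hk).2 (Or.inr rfl))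
  have hne : ε k ≠ ε (cycPred n k) := fun hh =>
    cycPred_ne hn (h.edge_inj _ hk _ (cycPred_le hk) hh)
  have hl1 : ¬ P.IsLoopAt (ε k) (c k) := fun hl => h.not_isLoopAt hn hk (hl.mono hP)
  have hl2 : ¬ P.IsLoopAt (ε (cycPred n k)) (c k) := fun hl =>
    h.not_isLoopAt hn (cycPred_le hk) (hl.mono hP)
  by_cases h1 : ε k ∈ E(P) <;> by_cases h2 : ε (cycPred n k) ∈ E(P)
  · have : P.deg (c k) = 2 := deg_eq_two_of_pair hne (fun g => by rw [hinc]; grind) hl1 hl2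
    simp [this, h1, h2]
  · have : P.deg (c k) = 1 := deg_eq_one (fun g => by rw [hinc]; grind) hl1
    simp [this, h1, h2]
  · have : P.deg (c k) = 1 := deg_eq_one (fun g => by rw [hinc]; grind) hl2
    simp [this, h1, h2]
  · have : P.deg (c k) = 0 := by
      have h3 : P.incidenceSet (c k) = ∅ := by
        ext g; simp only [mem_incidenceSet, hinc, Set.mem_empty_iff_false, iff_false]; grind
      have h4 := Set.subset_eq_empty (P.loopSet_subset_incidenceSet (c k)) h3
      rw [deg, h3, h4]; simp
    simp [this]

/-- A path in an enumerated circle with ends `c i` and `c j` is one of the two arcs. -/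
lemma edgeSet_of_isPathFromTo (h : C.CycEnum n c ε) (hn : 1 ≤ n) (hP : P ≤ C) (hij : i < j)
    (hj : j ≤ n) (hp : P.IsPathFromTo (c i) (c j)) :
    E(P) = ε '' Set.Ico i j ∨ E(P) = ε '' (Set.Iic n \ Set.Ico i j) := by
  have hsame : ∀ k ≤ n, k ≠ i → k ≠ j → (ε k ∈ E(P) ↔ ε (cycPred n k) ∈ E(P)) := by
    intro k hk hki hkj
    by_cases hkP : c k ∈ V(P)
    · exact (h.deg_sub hn hP hk).2 (hp.2.2.2.2.2.2 _ hkP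
        (fun hh => hki (h.inj _ hk _ (by omega) hh)) fun hh => hkj (h.inj _ hk _ (by omega) hh))
    · have aux : ∀ m ≤ n, C.Inc (ε m) (c k) → ε m ∉ E(P) := fun m hm hi hmP =>
        hkP ((IsSubgraph.inc_congr hP hmP).2 hi).vertex_mem
      exact iff_of_false (aux k hk ((h.inc_iff hk hk).2 (Or.inl rfl)))
        (aux _ (cycPred_le hk) ((h.inc_iff (cycPred_le hk) hk).2 (Or.inr rfl)))
  have hdj := (h.deg_sub hn hP hj).1 hp.2.2.2.2.2.1
  have hpred : ∀ k, cycPred n (k + 1) = k := fun k => by simp [cycPred]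
  have h1 : ∀ k, i ≤ k → k < j → (ε k ∈ E(P) ↔ ε i ∈ E(P)) := by
    intro k hk
    induction k, hk using Nat.le_induction with
    | base => exact fun _ => Iff.rfl
    | succ k hk ih =>
      intro hkj
      rw [hsame (k + 1) (by omega) (by omega) (by omega), hpred, ih (by omega)]
  have h2 : ∀ k, j ≤ k → k ≤ n → (ε k ∈ E(P) ↔ ε j ∈ E(P)) := by
    intro k hk
    induction k, hk using Nat.le_induction with
    | base => exact fun _ => Iff.rfl
    | succ k hk ih =>
      intro hkj
      rw [hsame (k + 1) (by omega) (by omega) (by omega), hpred, ih (by omega)]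
  have h3 : ∀ k, k < i → (ε k ∈ E(P) ↔ ε j ∈ E(P)) := by
    intro k
    induction k with
    | zero =>
      intro hi
      rw [hsame 0 (by omega) (by omega) (by omega), show cycPred n 0 = n by simp [cycPred],
        h2 n hj le_rfl]
    | succ k ih =>
      intro hkj
      rw [hsame (k + 1) (by omega) (by omega) (by omega), hpred, ih (by omega)]
  obtain ⟨j', rfl⟩ : ∃ j', j = j' + 1 := ⟨j - 1, by omega⟩
  rw [hpred, h1 j' (by omega) (by omega)] at hdj
  have hmem : ∀ A ⊆ Set.Iic n, (∀ k ≤ n, ε k ∈ E(P) ↔ k ∈ A) → E(P) = ε '' A := by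
    intro A hA hh
    ext g
    constructor
    · intro hg
      obtain ⟨k, hk, rfl⟩ := h.edge_surj g (IsSubgraph.edgeSet_mono hP hg)
      exact ⟨k, (hh k hk).1 hg, rfl⟩
    · rintro ⟨k, hk, rfl⟩
      exact (hh k (hA hk)).2 hk
  by_cases hi : ε i ∈ E(P)
  · left
    refine hmem _ (fun k hk => hk.2.le.trans hj) fun k hk => ?_
    rw [Set.mem_Ico]
    by_cases hk1 : i ≤ k
    · by_cases hk2 : k < j' + 1
      · simp [h1 k hk1 hk2, hi, hk1, hk2]
      · have := h2 k (by omega) hk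
        tauto
    · have := h3 k (by omega)
      tauto
  · right
    refine hmem _ Set.sdiff_subset fun k hk => ?_
    simp only [Set.mem_sdiff, Set.mem_Iic, Set.mem_Ico]
    by_cases hk1 : i ≤ k
    · by_cases hk2 : k < j' + 1
      · simp [h1 k hk1 hk2, hi, hk1, hk2]
      · have := h2 k (by omega) hk
        tauto
    · have := h3 k (by omega)
      tauto

end CycEnum

/-- The indices `i < j` of the ends of a chord of an enumerated circle. -/
def ChordIdx (G C : Graph α β) (n : ℕ) (c : ℕ → α) (i j : ℕ) : Prop :=
  i < j ∧ j ≤ n ∧ ∃ d, G.IsChordWithEnds C d (c i) (c j)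

lemma IsChordWithEnds.symm (h : G.IsChordWithEnds C d x y) : G.IsChordWithEnds C d y x :=
  ⟨h.1, h.2.2.1, h.2.1, h.2.2.2.1.symm, h.2.2.2.2.symm⟩

lemma CycEnum.exists_chordIdx (h : C.CycEnum n c ε) (hd : G.IsChordWithEnds C d x y) :
    ∃ i j, G.ChordIdx C n c i j ∧ G.IsLink d (c i) (c j) ∧
      (x = c i ∧ y = c j ∨ x = c j ∧ y = c i) := by
  obtain ⟨i, hi, rfl⟩ := h.surj x hd.2.1
  obtain ⟨j, hj, rfl⟩ := h.surj y hd.2.2.1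
  rcases lt_trichotomy i j with hij | rfl | hij
  · exact ⟨i, j, ⟨hij, hj, d, hd⟩, hd.2.2.2.2, Or.inl ⟨rfl, rfl⟩⟩
  · exact absurd rfl hd.2.2.2.1
  · exact ⟨j, i, ⟨hij, hi, d, hd.symm⟩, hd.2.2.2.2.symm, Or.inr ⟨rfl, rfl⟩⟩

/-- Chords that span nested intervals do not cross: either two of their four ends coincide, or the
ends of the inner one can be cut off from the others by two edges. -/
lemma CycEnum.not_chordsCross (h : C.CycEnum n c ε) {d₁ d₂ : β} {i₁ j₁ i₂ j₂ : ℕ}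
    (hle : C ≤ G)
    (hd₁ : G.IsLink d₁ (c i₁) (c j₁)) (hd₂ : G.IsLink d₂ (c i₂) (c j₂)) (h₂ : i₂ < j₂)
    (hn : j₁ ≤ n) (hi : i₁ ≤ i₂) (hj : j₂ ≤ j₁) : ¬ G.ChordsCross C d₁ d₂ := by
  rintro ⟨f, P, hf, hP, hdisj, -, -⟩
  have hH : ∀ e a b, ((G.induce V(C)).restrict (E(C) ∪ {d₁, d₂})).IsLink e a b →
      C.IsLink e a b ∨ e = d₁ ∧ G.IsLink d₁ a b ∨ e = d₂ ∧ G.IsLink d₂ a b := by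
    intro e a b he
    have he' := (sub_isLink (X := V(C))).1 he
    rcases he'.2 with heC | rfl | rfl
    · exact Or.inl ((IsSubgraph.isLink_iff hle heC).2 he'.1.1)
    · exact Or.inr (Or.inl ⟨rfl, he'.1.1⟩)
    · exact Or.inr (Or.inr ⟨rfl, he'.1.1⟩)
  have hfV : ∀ s, f s ∈ V(C) := by
    have aux : ∀ s t, s < t → f s ∈ V(C) ∧ f t ∈ V(C) := fun s t hst =>
      ⟨IsSubgraph.vertexSet_mono (hP s t hst).1 (hP s t hst).2.2.2.1,
        IsSubgraph.vertexSet_mono (hP s t hst).1 (hP s t hst).2.2.2.2.1⟩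
    intro s
    by_cases hs : s < 3
    · exact (aux s 3 hs).1
    · exact (aux 0 s (by omega)).2
  choose g hgn hg using fun s => h.surj (f s) (hfV s)
  have hginj : Function.Injective g := fun s t hst => hf (by rw [← hg s, ← hg t, hst])
  -- A branch vertex that is not an end of one of the chords has only two edges, and can be cut off.
  have hgmem : ∀ s, g s ∈ ({i₁, j₁, i₂, j₂} : Finset ℕ) := by
    intro s
    by_contra hs
    simp only [Finset.mem_insert, Finset.mem_singleton, not_or] at hs
    have key := branch_mem_iff (S := {f s}) (p := ε (g s)) (q := ε (cycPred n (g s))) hP hdisj (by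
      rintro e a b he rfl -
      rcases hH e _ b he with he | ⟨rfl, he⟩ | ⟨rfl, he⟩
      · obtain ⟨m, hm, rfl⟩ := h.edge_surj e he.edge_mem
        have := he.inc_left
        rw [← hg s, h.inc_iff hm (hgn s)] at this
        rcases this with rfl | rfl
        exacts [Or.inl rfl, Or.inr rfl]
      · rw [← hg s] at he
        rcases he.left_eq_or_eq hd₁ with hh | hh
        · have := h.inj _ (hgn s) _ (by omega) hh; omega
        · have := h.inj _ (hgn s) _ (by omega) hh; omega
      · rw [← hg s] at he
        rcases he.left_eq_or_eq hd₂ with hh | hh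
        · have := h.inj _ (hgn s) _ (by omega) hh; omega
        · have := h.inj _ (hgn s) _ (by omega) hh; omega)
    have h0 := hf ((key s 0).1 rfl : f 0 = f s)
    have h1 := hf ((key s 1).1 rfl : f 1 = f s)
    exact absurd (h0.trans h1.symm) (by decide)
  have himg : Finset.univ.image g = {i₁, j₁, i₂, j₂} := by
    refine Finset.eq_of_subset_of_card_le (fun k hk => ?_) ?_
    · obtain ⟨s, -, rfl⟩ := Finset.mem_image.1 hk
      exact hgmem s
    · rw [Finset.card_image_of_injective _ hginj]
      exact Finset.card_le_four
  have hcard : ({i₁, j₁, i₂, j₂} : Finset ℕ).card = 4 := by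
    rw [← himg, Finset.card_image_of_injective _ hginj]
    rfl
  have hii : i₁ ≠ i₂ := by
    rintro rfl
    rw [Finset.insert_eq_of_mem (by simp)] at hcard
    have : ({j₁, i₁, j₂} : Finset ℕ).card ≤ 3 := Finset.card_le_three
    omega
  have hjj : j₁ ≠ j₂ := by
    rintro rfl
    rw [Finset.insert_comm j₁ i₂, Finset.pair_eq_singleton] at hcard
    have : ({i₁, i₂, j₁} : Finset ℕ).card ≤ 3 := Finset.card_le_three
    omega
  obtain ⟨s, -, hs⟩ := Finset.mem_image.1 (himg.symm ▸ (by simp) : i₁ ∈ Finset.univ.image g)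
  obtain ⟨t, -, ht⟩ := Finset.mem_image.1 (himg.symm ▸ (by simp) : i₂ ∈ Finset.univ.image g)
  -- Otherwise all four ends are branch vertices. The arc from `c i₂` to `c j₂` is joined to the
  -- rest by two edges only, but contains `c i₂` and not `c i₁`.
  have hmem : ∀ k ≤ n, c k ∈ c '' Set.Icc i₂ j₂ ↔ i₂ ≤ k ∧ k ≤ j₂ := fun k hk =>
    h.mem_image_iff (fun l hl => hl.2.trans (by omega)) hk
  have key := branch_mem_iff (S := c '' Set.Icc i₂ j₂) (p := ε j₂) (q := ε (cycPred n i₂)) hP hdisj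
    (by
      rintro e a b he ha hb
      rcases hH e a b he with he | ⟨rfl, he⟩ | ⟨rfl, he⟩
      · obtain ⟨m, hm, rfl⟩ := h.edge_surj e he.edge_mem
        obtain ⟨k, hk, rfl⟩ := h.surj a he.left_mem
        obtain ⟨l, hl, rfl⟩ := h.surj b he.right_mem
        rw [hmem _ hk] at ha
        rw [hmem _ hl] at hb
        have hne : k ≠ l := by rintro rfl; exact hb ha
        have h1 := (h.inc_iff hm hk).1 he.inc_left
        have h2 := (h.inc_iff hm hl).1 he.inc_right
        have : m = j₂ ∨ m = cycPred n i₂ := by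
          rw [cycPred] at h1 h2 ⊢
          split_ifs at * <;> omega
        rcases this with rfl | rfl
        exacts [Or.inl rfl, Or.inr rfl]
      · exfalso
        rcases he.left_eq_or_eq hd₁ with rfl | rfl
        · rw [hmem _ (by omega)] at ha; omega
        · rw [hmem _ (by omega)] at ha; omega
      · exfalso
        apply hb
        rcases he.right_eq_or_eq hd₂ with rfl | rfl
        · rw [hmem _ (by omega)]; omega
        · rw [hmem _ (by omega)]; omega) s t
  rw [← hg s, ← hg t, hs, ht, hmem _ (by omega), hmem _ (by omega)] at key
  omega

/-- A subgraph without isolated vertices is determined by its edges. -/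
lemma eq_of_edgeSet_eq {P' : Graph α β} (h : P ≤ C) (h' : P' ≤ C) (hP : ∀ x ∈ V(P), ∃ e, P.Inc e x)
    (hP' : ∀ x ∈ V(P'), ∃ e, P'.Inc e x) (hE : E(P) = E(P')) : P = P' := by
  have key : ∀ Q : Graph α β, Q ≤ C → (∀ x ∈ V(Q), ∃ e, Q.Inc e x) →
      V(Q) = {x | ∃ e ∈ E(Q), C.Inc e x} := by
    intro Q hQ hi
    ext x
    constructor
    · intro hx
      obtain ⟨e, he⟩ := hi x hx
      exact ⟨e, he.edge_mem, he.mono hQ⟩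
    · rintro ⟨e, he, hx⟩
      exact ((IsSubgraph.inc_congr hQ he).2 hx).vertex_mem
  exact eq_of_le_of_le h h' (by rw [key P h hP, key P' h' hP', hE]) hE

lemma IsPathFromTo.symm (h : P.IsPathFromTo x y) : P.IsPathFromTo y x := by
  obtain ⟨h1, h2, h3, h4, h5, h6, h7⟩ := h
  exact ⟨h1, h2.symm, h4, h3, h6, h5, fun z hz hy hx => h7 z hz hx hy⟩

lemma IsPathFromTo.exists_inc (h : P.IsPathFromTo x y) (ha : a ∈ V(P)) : ∃ e, P.Inc e a := by
  have : ∃ e, e ∈ E(P) := by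
    by_contra! hcon
    have h1 : P.incidenceSet x = ∅ :=
      Set.eq_empty_of_forall_notMem fun e he => hcon e (Inc.edge_mem he)
    have h2 := Set.subset_eq_empty (P.loopSet_subset_incidenceSet x) h1
    have := h.2.2.2.2.1
    rw [deg, h1, h2] at this
    simp at this
  obtain ⟨e, he⟩ := this
  exact h.1.exists_inc he ha

/-- The arc of an enumerated circle from `c j` to `c i` that passes through `ε n`. -/
lemma CycEnum.pathOn_compl (h : C.CycEnum n c ε) (hij : i < j) (hj : j ≤ n) :
    C.PathOn (c j) (c i) (c '' (Set.Icc j n ∪ Set.Icc 0 i)) (ε '' (Set.Iic n \ Set.Ico i j)) := by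
  have hA := h.pathOn_Icc (Nat.zero_le i) (by omega)
  have hZ := h.pathOn_Icc hj le_rfl
  have hsub : Set.Icc 0 i ⊆ Set.Iic n := fun k hk => by
    have := hk.2
    simp only [Set.mem_Iic]
    omega
  have hnA : c n ∉ c '' Set.Icc 0 i := by
    rw [h.mem_image_iff hsub le_rfl, Set.mem_Icc]
    omega
  refine (hZ.append (.cons h.close hA hnA) ?_).congr ?_ ?_
  · rintro _ ⟨⟨k, hk, rfl⟩, hk' | hk'⟩
    · exact hk'
    · rw [h.mem_image_iff hsub hk.2] at hk'
      have := hk.1; have := hk'.2; omega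
  · rw [Set.image_union, Set.union_insert, Set.insert_eq_of_mem]
    exact Or.inl ⟨n, ⟨hj, le_rfl⟩, rfl⟩
  · rw [← Set.image_insert_eq, ← Set.image_union]
    congr 1
    ext k
    simp only [Set.mem_union, Set.mem_insert_iff, Set.mem_Ico, Set.mem_sdiff, Set.mem_Iic]
    omega

/-- A circle with at least one chord, any two of whose chords span nested intervals, is
2-handled. The two handles are the interval of the innermost chord and the complement of the
interval of the outermost one. -/
theorem CycEnum.isTwoHandled (h : C.CycEnum n c ε) (hn : 1 ≤ n) (hle : C ≤ G)
    (hne : ∃ i j, G.ChordIdx C n c i j)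
    (hnest : ∀ i₁ j₁ i₂ j₂, G.ChordIdx C n c i₁ j₁ → G.ChordIdx C n c i₂ j₂ →
      (i₁ ≤ i₂ ∧ j₂ ≤ j₁) ∨ (i₂ ≤ i₁ ∧ j₁ ≤ j₂)) :
    G.IsTwoHandled C := by
  constructor
  · rintro d₁ d₂ ⟨x₁, y₁, h₁⟩ ⟨x₂, y₂, h₂⟩
    obtain ⟨i₁, j₁, hc₁, hl₁, -⟩ := h.exists_chordIdx h₁
    obtain ⟨i₂, j₂, hc₂, hl₂, -⟩ := h.exists_chordIdx h₂
    rcases hnest _ _ _ _ hc₁ hc₂ with hh | hh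
    · exact h.not_chordsCross hle hl₁ hl₂ hc₂.1 hc₁.2.1 hh.1 hh.2
    · rw [ChordsCross, Set.pair_comm]
      exact h.not_chordsCross hle hl₂ hl₁ hc₁.1 hc₂.2.1 hh.1 hh.2
  · have hends : ∀ i j, G.ChordIdx C n c i j → c i ∈ G.chordEnds C ∧ c j ∈ G.chordEnds C :=
      fun i j ⟨_, _, d, hd⟩ => ⟨⟨d, _, hd⟩, ⟨d, _, hd.symm⟩⟩
    have hends' : ∀ k ≤ n, c k ∈ G.chordEnds C → ∃ i j, G.ChordIdx C n c i j ∧ (k = i ∨ k = j) := by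
      rintro k hk ⟨d, y, hd⟩
      obtain ⟨i, j, hij, -, ⟨h1, -⟩ | ⟨h1, -⟩⟩ := h.exists_chordIdx hd
      · exact ⟨i, j, hij, Or.inl (h.inj _ hk _ (hij.1.le.trans hij.2.1) h1)⟩
      · exact ⟨i, j, hij, Or.inr (h.inj _ hk _ hij.2.1 h1)⟩
    -- the innermost chord
    obtain ⟨i₀, j₀, h₀, hin⟩ : ∃ i₀ j₀, G.ChordIdx C n c i₀ j₀ ∧
        ∀ i j, G.ChordIdx C n c i j → i ≤ i₀ ∧ j₀ ≤ j := by
      classical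
      have hex : ∃ m i j, G.ChordIdx C n c i j ∧ j - i = m := by
        obtain ⟨i, j, hij⟩ := hne
        exact ⟨_, i, j, hij, rfl⟩
      obtain ⟨i₀, j₀, h₀, hm⟩ := Nat.find_spec hex
      refine ⟨i₀, j₀, h₀, fun i j hij => ?_⟩
      have hle := Nat.find_min' hex ⟨i, j, hij, rfl⟩
      have h1 := h₀.1
      have h2 := hij.1
      rcases hnest _ _ _ _ h₀ hij with hh | hh <;> omega
    -- the outermost chord
    obtain ⟨i₁, j₁, h₁, hout⟩ : ∃ i₁ j₁, G.ChordIdx C n c i₁ j₁ ∧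
        ∀ i j, G.ChordIdx C n c i j → i₁ ≤ i ∧ j ≤ j₁ := by
      classical
      have hex : ∃ m i j, G.ChordIdx C n c i j ∧ n - (j - i) = m := by
        obtain ⟨i, j, hij⟩ := hne
        exact ⟨_, i, j, hij, rfl⟩
      obtain ⟨i₁, j₁, h₁, hm⟩ := Nat.find_spec hex
      refine ⟨i₁, j₁, h₁, fun i j hij => ?_⟩
      have hle := Nat.find_min' hex ⟨i, j, hij, rfl⟩
      have h2 := h₁.1
      have h3 := hij.1
      have h4 := h₁.2.1
      have h5 := hij.2.1
      rcases hnest _ _ _ _ h₁ hij with hh | hh <;> omega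
    have hne₀ : c i₀ ≠ c j₀ := fun hh => by
      have := h.inj _ (h₀.1.le.trans h₀.2.1) _ h₀.2.1 hh
      exact absurd h₀.1 (by omega)
    have hne₁ : c j₁ ≠ c i₁ := fun hh => by
      have := h.inj _ h₁.2.1 _ (h₁.1.le.trans h₁.2.1) hh
      exact absurd h₁.1 (by omega)
    obtain ⟨hle₀, hE₀, hp₀⟩ := (h.pathOn_Icc h₀.1.le h₀.2.1).isPathFromTo hne₀
    obtain ⟨hle₁, hE₁, hp₁⟩ := (h.pathOn_compl h₁.1 h₁.2.1).isPathFromTo hne₁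
    set P₀ := C.sub (c '' Set.Icc i₀ j₀) (ε '' Set.Ico i₀ j₀) with hP₀
    set P₁ := C.sub (c '' (Set.Icc j₁ n ∪ Set.Icc 0 i₁)) (ε '' (Set.Iic n \ Set.Ico i₁ j₁)) with hP₁
    have hset : {P : Graph α β | G.IsHandle C P} = {P₀, P₁} := by
      ext P
      constructor
      · rintro ⟨x, y, hP, hp, -, -, hint, d, hd⟩
        obtain ⟨i, j, hij, -, hxy⟩ := h.exists_chordIdx hd
        have hij1 := hij.1
        have hij2 := hij.2.1
        have hp' : P.IsPathFromTo (c i) (c j) := by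
          rcases hxy with ⟨rfl, rfl⟩ | ⟨rfl, rfl⟩
          exacts [hp, hp.symm]
        have hint' : ∀ k ≤ n, c k ∈ V(P) → c k ∈ G.chordEnds C → k = i ∨ k = j := by
          intro k hk hkP hkC
          have : c k = c i ∨ c k = c j := by
            rcases hxy with ⟨rfl, rfl⟩ | ⟨rfl, rfl⟩
            exacts [hint _ hkP hkC, (hint _ hkP hkC).symm]
          exact this.imp (h.inj _ hk _ (by omega)) (h.inj _ hk _ hij2)
        have hmemP : ∀ m ≤ n, ∀ k ≤ n, ε m ∈ E(P) → (m = k ∨ m = cycPred n k) → c k ∈ V(P) :=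
          fun m hm k hk hmP hmk =>
            ((IsSubgraph.inc_congr hP hmP).2 ((h.inc_iff hm hk).2 hmk)).vertex_mem
        rcases h.edgeSet_of_isPathFromTo hn hP hij1 hij2 hp' with hE | hE
        · left
          have hin' := hin i j hij
          have hlt := h₀.1
          have hi₀ : i₀ = i := by
            have := hint' i₀ (by omega) (hmemP i₀ (by omega) i₀ (by omega)
              (hE ▸ ⟨i₀, ⟨by omega, by omega⟩, rfl⟩) (Or.inl rfl)) (hends _ _ h₀).1
            omega
          have hj₀ : j₀ = j := by
            have := hint' j₀ (by omega) (hmemP (j₀ - 1) (by omega) j₀ (by omega)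
              (hE ▸ ⟨j₀ - 1, ⟨by omega, by omega⟩, rfl⟩)
              (Or.inr (by rw [cycPred, if_neg (by omega)]))) (hends _ _ h₀).2
            omega
          exact eq_of_edgeSet_eq hP hle₀ (fun _ => hp.exists_inc) (fun _ => hp₀.exists_inc)
            (by rw [hE, hE₀, hi₀, hj₀])
        · right
          have hout' := hout i j hij
          have hlt := h₁.1
          have hle' := h₁.2.1
          have hi₁ : i₁ = i := by
            by_contra hii
            have := hint' i₁ (by omega) (hmemP i₁ (by omega) i₁ (by omega)
              (hE ▸ ⟨i₁, ⟨by simp only [Set.mem_Iic]; omega,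
                by simp only [Set.mem_Ico]; omega⟩, rfl⟩) (Or.inl rfl)) (hends _ _ h₁).1
            omega
          have hj₁ : j₁ = j := by
            by_contra hjj
            have := hint' j₁ (by omega) (hmemP j₁ (by omega) j₁ (by omega)
              (hE ▸ ⟨j₁, ⟨by simp only [Set.mem_Iic]; omega,
                by simp only [Set.mem_Ico]; omega⟩, rfl⟩) (Or.inl rfl)) (hends _ _ h₁).2
            omega
          exact eq_of_edgeSet_eq hP hle₁ (fun _ => hp.exists_inc) (fun _ => hp₁.exists_inc)
            (by rw [hE, hE₁, hi₁, hj₁])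
      · rintro (rfl | rfl)
        · refine ⟨c i₀, c j₀, hle₀, hp₀, (hends _ _ h₀).1, (hends _ _ h₀).2, ?_, h₀.2.2⟩
          rintro _ ⟨k, hk, rfl⟩ hkC
          obtain ⟨i, j, hij, hk'⟩ := hends' k (hk.2.trans h₀.2.1) hkC
          have := hin i j hij
          have h1 := hk.1
          have h2 := hk.2
          have : k = i₀ ∨ k = j₀ := by omega
          rcases this with rfl | rfl
          exacts [Or.inl rfl, Or.inr rfl]
        · obtain ⟨d, hd⟩ := h₁.2.2
          refine ⟨c j₁, c i₁, hle₁, hp₁, (hends _ _ h₁).2, (hends _ _ h₁).1, ?_, d, hd.symm⟩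
          rintro _ ⟨k, hk, rfl⟩ hkC
          have hle' := h₁.2.1
          have hlt := h₁.1
          simp only [Set.mem_union, Set.mem_Icc] at hk
          obtain ⟨i, j, hij, hk'⟩ := hends' k (by omega) hkC
          have := hout i j hij
          have := hij.1
          have : k = i₁ ∨ k = j₁ := by omega
          rcases this with rfl | rfl
          exacts [Or.inr rfl, Or.inl rfl]
    rw [hset, Set.ncard_pair]
    intro hh
    have h1 : ε i₀ ∈ E(P₀) := hE₀ ▸ ⟨i₀, ⟨le_rfl, h₀.1⟩, rfl⟩
    rw [hh, hE₁, h.edge_mem_image_iff Set.sdiff_subset (h₀.1.le.trans h₀.2.1)] at h1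
    have := hout _ _ h₀
    have := h₀.1
    exact h1.2 ⟨by omega, by omega⟩

end Nested

/-! ### The circle of a positive edge battery is layered -/

section Layered

variable {α β : Type*} {G B C D : Graph α β} {x y : α} {e f : β} {σ : β → ℤˣ} {n : ℕ} {c : ℕ → α}
  {ε : ℕ → β}

/-- A circle that does not contain all edges of a nonseparable graph has a bridge. -/
lemma EdgeNonsep.exists_isBridgeOf (hB : B.EdgeNonsep) (hle : C ≤ B) (hC : E(C).Nonempty)
    (hne : E(C) ≠ E(B)) : ∃ D, B.IsBridgeOf C D := by
  obtain ⟨x, -, -, ⟨⟨e, he, hex⟩, g, hg, y, hgx⟩, -⟩ := hB E(C) (IsSubgraph.edgeSet_mono hle) hC hne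
  obtain ⟨D, hD, -⟩ := Graph.exists_isBridgeOf hgx ((IsSubgraph.inc_congr hle he).2 hex).vertex_mem
    hg fun hxy => hB.not_isLoopAt hex.edge_mem hgx.edge_mem (fun h => hg (h ▸ he)) (hxy ▸ hgx)
  exact ⟨D, hD⟩

lemma CycEnum.inlCopy (h : C.CycEnum n c ε) (γ : Type*) :
    (C.inlCopy γ).CycEnum n c (fun i => Sum.inl (ε i)) where
  inj := h.inj
  link := h.link
  close := h.close
  surj := h.surj
  edge_inj i hi j hj hij := h.edge_inj i hi j hj (Sum.inl_injective hij)
  edge_surj := by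
    rintro (e | e) he
    · obtain ⟨x, y, hxy⟩ := exists_isLink_of_mem_edgeSet he
      obtain ⟨i, hi, rfl⟩ := h.edge_surj e (IsLink.edge_mem (G := C) hxy)
      exact ⟨i, hi, rfl⟩
    · obtain ⟨x, y, hxy⟩ := exists_isLink_of_mem_edgeSet he
      exact hxy.elim

lemma inlCopy_le_star : C.inlCopy (Graph α β) ≤ B.star C :=
  ⟨subset_rfl, by rintro (e | e) x y h; exacts [h, h.elim]⟩

lemma isChordWithEnds_star {d : β ⊕ Graph α β} :
    (B.star C).IsChordWithEnds (C.inlCopy (Graph α β)) d x y ↔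
      ∃ D, d = Sum.inr D ∧ B.IsBridgeOf C D ∧ x ≠ y ∧ C.attachments D = {x, y} := by
  constructor
  · rintro ⟨h1, h2, h3, h4, h5⟩
    rcases d with e | D
    · exact absurd (IsLink.edge_mem (G := C.inlCopy (Graph α β)) (e := Sum.inl e) (x := x) (y := y)
        h5) h1
    · exact ⟨D, rfl, h5⟩
  · rintro ⟨D, rfl, hD, hxy, hA⟩
    have hx : x ∈ C.attachments D := by rw [hA]; simp
    have hy : y ∈ C.attachments D := by rw [hA]; simp
    refine ⟨fun hc => ?_, hx.2, hy.2, hxy, hD, hxy, hA⟩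
    obtain ⟨s, t, hst⟩ := exists_isLink_of_mem_edgeSet hc
    exact hst.elim

lemma EnumBattery.isLayered (h : EnumBattery σ B C n c ε) (hn : 1 ≤ n) (hC : C.IsCircle)
    (hB : B.EdgeNonsep) (hiso : ∀ x ∈ V(B), ∃ e, B.Inc e x) (hne : E(C) ≠ E(B)) :
    B.IsLayered C := by
  have hcne : ∀ {i j : ℕ}, i < j → j ≤ n → c i ≠ c j := fun hij hj hh => by
    have := h.inj _ (by omega) _ hj hh
    omega
  refine ⟨⟨h.le, hC⟩, fun D hD => ?_, ?_⟩
  · obtain ⟨i, j, hij, hj, hA⟩ := h.exists_attachments hB hiso hD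
    rw [hA, Set.ncard_pair (hcne hij hj)]
  · refine (h.toCycEnum.inlCopy _).isTwoHandled hn inlCopy_le_star ?_ ?_
    · obtain ⟨D, hD⟩ := hB.exists_isBridgeOf h.le ⟨ε n, h.edge_mem le_rfl⟩ hne
      obtain ⟨i, j, hij, hj, hA⟩ := h.exists_attachments hB hiso hD
      exact ⟨i, j, hij, hj, Sum.inr D, isChordWithEnds_star.2 ⟨D, rfl, hD, hcne hij hj, hA⟩⟩
    · rintro i₁ j₁ i₂ j₂ ⟨h₁, hn₁, d₁, hd₁⟩ ⟨h₂, hn₂, d₂, hd₂⟩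
      obtain ⟨D₁, -, hD₁, -, hA₁⟩ := isChordWithEnds_star.1 hd₁
      obtain ⟨D₂, -, hD₂, -, hA₂⟩ := isChordWithEnds_star.1 hd₂
      exact h.bridges_nested hD₁ hD₂ h₁ hn₁ hA₁ h₂ hn₂ hA₂

lemma IsPosEdgeBattery.enumBattery (h : IsPosEdgeBattery σ B e C) (hc : C.CycEnum n c ε)
    (he : ε n = e) : EnumBattery σ B C n c ε :=
  ⟨hc, h.1.1.1, h.1.2.1, he ▸ h.2⟩

/-- In a nonseparable graph, the unique positive circle through an edge is layered, unless it
contains all edges. -/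
theorem IsPosEdgeBattery.isLayered (h : IsPosEdgeBattery σ B e C) (hV : V(B).Finite)
    (hE : E(B).Finite) (hB : B.EdgeNonsep) (hiso : ∀ x ∈ V(B), ∃ e, B.Inc e x)
    (hne : E(C) ≠ E(B)) : B.IsLayered C := by
  have hle := h.1.1.1
  obtain ⟨x, y, hxy⟩ := exists_isLink_of_mem_edgeSet h.1.2.2
  obtain ⟨g, hg, hgC⟩ := exists_notMem_of_ne (IsSubgraph.edgeSet_mono hle) hne
  have hxy' : x ≠ y := by
    rintro rfl
    exact hB.not_isLoopAt hg (hxy.mono hle).edge_mem (fun hh => hgC (hh ▸ h.1.2.2)) (hxy.mono hle)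
  obtain ⟨n, c, ε, hc, -, hn, h1⟩ := h.1.1.2.exists_cycEnum
    (hV.subset (IsSubgraph.vertexSet_mono hle)) (hE.subset (IsSubgraph.edgeSet_mono hle)) hxy hxy'
  exact (h.enumBattery hc hn).isLayered h1 h.1.1.2 hB hiso hne

end Layered

/-! ### Suppressing a vertex of degree two -/

section Suppress

variable {α β : Type*} {G B C C₁ C₂ : Graph α β} {D : Graph α (Option β)} {x y v a b : α}
  {e f e₁ e₂ : β} {σ : β → ℤˣ} {X : Set α} {F : Set β}

/-- The edges at `v` are the two links `e₁`, from `v` to `a`, and `e₂`, from `v` to `b`. -/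
structure LinksAt (B : Graph α β) (v a b : α) (e₁ e₂ : β) : Prop where
  ne : e₁ ≠ e₂
  inc : ∀ g, B.Inc g v ↔ g = e₁ ∨ g = e₂
  left : B.IsLink e₁ v a
  right : B.IsLink e₂ v b
  left_ne : a ≠ v
  right_ne : b ≠ v

lemma onlyLoopAt_or_linksAt (hE : E(B).Finite) (h : B.deg v = 2) :
    B.OnlyLoopAt v ∨ ∃ a b e₁ e₂, B.LinksAt v a b e₁ e₂ := by
  rcases (deg_eq_two_iff hE).1 h with h | ⟨e₁, e₂, hne, hinc, h₁, h₂⟩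
  · exact Or.inl h
  · right
    obtain ⟨a, ha⟩ := (hinc e₁).2 (Or.inl rfl)
    obtain ⟨b, hb⟩ := (hinc e₂).2 (Or.inr rfl)
    exact ⟨a, b, e₁, e₂, hne, hinc, ha, hb, fun hh => h₁ (hh ▸ ha), fun hh => h₂ (hh ▸ hb)⟩

namespace LinksAt

lemma incidenceSet_eq (h : B.LinksAt v a b e₁ e₂) : B.incidenceSet v = {e₁, e₂} := by
  ext g
  simp [h.inc]

lemma twoLinksAt (h : B.LinksAt v a b e₁ e₂) : B.TwoLinksAt v a b :=
  ⟨e₁, e₂, h.ne, h.incidenceSet_eq, h.left, h.right, h.left_ne, h.right_ne⟩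

lemma not_onlyLoopAt (h : B.LinksAt v a b e₁ e₂) : ¬ B.OnlyLoopAt v := by
  rintro ⟨e, he, -⟩
  rw [h.incidenceSet_eq] at he
  have h1 : e₁ ∈ ({e} : Set β) := he ▸ Or.inl rfl
  have h2 : e₂ ∈ ({e} : Set β) := he ▸ Or.inr rfl
  exact h.ne (h1.trans h2.symm)

lemma vertexSet_suppress (h : B.LinksAt v a b e₁ e₂) : V(B.suppress v) = V(B) \ {v} := by
  ext x
  change x ∈ V(B) ∧ (x ≠ v ∨ B.OnlyLoopAt v) ↔ _
  simp [h.not_onlyLoopAt]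

lemma isLink_none (h : B.LinksAt v a b e₁ e₂) : (B.suppress v).IsLink none a b :=
  Or.inl h.twoLinksAt

lemma edgeSet_suppress (h : B.LinksAt v a b e₁ e₂) :
    E(B.suppress v) = insert none (some '' (E(B) \ {e₁, e₂})) := by
  ext (_ | e)
  · simpa using h.isLink_none.edge_mem
  · simp only [Set.mem_insert_iff, reduceCtorEq, Set.mem_image, Option.some.injEq, exists_eq_right,
      Set.mem_sdiff, Set.mem_singleton_iff, false_or]
    constructor
    · intro he
      obtain ⟨x, y, hxy, hv⟩ := exists_isLink_of_mem_edgeSet he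
      exact ⟨hxy.edge_mem, fun hh => hv ((h.inc e).2 hh)⟩
    · rintro ⟨he, hv⟩
      obtain ⟨x, y, hxy⟩ := exists_isLink_of_mem_edgeSet he
      exact IsLink.edge_mem (G := B.suppress v) (x := x) (y := y)
        ⟨hxy, fun hh => hv ((h.inc e).1 hh)⟩

lemma finite_suppress (h : B.LinksAt v a b e₁ e₂) (hV : V(B).Finite) (hE : E(B).Finite) :
    V(B.suppress v).Finite ∧ E(B.suppress v).Finite := by
  rw [h.vertexSet_suppress, h.edgeSet_suppress]
  exact ⟨hV.subset Set.sdiff_subset, ((hE.subset Set.sdiff_subset).image _).insert _⟩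

lemma of_isCircleOf (h : B.LinksAt v a b e₁ e₂) (hE : E(B).Finite) (hC : C.IsCircleOf B)
    (hv : v ∈ V(C)) : C.LinksAt v a b e₁ e₂ := by
  rcases onlyLoopAt_or_linksAt (hE.subset (IsSubgraph.edgeSet_mono hC.1)) (hC.2.2 v hv) with
    ⟨e, he, hl⟩ | ⟨a', b', f₁, f₂, h'⟩
  · have hl' := hl.mono hC.1
    rcases (h.inc e).1 hl'.inc with rfl | rfl
    · exact absurd (hl'.eq_of_inc h.left.inc_right).symm h.left_ne
    · exact absurd (hl'.eq_of_inc h.right.inc_right).symm h.right_ne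
  · have h1 := (h.inc f₁).1 (h'.left.mono hC.1).inc_left
    have h2 := (h.inc f₂).1 (h'.right.mono hC.1).inc_left
    have hmem : e₁ ∈ E(C) ∧ e₂ ∈ E(C) := by
      have m1 := h'.left.edge_mem
      have m2 := h'.right.edge_mem
      rcases h1 with rfl | rfl <;> rcases h2 with rfl | rfl
      exacts [absurd rfl h'.ne, ⟨m1, m2⟩, ⟨m2, m1⟩, absurd rfl h'.ne]
    refine ⟨h.ne, fun g => ⟨fun hg => (h.inc g).1 (hg.mono hC.1), ?_⟩,
      (IsSubgraph.isLink_iff hC.1 hmem.1).2 h.left, (IsSubgraph.isLink_iff hC.1 hmem.2).2 h.right,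
      h.left_ne, h.right_ne⟩
    rintro (rfl | rfl)
    · exact (IsSubgraph.inc_congr hC.1 hmem.1).2 h.left.inc_left
    · exact (IsSubgraph.inc_congr hC.1 hmem.2).2 h.right.inc_left

lemma suppress_le (h : B.LinksAt v a b e₁ e₂) (hC : C ≤ B) (h' : C.LinksAt v a b e₁ e₂) :
    C.suppress v ≤ B.suppress v := by
  refine ⟨?_, ?_⟩
  · rw [h.vertexSet_suppress, h'.vertexSet_suppress]
    exact Set.sdiff_subset_sdiff_left (IsSubgraph.vertexSet_mono hC)
  · rintro (_ | e) x y hxy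
    · rcases hxy with hxy | ⟨-, -, hl⟩
      · have hl : (C.suppress v).IsLink none x y := Or.inl hxy
        rcases hxy.eq_or_eq h'.twoLinksAt with rfl | rfl
        · have hy := hl.right_unique h'.isLink_none
          rw [hy]
          exact h.isLink_none
        · have hy := hl.right_unique h'.isLink_none.symm
          rw [hy]
          exact h.isLink_none.symm
      · exact absurd hl h'.not_onlyLoopAt
    · refine ⟨hxy.1.mono hC, fun hv => hxy.2 ?_⟩
      exact (IsSubgraph.inc_congr hC hxy.1.edge_mem).2 hv

lemma pathOn_suppress (hP : B.PathOn x y X F) (hv : v ∉ X) :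
    (B.suppress v).PathOn x y X (some '' F) := by
  induction hP with
  | nil hx =>
    rw [Set.image_empty]
    exact .nil ⟨hx, Or.inl fun hh => hv hh.symm⟩
  | @cons x y z e X F he h hx ih =>
    simp only [Set.mem_insert_iff, not_or] at hv
    rw [Set.image_insert_eq]
    refine .cons ⟨he, fun hh => ?_⟩ (ih hv.2) hx
    rcases hh.eq_or_eq_of_isLink he with rfl | rfl
    exacts [hv.1 rfl, hv.2 h.left_mem]

lemma pathOn_of_suppress (h : B.LinksAt v a b e₁ e₂) {F : Set (Option β)}
    (hP : (B.suppress v).PathOn x y X F) (hF : none ∉ F) :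
    ∃ F', F = some '' F' ∧ B.PathOn x y X F' := by
  induction hP with
  | nil hx =>
    rw [h.vertexSet_suppress] at hx
    exact ⟨∅, by simp, .nil hx.1⟩
  | @cons x y z e X F he hP hx ih =>
    simp only [Set.mem_insert_iff, not_or] at hF
    obtain ⟨F', rfl, hP'⟩ := ih hF.2
    obtain ⟨e', rfl⟩ := Option.ne_none_iff_exists'.1 (Ne.symm hF.1)
    exact ⟨insert e' F', by rw [Set.image_insert_eq], .cons he.1 hP' hx⟩

/-- A circle through `v` consists of the two edges at `v` and a path that avoids `v`. -/
lemma exists_pathOn (h : B.LinksAt v a b e₁ e₂) (hV : V(B).Finite) (hE : E(B).Finite)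
    (hC : C.IsCircleOf B) (hv : v ∈ V(C)) :
    ∃ X F, C.PathOn b a X F ∧ v ∉ X ∧ V(C) = insert v X ∧ E(C) = insert e₁ (insert e₂ F) ∧
      e₁ ∉ insert e₂ F ∧ e₂ ∉ F := by
  have h' := h.of_isCircleOf hE hC hv
  obtain ⟨F, hP, he₁, hEC⟩ := hC.2.exists_pathOn (hV.subset (IsSubgraph.vertexSet_mono hC.1))
    (hE.subset (IsSubgraph.edgeSet_mono hC.1)) h'.left
  generalize hX : V(C) = X at hP
  cases hP with
  | nil => exact absurd rfl h.left_ne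
  | @cons _ w _ g X F hg hP hvX =>
    have hge : g = e₂ := ((h'.inc g).1 hg.inc_left).resolve_left fun hh => he₁ (by simp [hh])
    subst hge
    obtain rfl := hg.right_unique h'.right
    exact ⟨X, F, hP, hvX, rfl, hEC, he₁, fun hh => hvX (hP.mem_of_inc hh hg.inc_left)⟩

lemma sdiff_pair {F : Set β} (h₁ : e₁ ∉ insert e₂ F) (h₂ : e₂ ∉ F) :
    insert e₁ (insert e₂ F) \ {e₁, e₂} = F := by
  ext g
  simp only [Set.mem_sdiff, Set.mem_insert_iff, Set.mem_singleton_iff]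
  constructor
  · tauto
  · intro hg
    refine ⟨Or.inr (Or.inr hg), ?_⟩
    rintro (rfl | rfl)
    exacts [h₁ (Or.inr hg), h₂ hg]

lemma sgn_suppress (h : B.LinksAt v a b e₁ e₂) (hF : F.Finite)
    (h₁ : e₁ ∉ insert e₂ F) (h₂ : e₂ ∉ F) :
    sgn (suppressSign σ B v) (insert none (some '' F)) = sgn σ (insert e₁ (insert e₂ F)) := by
  have h0 : suppressSign σ B v none = σ e₁ * σ e₂ := by
    change ∏ᶠ e ∈ B.incidenceSet v, σ e = _
    rw [h.incidenceSet_eq, finprod_mem_pair h.ne]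
  have h3 : sgn (suppressSign σ B v) (some '' F) = sgn σ F := by
    rw [sgn, finprod_mem_image (Option.some_injective β).injOn]
    rfl
  rw [sgn_insert (hF.image _) (by simp), sgn_insert (hF.insert _) h₁, sgn_insert hF h₂, h0, h3,
    mul_assoc]

/-- A circle through `v` becomes a circle through the new edge, with the same sign. -/
lemma isCircleOf_suppress (h : B.LinksAt v a b e₁ e₂) (hV : V(B).Finite) (hE : E(B).Finite)
    (hC : C.IsCircleOf B) (hv : v ∈ V(C)) :
    (C.suppress v).IsCircleOf (B.suppress v) ∧ none ∈ E(C.suppress v) ∧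
      circleSign (suppressSign σ B v) (C.suppress v) = circleSign σ C := by
  have h' := h.of_isCircleOf hE hC hv
  obtain ⟨X, F, hP, hvX, hVC, hEC, h₁, h₂⟩ := h.exists_pathOn hV hE hC hv
  obtain ⟨D, hD, hDV, hDE⟩ := (pathOn_suppress (hP.mono hC.1) hvX).exists_isCircleOf
    h.isLink_none.symm (by simp)
  have hES : E(C.suppress v) = insert none (some '' F) := by
    rw [h'.edgeSet_suppress, hEC, sdiff_pair h₁ h₂]
  have hDC : D = C.suppress v := by
    refine eq_of_le_of_le hD.1 (h.suppress_le hC.1 h') ?_ (by rw [hDE, hES])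
    rw [hDV, h'.vertexSet_suppress, hVC, Set.insert_sdiff_of_mem _ (Set.mem_singleton v),
      Set.sdiff_singleton_eq_self hvX]
  refine ⟨hDC ▸ hD, by rw [hES]; simp, ?_⟩
  rw [circleSign_eq_sgn, circleSign_eq_sgn, hES, hEC, h.sgn_suppress hP.finite_edges h₁ h₂]

/-- Every circle through the new edge comes from a circle through `v`. -/
lemma exists_isCircleOf (h : B.LinksAt v a b e₁ e₂) (hV : V(B).Finite) (hE : E(B).Finite)
    (hD : D.IsCircleOf (B.suppress v)) (hn : none ∈ E(D)) :
    ∃ C, C.IsCircleOf B ∧ v ∈ V(C) ∧ C.suppress v = D := by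
  obtain ⟨fV, fE⟩ := h.finite_suppress hV hE
  obtain ⟨F, hP, hnF, hEC⟩ := hD.2.exists_pathOn (fV.subset (IsSubgraph.vertexSet_mono hD.1))
    (fE.subset (IsSubgraph.edgeSet_mono hD.1))
    ((IsSubgraph.isLink_iff hD.1 hn).2 h.isLink_none.symm)
  obtain ⟨F', rfl, hP'⟩ := h.pathOn_of_suppress (hP.mono hD.1) hnF
  have hvX : v ∉ V(D) := fun hv => by
    have := IsSubgraph.vertexSet_mono hD.1 hv
    rw [h.vertexSet_suppress] at this
    exact this.2 rfl
  have h₂ : e₂ ∉ F' := fun hh => hvX (hP'.mem_of_inc hh h.right.inc_left)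
  have h₁ : e₁ ∉ insert e₂ F' := by
    rintro (hh | hh)
    exacts [h.ne hh, hvX (hP'.mem_of_inc hh h.left.inc_left)]
  obtain ⟨C, hC, hCV, hCE⟩ := (PathOn.cons h.right hP' hvX).exists_isCircleOf h.left h₁
  have hvC : v ∈ V(C) := by simp [hCV]
  have h' := h.of_isCircleOf hE hC hvC
  refine ⟨C, hC, hvC, eq_of_le_of_le (h.suppress_le hC.1 h') hD.1 ?_ ?_⟩
  · rw [h'.vertexSet_suppress, hCV, Set.insert_sdiff_of_mem _ (Set.mem_singleton v),
      Set.sdiff_singleton_eq_self hvX]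
  · rw [h'.edgeSet_suppress, hCE, sdiff_pair h₁ h₂, hEC]

/-- Different circles through `v` do not become equal. -/
lemma suppress_injective (h : B.LinksAt v a b e₁ e₂) (hE : E(B).Finite)
    (hC₁ : C₁.IsCircleOf B) (hC₂ : C₂.IsCircleOf B) (hv₁ : v ∈ V(C₁)) (hv₂ : v ∈ V(C₂))
    (hCC : C₁.suppress v = C₂.suppress v) : C₁ = C₂ := by
  have h₁ := h.of_isCircleOf hE hC₁ hv₁
  have h₂ := h.of_isCircleOf hE hC₂ hv₂
  have key : ∀ {C : Graph α β}, C.LinksAt v a b e₁ e₂ → v ∈ V(C) →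
      V(C) = insert v V(C.suppress v) ∧ E(C) = {e₁, e₂} ∪ some ⁻¹' E(C.suppress v) := by
    intro C h hv
    rw [h.vertexSet_suppress, h.edgeSet_suppress]
    constructor
    · rw [Set.insert_sdiff_singleton, Set.insert_eq_of_mem hv]
    · ext g
      simp only [Set.mem_union, Set.mem_insert_iff, Set.mem_singleton_iff, Set.mem_preimage,
        reduceCtorEq, Set.mem_image, Option.some.injEq, exists_eq_right, Set.mem_sdiff, false_or]
      constructor
      · tauto
      · rintro ((rfl | rfl) | hg)
        exacts [h.left.edge_mem, h.right.edge_mem, hg.1]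
  exact eq_of_le_of_le hC₁.1 hC₂.1 (by rw [(key h₁ hv₁).1, (key h₂ hv₂).1, hCC])
    (by rw [(key h₁ hv₁).2, (key h₂ hv₂).2, hCC])

/-- An edge at a vertex `x ≠ v` remains at `x`, where `e₁` and `e₂` are replaced by the new edge. -/
lemma exists_inc_suppress (h : B.LinksAt v a b e₁ e₂) (hf : B.Inc f x) (hxv : x ≠ v) :
    ∃ g, (B.suppress v).Inc g x ∧ (f = e₁ ∨ f = e₂ → g = none) ∧
      (¬ (f = e₁ ∨ f = e₂) → g = some f) := by
  by_cases hfv : f = e₁ ∨ f = e₂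
  · refine ⟨none, ?_, fun _ => rfl, fun hh => absurd hfv hh⟩
    rcases hfv with rfl | rfl
    · rw [hf.eq_of_isLink_of_ne_left h.left hxv]
      exact h.isLink_none.inc_left
    · rw [hf.eq_of_isLink_of_ne_left h.right hxv]
      exact h.isLink_none.inc_right
  · obtain ⟨y, hy⟩ := hf
    exact ⟨some f, ⟨y, hy, fun hh => hfv ((h.inc f).1 hh)⟩, fun hh => absurd hh hfv, fun _ => rfl⟩

/-- Nonseparability is preserved: the two edges at `v` are put into the class of the new edge, and
then `v` is incident with edges of one class only. -/
lemma edgeNonsep_suppress (h : B.LinksAt v a b e₁ e₂) (hB : B.EdgeNonsep) :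
    (B.suppress v).EdgeNonsep := by
  rintro S hS ⟨s, hs⟩ hne
  obtain ⟨t, ht, htS⟩ := exists_notMem_of_ne hS hne
  -- the edge of `B ↓ v` that takes the place of an edge of `B`
  classical
  set φ : β → Option β := fun f => if f = e₁ ∨ f = e₂ then none else some f with hφ
  have hsurj : ∀ r ∈ E(B.suppress v), ∃ f ∈ E(B), φ f = r := by
    intro r hr
    rw [h.edgeSet_suppress] at hr
    rcases hr with rfl | ⟨f, hf, rfl⟩
    · exact ⟨e₁, h.left.edge_mem, by simp [hφ]⟩
    · exact ⟨f, hf.1, if_neg hf.2⟩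
  obtain ⟨s', hs', rfl⟩ := hsurj s (hS hs)
  obtain ⟨t', ht', rfl⟩ := hsurj t ht
  have hsh : ∀ z, B.IsShared {f ∈ E(B) | φ f ∈ S} z → (B.suppress v).IsShared S z := by
    rintro z ⟨⟨f, hf, hfz⟩, g, hg, hgz⟩
    have hg' : φ g ∉ S := fun hh => hg ⟨hgz.edge_mem, hh⟩
    have hzv : z ≠ v := by
      rintro rfl
      have h1 : φ f = none := if_pos ((h.inc f).1 hfz)
      have h2 : φ g = none := if_pos ((h.inc g).1 hgz)
      exact hg' (h2 ▸ h1 ▸ hf.2)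
    have aux : ∀ f, B.Inc f z → (B.suppress v).Inc (φ f) z := by
      intro f hf
      obtain ⟨r, hr, h1, h2⟩ := h.exists_inc_suppress hf hzv
      by_cases hh : f = e₁ ∨ f = e₂
      · rwa [show φ f = r by rw [h1 hh]; exact if_pos hh]
      · rwa [show φ f = r by rw [h2 hh]; exact if_neg hh]
    exact ⟨⟨φ f, hf.2, aux f hfz⟩, φ g, hg', aux g hgz⟩
  obtain ⟨x, y, hxy, hx, hy⟩ := hB {f ∈ E(B) | φ f ∈ S} (fun f hf => hf.1) ⟨s', hs', hs⟩
    fun hh => htS (hh.symm.subset ht').2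
  exact ⟨x, y, hxy, hsh x hx, hsh y hy⟩

lemma exists_inc_of_mem_suppress (h : B.LinksAt v a b e₁ e₂) (hiso : ∀ x ∈ V(B), ∃ e, B.Inc e x) :
    ∀ x ∈ V(B.suppress v), ∃ e, (B.suppress v).Inc e x := by
  intro x hx
  rw [h.vertexSet_suppress] at hx
  obtain ⟨f, hf⟩ := hiso x hx.1
  obtain ⟨g, hg, -⟩ := h.exists_inc_suppress hf hx.2
  exact ⟨g, hg⟩

end LinksAt

end Suppress

/-! ### Potentials and balancing edges -/

section Balancing

variable {α β : Type*} {G H B C D Q : Graph α β} {x y z v a b : α} {e f g : β}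
  {σ : β → ℤˣ} {X Y : Set α} {F K : Set β} {s t : ℤˣ} {ζ : α → ℤˣ}

/-- There is a walk of sign `s` from `x` to `y`. -/
inductive WalkSign (σ : β → ℤˣ) (G : Graph α β) : α → α → ℤˣ → Prop
  | nil (x : α) : WalkSign σ G x x 1
  | cons {x y z : α} {e : β} {s : ℤˣ} (he : G.IsLink e x y) (h : WalkSign σ G y z s) :
      WalkSign σ G x z (σ e * s)

namespace WalkSign

lemma trans (h : WalkSign σ G x y s) (h' : WalkSign σ G y z t) : WalkSign σ G x z (s * t) := by
  induction h with
  | nil => simpa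
  | cons he _ ih => rw [mul_assoc]; exact .cons he (ih h')

lemma single (he : G.IsLink e x y) : WalkSign σ G x y (σ e) := by
  simpa using WalkSign.cons (σ := σ) he (.nil y)

lemma symm (h : WalkSign σ G x y s) : WalkSign σ G y x s := by
  induction h with
  | nil => exact .nil _
  | cons he _ ih => rw [mul_comm]; exact ih.trans (single he.symm)

lemma of_eqvGen (h : Relation.EqvGen G.Adj x y) : ∃ s, WalkSign σ G x y s := by
  induction h with
  | rel x y hxy => obtain ⟨e, he⟩ := hxy; exact ⟨_, single he⟩
  | refl x => exact ⟨1, .nil x⟩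
  | symm x y _ ih => obtain ⟨s, hs⟩ := ih; exact ⟨s, hs.symm⟩
  | trans x y z _ _ ih ih' =>
    obtain ⟨s, hs⟩ := ih
    obtain ⟨t, ht⟩ := ih'
    exact ⟨_, hs.trans ht⟩

/-- In a balanced graph, cutting the closed parts out of a walk does not change its sign. -/
lemma exists_pathOn (hG : IsBalanced σ G) (h : WalkSign σ G x y s) (hx : x ∈ V(G)) :
    ∃ X F, G.PathOn x y X F ∧ sgn σ F = s := by
  induction h with
  | nil x => exact ⟨_, _, .nil hx, sgn_empty⟩
  | @cons x y z e s he h ih =>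
    obtain ⟨X, F, hP, rfl⟩ := ih he.right_mem
    by_cases hxX : x ∈ X
    · obtain ⟨X₁, F₁, X₂, F₂, h₁, h₂, -, -, rfl, hd⟩ := hP.split hxX
      refine ⟨X₂, F₂, h₂, ?_⟩
      have key : σ e * sgn σ F₁ = 1 := by
        by_cases heF : e ∈ F₁
        · cases h₁ with
          | nil => simp at heF
          | @cons _ w _ g X₁ F₁ hg h₁ hy =>
            have heg : e = g := heF.resolve_right fun hh => hy (h₁.mem_of_inc hh he.inc_right)
            subst heg
            obtain rfl := he.symm.right_unique hg
            obtain ⟨-, rfl⟩ := h₁.eq_of_refl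
            rw [insert_empty_eq, sgn_singleton, Int.units_mul_self]
        · obtain ⟨C, hC, -, hE⟩ := h₁.exists_isCircleOf he.symm heF
          rw [← sgn_insert h₁.finite_edges heF, ← hE]
          exact hG C hC
      rw [sgn_union h₁.finite_edges h₂.finite_edges hd, ← mul_assoc, key, one_mul]
    · have heF : e ∉ F := fun hh => hxX (hP.mem_of_inc hh he.inc_left)
      exact ⟨_, _, .cons he hP hxX, sgn_insert hP.finite_edges heF⟩

lemma eq_one (hG : IsBalanced σ G) (h : WalkSign σ G x x s) (hx : x ∈ V(G)) : s = 1 := by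
  obtain ⟨X, F, hP, rfl⟩ := h.exists_pathOn hG hx
  rw [hP.eq_of_refl.2, sgn_empty]

end WalkSign

/-- A balanced graph can be switched so that all edges are positive. -/
lemma IsBalanced.exists_potential (hG : IsBalanced σ G) :
    ∃ ζ : α → ℤˣ, ∀ e x y, G.IsLink e x y → ζ x * σ e * ζ y = 1 := by
  -- a root in each component; then `ζ x` is the sign of a walk from the root to `x`
  have hroot : ∀ x, ∃ s, WalkSign σ G (Quot.out (Quot.mk G.Adj x)) x s := fun x =>
    WalkSign.of_eqvGen (Quot.eqvGen_exact (Quot.out_eq (Quot.mk G.Adj x)))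
  choose ζ hζ using hroot
  refine ⟨ζ, fun e x y he => ?_⟩
  have hxy : Quot.mk G.Adj x = Quot.mk G.Adj y := Quot.sound he.adj
  have h := ((hζ x).symm.trans (hxy ▸ hζ y)).trans (.single he.symm)
  have := h.eq_one hG he.left_mem
  rw [← this]
  rw [mul_right_comm]

lemma PathOn.sgn_eq (h : G.PathOn x y X F)
    (hζ : ∀ f ∈ F, ∀ x y, G.IsLink f x y → ζ x * σ f * ζ y = 1) : sgn σ F = ζ x * ζ y := by
  induction h with
  | nil => rw [sgn_empty, Int.units_mul_self]
  | @cons x y z e X F he h hx ih =>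
    have heF : e ∉ F := fun hh => hx (h.mem_of_inc hh he.inc_left)
    rw [sgn_insert h.finite_edges heF, ih fun f hf => hζ f (Or.inr hf)]
    have key : ∀ p q r s : ℤˣ, p * s * q = 1 → s * (q * r) = p * r := by decide
    exact key _ _ _ _ (hζ e (by simp) x y he)

/-- The circles through a balancing edge are negative. -/
lemma IsBalancingEdge.circleSign_eq (h : IsBalancingEdge σ G e) (hV : V(G).Finite)
    (hE : E(G).Finite) (hC : C.IsCircleOf G) (he : e ∈ E(C)) : circleSign σ C = -1 := by
  obtain ⟨-, ζ, hζ⟩ := h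
  obtain ⟨x, y, hxy⟩ := exists_isLink_of_mem_edgeSet he
  obtain ⟨F, hP, heF, hEC⟩ := hC.2.exists_pathOn (hV.subset (IsSubgraph.vertexSet_mono hC.1))
    (hE.subset (IsSubgraph.edgeSet_mono hC.1)) hxy
  have h1 := (hζ e x y (hxy.mono hC.1)).2 rfl
  have h2 := hP.sgn_eq (σ := σ) (ζ := ζ) fun f hf s t hst =>
    (Int.units_eq_one_or _).resolve_right fun hh =>
      heF ((hζ f s t (hst.mono hC.1)).1 hh ▸ hf)
  rw [circleSign_eq_sgn, hEC, sgn_insert hP.finite_edges heF, h2, ← h1]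
  rw [← mul_assoc, mul_comm (σ e)]

/-- An ear together with an arc of the circle between its ends is a circle. -/
lemma IsEar.exists_isCircleOf (h : G.IsEar C x y X F) (hle : C ≤ G) (hA : C.PathOn x y Y K) :
    ∃ D, D.IsCircleOf G ∧ V(D) = X ∪ Y ∧ E(D) = F ∪ K ∧
      circleSign σ D = sgn σ F * sgn σ K := by
  have hd : Disjoint F K := h.disj.mono_right hA.subset_edgeSet
  obtain ⟨D, hD, hV, hE⟩ := h.pathOn.exists_isCircleOf_union (hA.mono hle) h.ne
    (fun t ht => h.inter ⟨ht.1, hA.subset_vertexSet ht.2⟩) hd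
  exact ⟨D, hD, hV, hE, by
    rw [circleSign_eq_sgn, hE, sgn_union h.pathOn.finite_edges hA.finite_edges hd]⟩

/-- If all circles through an edge `e` of a nonseparable graph are negative, then `e` is a balancing
edge. A negative circle `Q` that avoids `e` cannot exist: there is a circle through `e` and an
edge of `Q`, and it can be led along either of two arcs of `Q`, which have different signs. -/
theorem EdgeNonsep.isBalancingEdge (h : G.EdgeNonsep) (hV : V(G).Finite) (hE : E(G).Finite)
    (hC : C.IsCircleOf G) (heC : e ∈ E(C))
    (hneg : ∀ C, C.IsCircleOf G → e ∈ E(C) → circleSign σ C ≠ 1) : IsBalancingEdge σ G e := by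
  have fV : ∀ {D : Graph α β}, D ≤ G → V(D).Finite := fun h =>
    hV.subset (IsSubgraph.vertexSet_mono h)
  have fE : ∀ {D : Graph α β}, D ≤ G → E(D).Finite := fun h =>
    hE.subset (IsSubgraph.edgeSet_mono h)
  have he := IsSubgraph.edgeSet_mono hC.1 heC
  have hbal : IsBalanced σ (G.deleteEdges {e}) := by
    intro Q hQ
    have hQG : Q.IsCircleOf G := hQ.mono G.deleteEdges_le
    have heQ : e ∉ E(Q) := fun hh => by
      have := IsSubgraph.edgeSet_mono hQ.1 hh
      simp at this
    by_contra hQs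
    obtain ⟨p, hp⟩ := hQ.2.1.1
    obtain ⟨g, q, hg⟩ := hQ.2.exists_inc hp
    have hge : e ≠ g := fun hh => heQ (hh ▸ hg.edge_mem)
    have hgG := hg.mono hQG.1
    obtain ⟨D, hD, heD, hgD⟩ := h.exists_isCircleOf hV hE he hgG.edge_mem hge
    obtain ⟨x, y, hxy⟩ := exists_isLink_of_mem_edgeSet heD
    obtain ⟨F, hP, heF, -⟩ := hD.2.exists_pathOn (fV hD.1) (fE hD.1) hxy
    have hl := (IsSubgraph.isLink_iff hD.1 hgD).2 hgG
    have hpq : p ≠ q := by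
      rintro rfl
      exact h.not_isLoopAt he hgG.edge_mem hge hgG
    obtain ⟨a, haT, b, hbT, hab, X₁, F₁, X₂, F₂, h₁, h₂, hT₁, hT₂, hd, hF₁, hF₂⟩ :=
      hP.exists_first_last (T := V(Q)) ⟨hl.left_mem, hg.left_mem⟩ ⟨hl.right_mem, hg.right_mem⟩ hpq
    have close : ∀ Y K, Q.PathOn a b Y K → σ e * (sgn σ F₁ * sgn σ K * sgn σ F₂) ≠ 1 := by
      intro Y K hYK
      have d1 : X₁ ∩ Y ⊆ {a} := fun t ht => hT₁ ▸ ⟨ht.1, hYK.subset_vertexSet ht.2⟩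
      have d2 : (X₁ ∪ Y) ∩ X₂ ⊆ {b} := by
        rintro t ⟨ht | ht, ht2⟩
        · exact absurd ht2 (Set.disjoint_left.1 hd ht)
        · exact hT₂ ▸ ⟨ht2, hYK.subset_vertexSet ht⟩
      have p1 := (h₁.mono hD.1).append (hYK.mono hQG.1) d1
      have p2 := p1.append (h₂.mono hD.1) d2
      have heP : e ∉ F₁ ∪ K ∪ F₂ := by
        rintro ((h | h) | h)
        exacts [heF (hF₁ h), heQ (hYK.subset_edgeSet h), heF (hF₂ h)]
      obtain ⟨D', hD', -, hDE⟩ := p2.exists_isCircleOf (hxy.mono hD.1) heP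
      have := hneg D' hD' (by simp [hDE])
      rwa [circleSign_eq_sgn, hDE, sgn_insert p2.finite_edges heP,
        sgn_append p1 (h₂.mono hD.1) d2, sgn_append (h₁.mono hD.1) (hYK.mono hQG.1) d1] at this
    obtain ⟨Y₁, K₁, Y₂, K₂, hK₁, hK₂, -, -, hKE, hKd⟩ :=
      hQ.2.exists_arcs (fV hQG.1) (fE hQG.1) haT hbT hab
    rw [circleSign_eq_sgn, ← hKE, sgn_union hK₁.finite_edges hK₂.finite_edges hKd] at hQs
    have key : ∀ p q r s t : ℤˣ, p * (q * r * t) ≠ 1 → p * (q * s * t) ≠ 1 → r * s ≠ 1 →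
        False := by decide
    exact key _ _ _ _ _ (close _ _ hK₁) (close _ _ hK₂) hQs
  obtain ⟨ζ, hζ⟩ := hbal.exists_potential
  have hζ' : ∀ f x y, G.IsLink f x y → f ≠ e → ζ x * σ f * ζ y = 1 := by
    intro f x y hf hfe
    refine hζ f x y ?_
    have : f ∈ E(G.deleteEdges {e}) := by simp [hf.edge_mem, hfe]
    exact (IsSubgraph.isLink_iff G.deleteEdges_le this).2 hf
  refine ⟨he, ζ, fun f x y hf => ⟨fun hh => ?_, ?_⟩⟩
  · by_contra hfe
    rw [hζ' f x y hf hfe] at hh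
    exact absurd hh (by decide)
  · rintro rfl
    obtain ⟨F, hP, heF, hEC⟩ := hC.2.exists_pathOn (fV hC.1) (fE hC.1)
      ((IsSubgraph.isLink_iff hC.1 heC).2 hf)
    have h2 := hP.sgn_eq (σ := σ) (ζ := ζ) fun g hg s t hst =>
      hζ' g s t (hst.mono hC.1) fun hh => heF (hh ▸ hg)
    have h3 := hneg C hC heC
    rw [circleSign_eq_sgn, hEC, sgn_insert hP.finite_edges heF, h2] at h3
    have key : ∀ p q r : ℤˣ, p * (q * r) ≠ 1 → q * p * r = -1 := by decide
    exact key _ _ _ h3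

end Balancing

/-! ### Blocks that consist of a loop -/

section Loop

variable {α β : Type*} {B C : Graph α β} {v : α} {e : β} {σ : β → ℤˣ}

lemma suppressSign_none_of_onlyLoopAt (he : B.incidenceSet v = {e}) :
    suppressSign σ B v none = σ e := by
  change ∏ᶠ e ∈ B.incidenceSet v, σ e = _
  rw [he, finprod_mem_singleton]

lemma EdgeNonsep.onlyLoopAt (h : B.EdgeNonsep) (he : B.IsLoopAt e v) :
    B.incidenceSet v = {e} ∧ B.OnlyLoopAt v := by
  have : B.incidenceSet v = {e} := by
    refine Set.Subset.antisymm ?_ (by simpa using he.inc)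
    exact (B.incidenceSet_subset_edgeSet v).trans (h.edgeSet_eq_of_isLoopAt he).subset
  exact ⟨this, e, this, he⟩

lemma IsCircle.edgeSet_nonempty (hC : C.IsCircle) : E(C).Nonempty := by
  obtain ⟨x, hx⟩ := hC.1.1
  obtain ⟨g, hg⟩ := hC.exists_inc hx
  exact ⟨g, hg.edge_mem⟩

lemma EdgeNonsep.edgeSet_eq_of_loop (h : B.EdgeNonsep) (he : B.IsLoopAt e v)
    (hC : C.IsCircleOf B) : E(C) = {e} := by
  have := IsSubgraph.edgeSet_mono hC.1
  rw [h.edgeSet_eq_of_isLoopAt he] at this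
  exact (Set.subset_singleton_iff_eq.1 this).resolve_left hC.2.edgeSet_nonempty.ne_empty

lemma EdgeNonsep.circleSign_of_loop (h : B.EdgeNonsep) (he : B.IsLoopAt e v)
    (hC : C.IsCircleOf B) : circleSign σ C = σ e := by
  rw [circleSign_eq_sgn, h.edgeSet_eq_of_loop he hC, sgn_singleton]

end Loop

/-! ### Blocks without a positive circle through a vertex -/

section NoPositive

variable {α β : Type*} {B C C₀ : Graph α β} {x v : α} {e : β} {σ : β → ℤˣ}

lemma IsCircle.exists_ne (hC : C.IsCircle) (hE : E(C).Finite) (he : ¬ C.IsLoopAt e x)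
    (hx : C.Inc e x) : ∃ f ∈ E(C), f ≠ e := by
  obtain ⟨y, hy⟩ := hx
  obtain ⟨f, hf, -, z, -, hz⟩ := hC.exists_other hE hy (by rintro rfl; exact he hy)
  exact ⟨f, hz.edge_mem, hf⟩

/-- A graph with a circle and a link has at least two edges. -/
lemma IsCircleOf.exists_ne (hC : C.IsCircleOf B) (hE : E(B).Finite) (hv : B.Inc e v)
    (he : ¬ B.IsLoopAt e v) : ∃ f ∈ E(B), f ≠ e := by
  obtain ⟨g, hg⟩ := hC.2.edgeSet_nonempty
  by_cases hge : g = e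
  · subst hge
    obtain ⟨f, hf, hfe⟩ := hC.2.exists_ne (hE.subset (IsSubgraph.edgeSet_mono hC.1))
      (fun hl => he (hl.mono hC.1)) ((IsSubgraph.inc_congr hC.1 hg).2 hv)
    exact ⟨f, IsSubgraph.edgeSet_mono hC.1 hf, hfe⟩
  · exact ⟨g, IsSubgraph.edgeSet_mono hC.1 hg, hge⟩

/-- If no positive circle of a block contains `v`, then `v` has degree two, since a third edge would
give a theta graph all of whose circles contain `v`; and the new edge of `B ↓ v` is a balancing
edge, since it lies on negative circles only. -/
theorem EdgeNonsep.hasOnlyNegForm (h : B.EdgeNonsep) (hc : B.IsConn) (hV : V(B).Finite)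
    (hE : E(B).Finite) (hC₀ : C₀.IsCircleOf B) (hv : v ∈ V(B))
    (hneg : ∀ C, C.IsCircleOf B → v ∈ V(C) → circleSign σ C ≠ 1) : HasOnlyNegForm σ B v := by
  have fV : ∀ {D : Graph α β}, D ≤ B → V(D).Finite := fun h =>
    hV.subset (IsSubgraph.vertexSet_mono h)
  have fE : ∀ {D : Graph α β}, D ≤ B → E(D).Finite := fun h =>
    hE.subset (IsSubgraph.edgeSet_mono h)
  obtain ⟨g, hg⟩ := hC₀.2.edgeSet_nonempty
  obtain ⟨e₁, he₁⟩ := hc.exists_inc (IsSubgraph.edgeSet_mono hC₀.1 hg) hv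
  by_cases hl : B.IsLoopAt e₁ v
  · obtain ⟨hinc, hol⟩ := h.onlyLoopAt hl
    obtain ⟨C, hC, hCV, -⟩ := (PathOn.nil hv).exists_isCircleOf hl (by simp)
    have hs := hneg C hC (by simp [hCV])
    rw [h.circleSign_of_loop hl hC] at hs
    refine ⟨deg_eq_two_of_onlyLoopAt hol, IsLink.edge_mem (x := v) (y := v)
      (Or.inr ⟨rfl, rfl, hol⟩), fun _ => 1, ?_⟩
    rintro (_ | f) x y hf
    · rw [suppressSign_none_of_onlyLoopAt hinc]
      simpa using (Int.units_eq_one_or _).resolve_left hs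
    · have hf' : f ∈ E(B) := hf.1.edge_mem
      rw [h.edgeSet_eq_of_isLoopAt hl] at hf'
      obtain rfl : f = e₁ := hf'
      exact absurd hl.inc hf.2
  · obtain ⟨g, hg, hge⟩ := hC₀.exists_ne hE he₁ hl
    obtain ⟨e₂, hne, he₂⟩ := h.exists_inc_ne he₁ hg hge.symm
    obtain ⟨a, ha⟩ := he₁
    obtain ⟨b, hb⟩ := he₂
    have hnl : ∀ f, ¬ B.IsLoopAt f v := fun f =>
      h.not_isLoopAt ha.edge_mem hb.edge_mem hne.symm
    obtain ⟨C, hC, h1, h2⟩ := h.exists_isCircleOf_of_adjacent hne.symm ha hb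
    have ha' := (IsSubgraph.isLink_iff hC.1 h1).2 ha
    have hb' := (IsSubgraph.isLink_iff hC.1 h2).2 hb
    have hav : v ≠ a := by rintro rfl; exact hnl _ ha
    obtain ⟨e₃, he₃, hinc, -⟩ := hC.2.exists_other (fE hC.1) ha' hav
    obtain rfl : e₂ = e₃ := ((hinc e₂).1 hb'.inc_left).resolve_left hne
    have hall : ∀ f, B.Inc f v ↔ f = e₁ ∨ f = e₂ := by
      refine fun f => ⟨fun hf => ?_, ?_⟩
      -- The bridge that contains a third edge at `v` contains an ear from `v` to another vertex of
      -- `C`. The product of the signs of the three circles of the resulting theta graph is `1`.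
      · by_contra hcon
        have hfC : f ∉ E(C) := fun hfC => hcon ((hinc f).1 ((IsSubgraph.inc_congr hC.1 hfC).2 hf))
        obtain ⟨w, hw⟩ := hf
        obtain ⟨D, hD, -, hvD⟩ := Graph.exists_isBridgeOf hw ha'.left_mem hfC
          (by rintro rfl; exact hnl _ hw)
        obtain ⟨x, hx, hxv⟩ : ∃ x ∈ C.attachments D, v ≠ x := by
          obtain ⟨x, hx, y, hy, hxy⟩ := hD.exists_ne_attachments h
            (fun x hx => hc.exists_inc ha.edge_mem hx) hC.1 hC.2.edgeSet_nonempty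
          by_cases hvx : v = x
          · exact ⟨y, hy, fun hh => hxy (hvx.symm.trans hh)⟩
          · exact ⟨x, hx, hvx⟩
        obtain ⟨X, F, hEar, -⟩ := hD.exists_isEar hC.1 hvD hx hxv
        obtain ⟨Y₁, K₁, Y₂, K₂, hK₁, hK₂, -, -, hKE, hKd⟩ :=
          hC.2.exists_arcs (fV hC.1) (fE hC.1) hvD.2 hx.2 hxv
        obtain ⟨D₁, hD₁, hV₁, -, hs₁⟩ := hEar.exists_isCircleOf (σ := σ) hC.1 hK₁
        obtain ⟨D₂, hD₂, hV₂, -, hs₂⟩ := hEar.exists_isCircleOf (σ := σ) hC.1 hK₂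
        have n0 := hneg C hC ha'.left_mem
        have n1 := hneg D₁ hD₁ (hV₁ ▸ Or.inl hEar.pathOn.left_mem)
        have n2 := hneg D₂ hD₂ (hV₂ ▸ Or.inl hEar.pathOn.left_mem)
        rw [circleSign_eq_sgn, ← hKE, sgn_union hK₁.finite_edges hK₂.finite_edges hKd] at n0
        rw [hs₁] at n1
        rw [hs₂] at n2
        have key : ∀ p q r : ℤˣ, q * r ≠ 1 → p * q ≠ 1 → p * r ≠ 1 → False := by decide
        exact key _ _ _ n0 n1 n2
      · rintro (rfl | rfl)
        exacts [ha.inc_left, hb.inc_left]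
    have hL : B.LinksAt v a b e₁ e₂ := ⟨hne.symm, hall, ha, hb, hav.symm,
      by rintro rfl; exact hnl _ hb⟩
    obtain ⟨fV', fE'⟩ := hL.finite_suppress hV hE
    obtain ⟨hC', hn, -⟩ := hL.isCircleOf_suppress (σ := σ) hV hE hC ha'.left_mem
    refine ⟨deg_eq_two_of_pair hne.symm hall (hnl _) (hnl _),
      (hL.edgeNonsep_suppress h).isBalancingEdge fV' fE' hC' hn ?_⟩
    intro D hD hnD
    obtain ⟨C₁, hC₁, hv₁, rfl⟩ := hL.exists_isCircleOf hV hE hD hnD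
    rw [(hL.isCircleOf_suppress hV hE hC₁ hv₁).2.2]
    exact hneg C₁ hC₁ hv₁

/-- The converse of `EdgeNonsep.hasOnlyNegForm`. -/
lemma HasOnlyNegForm.circleSign_ne (hneg : HasOnlyNegForm σ B v) (h : B.EdgeNonsep)
    (hV : V(B).Finite) (hE : E(B).Finite) (hC : C.IsCircleOf B) (hv : v ∈ V(C)) :
    circleSign σ C ≠ 1 := by
  rcases onlyLoopAt_or_linksAt hE hneg.1 with ⟨e, he, hl⟩ | ⟨a, b, e₁, e₂, hL⟩
  · obtain ⟨-, ζ, hζ⟩ := hneg.2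
    have := (hζ none v v (Or.inr ⟨rfl, rfl, e, he, hl⟩)).2 rfl
    rw [suppressSign_none_of_onlyLoopAt he] at this
    rw [h.circleSign_of_loop hl hC]
    have key : ∀ p q : ℤˣ, p * q * p = -1 → q ≠ 1 := by decide
    exact key _ _ this
  · obtain ⟨hC', hn, hs⟩ := hL.isCircleOf_suppress (σ := σ) hV hE hC hv
    obtain ⟨fV', fE'⟩ := hL.finite_suppress hV hE
    rw [← hs, hneg.2.circleSign_eq fV' fE' hC' hn]
    decide

end NoPositive

/-! ### Blocks with exactly one positive circle through a vertex -/

section OnePositive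

variable {α β : Type*} {B C C₀ D D' : Graph α β} {x v w : α} {e f : β} {σ : β → ℤˣ} {n i j k : ℕ}
  {c : ℕ → α} {ε : ℕ → β} {X X' : Set α} {F F' : Set β}

/-- A positive circle, considered as a graph, is balanced. -/
lemma isBalanced_of_isCircle (hC : C.IsCircle) (hE : E(C).Finite) (h : circleSign σ C = 1) :
    IsBalanced σ C := by
  intro D hD
  rw [hC.eq_of_le hE hD.1 hD.2, h]

/-- In a balanced block there is no bridge, since it would give a second circle through `v`. -/
lemma IsPosVertexBattery.eq_of_isBalanced (h : IsPosVertexBattery σ B v C) (hB : B.EdgeNonsep)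
    (hc : B.IsConn) (hV : V(B).Finite) (hE : E(B).Finite) (hbal : IsBalanced σ B) : B = C := by
  obtain ⟨⟨hC, -, hv⟩, huniq⟩ := h
  obtain ⟨e, he⟩ := hC.2.edgeSet_nonempty
  have hiso : ∀ x ∈ V(B), ∃ e, B.Inc e x := fun x hx =>
    hc.exists_inc (IsSubgraph.edgeSet_mono hC.1 he) hx
  have hEE : E(C) = E(B) := by
    by_contra hne
    obtain ⟨D, hD⟩ := hB.exists_isBridgeOf hC.1 ⟨e, he⟩ hne
    obtain ⟨x, hx, y, hy, hxy⟩ := hD.exists_ne_attachments hB hiso hC.1 ⟨e, he⟩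
    obtain ⟨X, F, hEar, -⟩ := hD.exists_isEar hC.1 hx hy hxy
    obtain ⟨Y₁, K₁, Y₂, K₂, hK₁, hK₂, hY, -⟩ :=
      hC.2.exists_arcs (hV.subset (IsSubgraph.vertexSet_mono hC.1))
        (hE.subset (IsSubgraph.edgeSet_mono hC.1)) hx.2 hy.2 hxy
    have key : ∀ Y K, C.PathOn x y Y K → v ∉ Y := by
      intro Y K hYK hvY
      obtain ⟨D, hD, hDV, hDE, -⟩ := hEar.exists_isCircleOf (σ := σ) hC.1 hYK
      have hDC := huniq D hD (hbal D hD) (hDV ▸ Or.inr hvY)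
      obtain ⟨f, hf⟩ := hEar.pathOn.nonempty hxy
      exact Set.disjoint_left.1 hEar.disj hf (hDC ▸ hDE ▸ Or.inl hf)
    rcases (hY ▸ hv : v ∈ Y₁ ∪ Y₂) with hv | hv
    exacts [key _ _ hK₁ hv, key _ _ hK₂ hv]
  exact eq_of_edgeSet_eq le_rfl hC.1 hiso (fun x hx => hC.2.exists_inc hx) hEE.symm

lemma IsPosVertexBattery.isPosEdgeBattery (h : IsPosVertexBattery σ B v C) (he : e ∈ E(C))
    (hv : B.Inc e v) : IsPosEdgeBattery σ B e C :=
  ⟨⟨h.1.1, h.1.2.1, he⟩, fun C' hC' hs heC' =>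
    h.2 C' hC' hs ((IsSubgraph.inc_congr hC'.1 heC').2 hv).vertex_mem⟩

namespace EnumBattery

/-- If all positive circles through `c 0` equal `C`, there are no two disjoint ears, one of which
starts at `c 0` and spans a larger interval than the other: they would form a positive circle with
the two remaining parts of this interval. -/
lemma false_of_two_ears (h : EnumBattery σ B C n c ε)
    (huniq : ∀ C', C'.IsCircleOf B → circleSign σ C' = 1 → c 0 ∈ V(C') → C' = C)
    (h₀ : B.IsEar C (c 0) (c k) X F)
    (h₁ : B.IsEar C (c i) (c j) X' F') (hX : X ∩ X' ⊆ V(C)) (hF : Disjoint F F') (hij : i < j)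
    (hjk : j ≤ k) (hk : k ≤ n) : False := by
  obtain ⟨A, hA, -, hsA⟩ := h.exists_pathOn σ (Nat.zero_le n) (show i ≤ n by omega)
  obtain ⟨Z, hZ, -, hsZ⟩ := h.exists_pathOn σ (show j ≤ n by omega) hk
  rw [Set.uIcc_of_le (Nat.zero_le i)] at hA
  rw [Set.uIcc_of_le hjk] at hZ
  have hA' := hA.mono h.le
  have hZ' := hZ.mono h.le
  have e0 : ∀ l ≤ n, c l ∈ X → l = 0 ∨ l = k := fun l hl => h.mem_ear h₀ (by omega) hk hl
  have e1 : ∀ l ≤ n, c l ∈ X' → l = i ∨ l = j := fun l hl =>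
    h.mem_ear h₁ (by omega) (by omega) hl
  have d1 : c '' Set.Icc 0 i ∩ X' ⊆ {c i} := by
    rintro _ ⟨⟨l, hl, rfl⟩, hlX⟩
    have := hl.2
    rcases e1 l (by omega) hlX with rfl | rfl
    · rfl
    · omega
  have p1 := hA'.append h₁.pathOn d1
  have d2 : (c '' Set.Icc 0 i ∪ X') ∩ c '' Set.Icc j k ⊆ {c j} := by
    rintro _ ⟨hl1, ⟨l, hl, rfl⟩⟩
    have hl2 := hl.1
    rcases hl1 with hl1 | hl1
    · rw [h.mem_image_iff (fun m hm => hm.2.trans (by omega)) (hl.2.trans hk)] at hl1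
      have := hl1.2
      omega
    · rcases e1 l (hl.2.trans hk) hl1 with rfl | rfl
      · omega
      · rfl
  have p2 := p1.append hZ' d2
  obtain ⟨D, hD, hDV, hDE⟩ := h₀.pathOn.exists_isCircleOf_union p2 h₀.ne (by
      rintro t ⟨ht, ht'⟩
      have htC : t ∈ V(C) := by
        rcases ht' with (⟨l, hl, rfl⟩ | ht') | ⟨l, hl, rfl⟩
        · exact h.mem (hl.2.trans (by omega))
        · exact hX ⟨ht, ht'⟩
        · exact h.mem (hl.2.trans hk)
      exact h₀.inter ⟨ht, htC⟩) (by
      rw [Set.disjoint_union_right, Set.disjoint_union_right]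
      exact ⟨⟨h₀.disj.mono_right hA.subset_edgeSet, hF⟩, h₀.disj.mono_right hZ.subset_edgeSet⟩)
  have key : ∀ p q r : ℤˣ, -(1 * r) * (1 * p * -(p * q) * (q * r)) = 1 := by decide
  have hDC := huniq D hD (by
    rw [circleSign_eq_sgn, hDE, sgn_union h₀.pathOn.finite_edges p2.finite_edges,
      sgn_append p1 hZ' d2, sgn_append hA' h₁.pathOn d1, hsA, hsZ, h.sgn_ear h₀ (by omega) hk,
      h.sgn_ear h₁ (by omega) (by omega), pot_zero, key]
    rw [Set.disjoint_union_right, Set.disjoint_union_right]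
    exact ⟨⟨h₀.disj.mono_right hA.subset_edgeSet, hF⟩, h₀.disj.mono_right hZ.subset_edgeSet⟩)
    (hDV ▸ Or.inl h₀.pathOn.left_mem)
  obtain ⟨f, hf⟩ := h₀.pathOn.nonempty h₀.ne
  exact Set.disjoint_left.1 h₀.disj hf (hDC ▸ hDE ▸ Or.inl hf)

/-- If all positive circles through `c 0` equal `C`, at most one bridge of `C` is attached at
`c 0`, and if there is one, it is the only bridge. -/
lemma bridge_unique (h : EnumBattery σ B C n c ε)
    (huniq : ∀ C', C'.IsCircleOf B → circleSign σ C' = 1 → c 0 ∈ V(C') → C' = C)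
    (hB : B.EdgeNonsep)
    (hiso : ∀ x ∈ V(B), ∃ e, B.Inc e x) (hD : B.IsBridgeOf C D) (hD' : B.IsBridgeOf C D')
    (h0 : c 0 ∈ C.attachments D) : D' = D := by
  by_contra hne
  obtain ⟨i, k, hik, hk, hA⟩ := h.exists_attachments hB hiso hD
  obtain ⟨j, l, hjl, hl, hA'⟩ := h.exists_attachments hB hiso hD'
  have hi : i = 0 := by
    rw [hA] at h0
    rcases h0 with hh | hh
    · exact (h.inj _ (by omega) _ (by omega) hh).symm
    · have := h.inj _ (by omega) _ hk hh
      omega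
  subst hi
  have hcne : ∀ {i j : ℕ}, i < j → j ≤ n → c i ≠ c j := fun hij hj hh => by
    have := h.inj _ (by omega) _ hj hh
    omega
  obtain ⟨X, F, hEar, hX, hF⟩ :=
    hD.exists_isEar h.le (hA ▸ Or.inl rfl) (hA ▸ Or.inr rfl) (hcne hik hk)
  obtain ⟨X', F', hEar', hX', hF'⟩ :=
    hD'.exists_isEar h.le (hA' ▸ Or.inl rfl) (hA' ▸ Or.inr rfl) (hcne hjl hl)
  have hXC : ∀ t ∈ X, t ∈ X' → t ∈ V(C) := fun t h1 h2 => by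
    by_contra ht
    exact hne (hD'.eq_of_mem hD (hX' h2) (hX h1) ht)
  have hFF : Disjoint F F' := Set.disjoint_left.2 fun f h1 h2 =>
    hne (hD'.eq_of_mem_edgeSet hD (hF' h2) (hF h1))
  rcases h.bridges_nested hD hD' hik hk hA hjl hl hA' with hh | hh
  · exact h.false_of_two_ears huniq hEar hEar' (fun t ht => hXC t ht.1 ht.2) hFF hjl hh.2 hk
  · obtain rfl : j = 0 := by omega
    exact h.false_of_two_ears huniq hEar' hEar (fun t ht => hXC t ht.2 ht.1) hFF.symm hik hh.2 hl

/-- If all positive circles through `c 0` equal `C`, a bridge contains at most one edge at `c 0`: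
two such edges and an edge at the other vertex of attachment can be extended to a tripod, two of
whose legs form a positive circle. -/
lemma bridge_edge_unique (h : EnumBattery σ B C n c ε)
    (huniq : ∀ C', C'.IsCircleOf B → circleSign σ C' = 1 → c 0 ∈ V(C') → C' = C)
    (hB : B.EdgeNonsep)
    (hiso : ∀ x ∈ V(B), ∃ e, B.Inc e x) (hD : B.IsBridgeOf C D) {f₁ f₂ : β} (hf₁ : f₁ ∈ E(D))
    (hf₂ : f₂ ∈ E(D)) (h₁ : B.Inc f₁ (c 0)) (h₂ : B.Inc f₂ (c 0)) : f₁ = f₂ := by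
  rcases hD.2 with ⟨d, x, y, hd, -, hED⟩ | ⟨K, hK, hV, hED⟩
  · rw [hED] at hf₁ hf₂
    exact (hf₁ : f₁ = d).trans (hf₂ : f₂ = d).symm
  · have hK' : K.IsComponent (B.deleteVerts V(C)) := hK
    by_contra hne
    have h0C : c 0 ∈ V(C) := h.mem (Nat.zero_le n)
    have h0K : c 0 ∉ V(K) := fun hh => hK'.notMem hh h0C
    have hend : ∀ f ∈ E(D), B.Inc f (c 0) → ∃ s ∈ V(K), B.IsLink f s (c 0) := by
      intro f hf hf0
      rw [hED] at hf
      obtain ⟨s, hs, t, ht⟩ := hf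
      have : c 0 = t := hf0.eq_of_isLink_of_ne_left ht (by rintro hh; exact h0K (hh ▸ hs))
      exact ⟨s, hs, this ▸ ht⟩
    obtain ⟨s₁, hs₁, l₁⟩ := hend f₁ hf₁ h₁
    obtain ⟨s₂, hs₂, l₂⟩ := hend f₂ hf₂ h₂
    obtain ⟨w, hw, hw0⟩ : ∃ w ∈ C.attachments D, c 0 ≠ w := by
      obtain ⟨x, hx, y, hy, hxy⟩ := hD.exists_ne_attachments hB hiso h.le ⟨ε n, h.edge_mem le_rfl⟩
      by_cases hvx : c 0 = x
      · exact ⟨y, hy, fun hh => hxy (hvx.symm.trans hh)⟩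
      · exact ⟨x, hx, hvx⟩
    have hw' := hw.1
    rw [hV] at hw'
    obtain ⟨s₃, hs₃, g, l₃⟩ := hw'.resolve_left fun hh => hK'.notMem hh hw.2
    obtain ⟨q, X₁, F₁, X₂, F₂, X₃, F₃, p₁, p₂, p₃, hX₁, hX₂, hX₃, h₁₂, h₁₃, h₂₃⟩ :=
      hK'.exists_tripod hs₁ hs₂ hs₃
    obtain ⟨E₁₃, D₁₃⟩ := hK'.isEar h.le p₁ p₃ hX₁ hX₃ h₁₃ l₁ l₃ hw0 h0C hw.2
    obtain ⟨E₂₃, D₂₃⟩ := hK'.isEar h.le p₂ p₃ hX₂ hX₃ h₂₃ l₂ l₃ hw0 h0C hw.2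
    obtain ⟨k, hk, rfl⟩ := h.surj w hw.2
    have s₁₃ := h.sgn_ear E₁₃ (Nat.zero_le n) hk
    have s₂₃ := h.sgn_ear E₂₃ (Nat.zero_le n) hk
    have n₁ : f₁ ∉ F₁ := fun hh => h0K (hX₁ (p₁.mem_of_inc hh h₁))
    have n₂ : f₂ ∉ F₂ := fun hh => h0K (hX₂ (p₂.mem_of_inc hh h₂))
    rw [sgn_union (p₁.finite_edges.insert _) (p₃.finite_edges.insert _) D₁₃,
      sgn_insert p₁.finite_edges n₁] at s₁₃
    rw [sgn_union (p₂.finite_edges.insert _) (p₃.finite_edges.insert _) D₂₃,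
      sgn_insert p₂.finite_edges n₂] at s₂₃
    have p₁₂ := p₁.reverse.append p₂ h₁₂
    have h0X : c 0 ∉ X₁ ∪ X₂ := by
      rintro (hh | hh)
      exacts [h0K (hX₁ hh), h0K (hX₂ hh)]
    have hnF : f₁ ∉ F₁ ∪ F₂ := fun hh => h0X (p₁₂.mem_of_inc hh h₁)
    have hnF' : f₂ ∉ insert f₁ (F₁ ∪ F₂) := by
      rintro (hh | hh)
      exacts [hne hh.symm, h0X (p₁₂.mem_of_inc hh h₂)]
    -- The legs that start with `f₁` and `f₂` have the same sign, as each of them forms an ear with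
    -- the third leg. So together they form a positive circle through `c 0`.
    obtain ⟨D', hD', hDV, hDE⟩ := (PathOn.cons l₁.symm p₁₂ h0X).exists_isCircleOf l₂.symm hnF'
    have key : ∀ p q r s t u : ℤˣ, p * q * r = u → s * t * r = u → s * (p * (q * t)) = 1 := by
      decide
    have hDC := huniq D' hD' (by
      rw [circleSign_eq_sgn, hDE, sgn_insert (p₁₂.finite_edges.insert _) hnF',
        sgn_insert p₁₂.finite_edges hnF, sgn_append p₁.reverse p₂ h₁₂]
      exact key _ _ _ _ _ _ s₁₃ s₂₃) (by simp [hDV])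
    exact hD.notMem_edgeSet h.le hf₁ (hDC ▸ hDE ▸ by simp)

end EnumBattery

end OnePositive

/-! ### The three forms of a block with one positive circle through a vertex -/

section Forms

variable {α β : Type*} {B C C' D : Graph α β} {x v : α} {e f g : β} {σ : β → ℤˣ}

/-- In an unbalanced nonseparable graph with a positive circle there are no loops, since a loop
would be the only edge. -/
lemma EdgeNonsep.not_isLoopAt_of_not_isBalanced (hB : B.EdgeNonsep) (hbal : ¬ IsBalanced σ B)
    (hC : C.IsCircleOf B) (hs : circleSign σ C = 1) : ¬ B.IsLoopAt g x := fun hg =>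
  hbal fun _ hC' =>
    (hB.circleSign_of_loop hg hC').trans ((hB.circleSign_of_loop hg hC).symm.trans hs)

lemma edgeSet_ne_of_not_isBalanced (hc : B.IsConn) (hE : E(B).Finite) (hbal : ¬ IsBalanced σ B)
    (hC : C.IsCircleOf B) (hs : circleSign σ C = 1) : E(C) ≠ E(B) := by
  intro hEE
  obtain ⟨e, he⟩ := hC.2.edgeSet_nonempty
  have hBC : B = C := eq_of_edgeSet_eq le_rfl hC.1
    (fun x hx => hc.exists_inc (IsSubgraph.edgeSet_mono hC.1 he) hx)
    (fun x hx => hC.2.exists_inc hx) hEE.symm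
  subst hBC
  exact hbal (isBalanced_of_isCircle hC.2 hE hs)

lemma IsCircleOf.ncard_incidenceSet (hC : C.IsCircleOf B) (hl : ∀ g, ¬ B.IsLoopAt g v)
    (hv : v ∈ V(C)) : (C.incidenceSet v).ncard = 2 := by
  have h0 : C.loopSet v = ∅ :=
    Set.eq_empty_of_forall_notMem fun g hg => hl g (IsLink.mono hC.1 hg)
  have := hC.2.2 v hv
  rwa [deg, h0, Set.ncard_empty, add_zero] at this

/-- Two circles through a vertex of degree three share an edge, if there are no loops. -/
lemma IsCircleOf.exists_common_edge (hC : C.IsCircleOf B) (hC' : C'.IsCircleOf B)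
    (hE : E(B).Finite) (hl : ∀ g, ¬ B.IsLoopAt g v) (hv : v ∈ V(C)) (hv' : v ∈ V(C'))
    (hd : B.deg v = 3) : ∃ e ∈ E(C), e ∈ E(C') := by
  by_contra! hcon
  have hfin : (B.incidenceSet v).Finite := hE.subset (B.incidenceSet_subset_edgeSet v)
  have h₁ : C.incidenceSet v ⊆ B.incidenceSet v := fun g hg => hg.mono hC.1
  have h₂ : C'.incidenceSet v ⊆ B.incidenceSet v := fun g hg => hg.mono hC'.1
  have hdisj : Disjoint (C.incidenceSet v) (C'.incidenceSet v) := Set.disjoint_left.2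
    fun g hg hg' => hcon g hg.edge_mem hg'.edge_mem
  have hU := Set.ncard_union_eq hdisj (hfin.subset h₁) (hfin.subset h₂)
  have hle := Set.ncard_le_ncard (Set.union_subset h₁ h₂) hfin
  rw [hU, hC.ncard_incidenceSet hl hv, hC'.ncard_incidenceSet hl hv'] at hle
  unfold deg at hd
  omega

/-- If `v` is a vertex of attachment of the only bridge of `C`, and this bridge has two vertices of
attachment, then every circle that meets `C` in an edge equals `C` or passes through `v`, because it
can leave `C` only at these two vertices. -/
lemma IsCircleOf.eq_or_mem_of_common_edge (hC : C.IsCircleOf B) (hC' : C'.IsCircleOf B)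
    (hV : V(B).Finite) (hE : E(B).Finite) (hl : ∀ g x, ¬ B.IsLoopAt g x)
    (hD : ∀ D', B.IsBridgeOf C D' → D' = D) (hA : (C.attachments D).ncard = 2)
    (hv : v ∈ C.attachments D) (he : e ∈ E(C)) (he' : e ∈ E(C')) : C' = C ∨ v ∈ V(C') := by
  by_cases hsub : E(C') ⊆ E(C)
  · left
    refine hC.2.eq_of_le (hE.subset (IsSubgraph.edgeSet_mono hC.1)) ?_ hC'.2
    refine ⟨fun x hx => ?_, fun f x y hf => ?_⟩
    · obtain ⟨f, hf⟩ := hC'.2.exists_inc hx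
      exact ((IsSubgraph.inc_congr hC.1 (hsub hf.edge_mem)).2 (hf.mono hC'.1)).vertex_mem
    · exact (IsSubgraph.isLink_iff hC.1 (hsub hf.edge_mem)).2 (hf.mono hC'.1)
  · right
    have hne : E(C') ∩ E(C) ≠ E(C') := fun h => hsub (h ▸ Set.inter_subset_right)
    obtain ⟨x, y, hxy, hx, hy⟩ := hC'.2.edgeNonsep
      (hV.subset (IsSubgraph.vertexSet_mono hC'.1)) (hE.subset (IsSubgraph.edgeSet_mono hC'.1))
      _ Set.inter_subset_left ⟨e, he', he⟩ hne
    have key : ∀ x, C'.IsShared (E(C') ∩ E(C)) x → x ∈ V(C') ∧ x ∈ C.attachments D := by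
      rintro x ⟨⟨f, ⟨-, hfC⟩, hf⟩, g, hg, t, ht⟩
      have hgC : g ∉ E(C) := fun h => hg ⟨ht.edge_mem, h⟩
      have hxC := ((IsSubgraph.inc_congr hC.1 hfC).2 (hf.mono hC'.1)).vertex_mem
      obtain ⟨D', hD', -, hx⟩ := exists_isBridgeOf (ht.mono hC'.1) hxC hgC (by
        rintro rfl
        exact hl g x (ht.mono hC'.1))
      exact ⟨ht.left_mem, hD D' hD' ▸ hx⟩
    obtain ⟨p, q, -, hpq⟩ := Set.ncard_eq_two.1 hA
    have hx' := (key x hx).2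
    have hy' := (key y hy).2
    rw [hpq] at hx' hy' hv
    have : v = x ∨ v = y := by
      rcases hx' with rfl | rfl <;> rcases hy' with rfl | rfl <;> rcases hv with rfl | rfl <;>
        simp_all
    rcases this with rfl | rfl
    exacts [(key _ hx).1, (key _ hy).1]

/-- In an unbalanced block in which `v` has degree other than two, the bridge of `C` at `v` is the
only bridge, and it contains exactly one edge at `v`, so `v` has degree three. -/
lemma IsPosVertexBattery.exists_bridge (h : IsPosVertexBattery σ B v C) (hB : B.EdgeNonsep)
    (hc : B.IsConn) (hV : V(B).Finite) (hE : E(B).Finite) (hbal : ¬ IsBalanced σ B)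
    (hd : B.deg v ≠ 2) :
    B.deg v = 3 ∧ ∃ D, (∀ D', B.IsBridgeOf C D' ↔ D' = D) ∧ v ∈ C.attachments D := by
  obtain ⟨⟨hC, hs, hv⟩, huniq⟩ := id h
  have hl : ∀ g x, ¬ B.IsLoopAt g x := fun g x => hB.not_isLoopAt_of_not_isBalanced hbal hC hs
  obtain ⟨e, he⟩ := hC.2.exists_inc hv
  obtain ⟨y, hey⟩ := id he
  obtain ⟨n, c, ε, hcyc, rfl, rfl, hn⟩ := hC.2.exists_cycEnum
    (hV.subset (IsSubgraph.vertexSet_mono hC.1)) (hE.subset (IsSubgraph.edgeSet_mono hC.1)) hey (by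
      rintro rfl
      exact hl _ _ (hey.mono hC.1))
  have hEB := (h.isPosEdgeBattery he.edge_mem (he.mono hC.1)).enumBattery hcyc rfl
  have hiso : ∀ x ∈ V(B), ∃ e, B.Inc e x := fun x hx =>
    hc.exists_inc (IsSubgraph.edgeSet_mono hC.1 he.edge_mem) hx
  have hloop : B.loopSet (c 0) = ∅ := Set.eq_empty_of_forall_notMem fun g hg => hl g _ hg
  have hdeg : B.deg (c 0) = (B.incidenceSet (c 0)).ncard := by
    rw [deg, hloop, Set.ncard_empty, add_zero]
  have hsub : C.incidenceSet (c 0) ⊆ B.incidenceSet (c 0) := fun g hg => hg.mono hC.1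
  have h2 := hC.ncard_incidenceSet (fun g => hl g _) hv
  obtain ⟨f, hf, hfC⟩ : ∃ f ∈ B.incidenceSet (c 0), f ∉ C.incidenceSet (c 0) := by
    by_contra! hcon
    rw [hdeg, Set.Subset.antisymm hcon hsub, h2] at hd
    exact hd rfl
  have hbridge : ∀ g ∈ B.incidenceSet (c 0), g ∉ C.incidenceSet (c 0) →
      ∃ D, B.IsBridgeOf C D ∧ g ∈ E(D) ∧ c 0 ∈ C.attachments D := by
    rintro g ⟨t, ht⟩ hg
    refine exists_isBridgeOf ht hv
      (fun hgC => hg ((IsSubgraph.inc_congr hC.1 hgC).2 ht.inc_left)) ?_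
    intro hh
    rw [← hh] at ht
    exact hl _ _ ht
  obtain ⟨D, hD, hfD, h0⟩ := hbridge f hf hfC
  have hDu : ∀ D', B.IsBridgeOf C D' → D' = D := fun D' hD' =>
    hEB.bridge_unique huniq hB hiso hD hD' h0
  refine ⟨?_, D, fun D' => ⟨hDu D', fun hh => hh ▸ hD⟩, h0⟩
  have hI : B.incidenceSet (c 0) = insert f (C.incidenceSet (c 0)) := by
    refine (Set.insert_subset hf hsub).antisymm' fun g hg => ?_
    by_cases hgC : g ∈ C.incidenceSet (c 0)
    · exact Or.inr hgC
    · obtain ⟨D', hD', hgD, -⟩ := hbridge g hg hgC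
      rw [hDu D' hD'] at hgD
      exact Or.inl (hEB.bridge_edge_unique huniq hB hiso hD hgD hfD hg hf)
  rw [hdeg, hI, Set.ncard_insert_of_notMem hfC
    ((hE.subset (B.incidenceSet_subset_edgeSet _)).subset hsub), h2]

/-- In a connected nonseparable graph, `C` is the unique positive circle through `v` precisely
in the three cases of `HasOnePosForm`. -/
theorem EdgeNonsep.isPosVertexBattery_iff (hB : B.EdgeNonsep) (hc : B.IsConn) (hV : V(B).Finite)
    (hE : E(B).Finite) (hvB : v ∈ V(B)) :
    IsPosVertexBattery σ B v C ↔ HasOnePosForm σ B v C := by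
  constructor
  · intro h
    obtain ⟨⟨hC, hs, hv⟩, huniq⟩ := id h
    refine ⟨hC, ?_⟩
    by_cases hbal : IsBalanced σ B
    · exact Or.inl ⟨h.eq_of_isBalanced hB hc hV hE hbal, hbal⟩
    have hl : ∀ g x, ¬ B.IsLoopAt g x := fun g x => hB.not_isLoopAt_of_not_isBalanced hbal hC hs
    have hiso : ∀ x ∈ V(B), ∃ e, B.Inc e x := fun x hx => by
      obtain ⟨e, he⟩ := hC.2.edgeSet_nonempty
      exact hc.exists_inc (IsSubgraph.edgeSet_mono hC.1 he) hx
    have hne := edgeSet_ne_of_not_isBalanced hc hE hbal hC hs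
    right
    by_cases hd : B.deg v = 2
    · refine Or.inl ⟨hbal, hd, ?_⟩
      obtain ⟨a, b, e₁, e₂, hL⟩ := (onlyLoopAt_or_linksAt hE hd).resolve_left
        fun ⟨e, _, he⟩ => hl e v he
      obtain ⟨fV, fE⟩ := hL.finite_suppress hV hE
      obtain ⟨hC', hn, hs'⟩ := hL.isCircleOf_suppress (σ := σ) hV hE hC hv
      have hbat : IsPosEdgeBattery (suppressSign σ B v) (B.suppress v) none (C.suppress v) := by
        refine ⟨⟨hC', hs'.trans hs, hn⟩, fun D hD hDs hnD => ?_⟩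
        obtain ⟨C₁, hC₁, hv₁, rfl⟩ := hL.exists_isCircleOf hV hE hD hnD
        rw [huniq C₁ hC₁ ((hL.isCircleOf_suppress hV hE hC₁ hv₁).2.2.symm.trans hDs) hv₁]
      refine ⟨hbat.isLayered fV fE (hL.edgeNonsep_suppress hB)
        (hL.exists_inc_of_mem_suppress hiso) fun hEE => hne ?_, hbat⟩
      -- `C ↓ v` does not contain all edges of `B ↓ v`, since `C` does not contain all edges of `B`
      have hLC := hL.of_isCircleOf hE hC hv
      rw [hL.edgeSet_suppress, hLC.edgeSet_suppress] at hEE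
      refine (IsSubgraph.edgeSet_mono hC.1).antisymm fun g hg => ?_
      by_cases hg' : g = e₁ ∨ g = e₂
      · rcases hg' with rfl | rfl
        exacts [hLC.left.edge_mem, hLC.right.edge_mem]
      · have : some g ∈ insert none (some '' (E(C) \ {e₁, e₂})) := by
          rw [hEE]
          exact Or.inr ⟨g, ⟨hg, hg'⟩, rfl⟩
        simp only [Set.mem_insert_iff, reduceCtorEq, false_or] at this
        obtain ⟨g', hg', hh⟩ := this
        exact Option.some.inj hh ▸ hg'.1
    · obtain ⟨hd3, D, hD, hvD⟩ := h.exists_bridge hB hc hV hE hbal hd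
      obtain ⟨e, he⟩ := hC.2.exists_inc hv
      have hlay := (h.isPosEdgeBattery he.edge_mem (he.mono hC.1)).isLayered hV hE hB hiso hne
      refine Or.inr ⟨hbal, hd3, hlay, ⟨D, hD, hvD⟩, fun g hg => ⟨⟨hC, hs, hg⟩,
        fun C' hC' hs' hg' => ?_⟩⟩
      rcases hC.eq_or_mem_of_common_edge hC' hV hE hl (fun D' => (hD D').1)
        (hlay.2.1 D ((hD D).2 rfl)) hvD hg hg' with hh | hh
      exacts [hh, huniq C' hC' hs' hh]
  · rintro ⟨hC, ⟨rfl, hbal⟩ | ⟨hbal, hd, -, hbat⟩ | ⟨hbal, hd, -, ⟨D, -, hvD⟩, hbat⟩⟩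
    · exact ⟨⟨hC, hbal _ hC, hvB⟩, fun C' hC' _ _ => hC.2.eq_of_le hE hC'.1 hC'.2⟩
    · obtain ⟨⟨hC', hs, hn⟩, huniq⟩ := hbat
      rcases onlyLoopAt_or_linksAt hE hd with ⟨e, he, hle⟩ | ⟨a, b, e₁, e₂, hL⟩
      -- If `B` is a loop, a positive loop in `B ↓ v` would make `B` balanced.
      · exfalso
        have hEB : ∀ f ∈ E(C.suppress v), f = none := by
          rintro (_ | f) hf
          · rfl
          · obtain ⟨x, y, hxy⟩ := exists_isLink_of_mem_edgeSet (IsSubgraph.edgeSet_mono hC'.1 hf)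
            have hfe : f ∈ E(B) := hxy.1.edge_mem
            rw [hB.edgeSet_eq_of_isLoopAt hle] at hfe
            obtain rfl : f = e := hfe
            exact absurd hle.inc hxy.2
        have hEC : E(C.suppress v) = {none} :=
          Set.Subset.antisymm hEB (Set.singleton_subset_iff.2 hn)
        rw [circleSign_eq_sgn, hEC, sgn_singleton, suppressSign_none_of_onlyLoopAt he] at hs
        exact hbal fun C' hC' => (hB.circleSign_of_loop hle hC').trans hs
      · have hv : v ∈ V(C) := by
          obtain ⟨x, y, hxy⟩ := exists_isLink_of_mem_edgeSet hn
          rcases hxy with ⟨_, _, -, -, hx, -⟩ | ⟨-, -, _, -, hx⟩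
          exacts [hx.left_mem, hx.vertex_mem]
        refine ⟨⟨hC, (hL.isCircleOf_suppress hV hE hC hv).2.2.symm.trans hs, hv⟩,
          fun C₁ hC₁ hs₁ hv₁ => ?_⟩
        obtain ⟨hC₂, hn₂, hs₂⟩ := hL.isCircleOf_suppress (σ := σ) hV hE hC₁ hv₁
        exact hL.suppress_injective hE hC₁ hC hv₁ hv (huniq _ hC₂ (hs₂.trans hs₁) hn₂)
    · obtain ⟨e, he⟩ := hC.2.edgeSet_nonempty
      have hs := (hbat e he).1.2.1
      have hl : ∀ g x, ¬ B.IsLoopAt g x := fun g x => hB.not_isLoopAt_of_not_isBalanced hbal hC hs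
      refine ⟨⟨hC, hs, hvD.2⟩, fun C' hC' hs' hv' => ?_⟩
      obtain ⟨g, hg, hg'⟩ := hC.exists_common_edge hC' hE (fun g => hl g v) hvD.2 hv' hd
      exact (hbat g hg).2 C' hC' hs' hg'

end Forms

end Graph

theorem mainTheorem7 {α β : Type*} (G : Graph α β) (hV : V(G).Finite) (hE : E(G).Finite)
    (σ : β → ℤˣ) (v : α) (hv : v ∈ V(G))
    (hcirc : ∀ B : Graph α β, B.IsBlockOf G → v ∈ V(B) → ∃ C : Graph α β, C.IsCircleOf B) :
    (∀ B C : Graph α β, B.IsBlockOf G → v ∈ V(B) →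
      (Graph.IsPosVertexBattery σ B v C ↔ Graph.HasOnePosForm σ B v C)) ∧
    (∀ C : Graph α β,
      Graph.IsPosVertexBattery σ G v C ↔
        ∃ B : Graph α β, B.IsBlockOf G ∧ v ∈ V(B) ∧ C ≤ B ∧
          Graph.HasOnePosForm σ B v C ∧
          (∀ B' C' : Graph α β, B'.IsBlockOf G → v ∈ V(B') →
            Graph.HasOnePosForm σ B' v C' → B' = B) ∧
          (∀ B' : Graph α β, B'.IsBlockOf G → v ∈ V(B') → B' ≠ B →
            Graph.HasOnlyNegForm σ B' v)) := by
  have fin : ∀ {B : Graph α β}, B.IsBlockOf G → V(B).Finite ∧ E(B).Finite := fun hB =>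
    ⟨hV.subset (Graph.IsSubgraph.vertexSet_mono hB.le),
      hE.subset (Graph.IsSubgraph.edgeSet_mono hB.le)⟩
  have ha : ∀ B C : Graph α β, B.IsBlockOf G → v ∈ V(B) →
      (Graph.IsPosVertexBattery σ B v C ↔ Graph.HasOnePosForm σ B v C) := fun B C hB hvB =>
    hB.edgeNonsep.isPosVertexBattery_iff hB.isConn (fin hB).1 (fin hB).2 hvB
  refine ⟨ha, fun C => ⟨fun h => ?_, ?_⟩⟩
  · obtain ⟨⟨hC, hs, hvC⟩, huniq⟩ := h
    obtain ⟨B, hB, hCB⟩ := hC.exists_isBlockOf hV hE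
    have hvB := Graph.IsSubgraph.vertexSet_mono hCB hvC
    obtain ⟨e, he⟩ := hC.2.edgeSet_nonempty
    -- A block that contains a positive circle through `v` shares an edge of `C` with `B`.
    have hblock : ∀ B' C' : Graph α β, B'.IsBlockOf G → C'.IsCircleOf B' →
        Graph.circleSign σ C' = 1 → v ∈ V(C') → B' = B := by
      intro B' C' hB' hC' hs' hv'
      obtain rfl := huniq C' (hC'.mono hB'.le) hs' hv'
      exact hB'.eq_of_mem hB (Graph.IsSubgraph.edgeSet_mono hC'.1 he)
        (Graph.IsSubgraph.edgeSet_mono hCB he)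
    refine ⟨B, hB, hvB, hCB, (ha B C hB hvB).1 ⟨⟨⟨hCB, hC.2⟩, hs, hvC⟩,
      fun C' hC' => huniq C' (hC'.mono hB.le)⟩, fun B' C' hB' hvB' h' => ?_,
      fun B' hB' hvB' hne => ?_⟩
    · obtain ⟨⟨hC', hs', hv'⟩, -⟩ := (ha B' C' hB' hvB').2 h'
      exact hblock B' C' hB' hC' hs' hv'
    · obtain ⟨C₀, hC₀⟩ := hcirc B' hB' hvB'
      exact hB'.edgeNonsep.hasOnlyNegForm hB'.isConn (fin hB').1 (fin hB').2 hC₀ hvB'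
        fun C' hC' hv' hs' => hne (hblock B' C' hB' hC' hs' hv')
  · rintro ⟨B, hB, hvB, -, hform, -, hneg⟩
    obtain ⟨⟨hC, hs, hvC⟩, huniq⟩ := (ha B C hB hvB).2 hform
    refine ⟨⟨hC.mono hB.le, hs, hvC⟩, fun C' hC' hs' hv' => ?_⟩
    obtain ⟨B', hB', hCB'⟩ := hC'.exists_isBlockOf hV hE
    by_cases hBB : B' = B
    · subst hBB
      exact huniq C' ⟨hCB', hC'.2⟩ hs' hv'
    · exact absurd hs' ((hneg B' hB' (Graph.IsSubgraph.vertexSet_mono hCB' hv') hBB).circleSign_ne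
        hB'.edgeNonsep (fin hB').1 (fin hB').2 ⟨hCB', hC'.2⟩ hv')
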